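/- Throughout, for probability measures $f,g$ on the Borel sets of $\mathbb R^d$ let $\|f-g\|_1 = 2\sup_{B}|f(B)-g(B)|$, the supremum being over Borel sets $B$ (for densities this is $\int|f-g|$). Let $\mathcal F$ be the class of axis-aligned Gaussians $\mathcal N(\mu,\Sigma)$ on $\mathbb R^d$ ($\mu\in\mathbb R^d$, $\Sigma$ diagonal and positive definite), let $\mathcal F^k=\{\sum_{i=1}^k w_if_i : w_i\ge 0,\ \sum_i w_i=1,\ f_i\in\mathcal F\}$, and let $\mathrm{OPT}(\mathcal F^k,g)=\inf_{f\in\mathcal F^k}\|f-g\|_1$. A learning method is a map that takes $\varepsilon$, $\delta$ and a finite sample of points of $\mathbb R^d$ to a probability measure on $\mathbb R^d$. With sample complexity $m(\varepsilon,\delta)\in\mathbb N$, it is a $C$-agnostic PAC-learner for $\mathcal F^k$ if for every Borel probability measure $g$ on $\mathbb R^d$ and all $\varepsilon,\delta>0$, given $\varepsilon$, $\delta$ and an i.i.d. sample of size $m(\varepsilon,\delta)$ from $g$, with probability at least $1-\delta$ it outputs $\hat g$ with $\|\hat g-g\|_1\le C\cdot\mathrm{OPT}(\mathcal F^k,g)+\varepsilon$;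 it is a realizable PAC-learner for $\mathcal F^k$ if for every $g\in\mathcal F^k$ and all $\varepsilon,\delta>0$, with probability at least $1-\delta$ it outputs $\hat g$ with $\|\hat g-g\|_1\le\varepsilon$. **Theorem.** (1) There is an absolute constant $K>0$ such that for all integers $d\ge1$ and $k\ge2$ there are a learning method and a function $m$ such that the method is, with sample complexity $m$, a $9$-agnostic PAC-learner for $\mathcal F^k$ and also a realizable PAC-learner for $\mathcal F^k$, and $$m(\varepsilon,\delta)\le K\,\frac{kd\,\log k\,\log(k/\delta)}{\varepsilon^4}\qquad\text{for all }\varepsilon>0,\ 0<\delta<1.$$ (2) This is optimal in $k$ and $d$ up to logarithmic factors: there are absolute constants $c,\varepsilon_0>0$ such that for all integers $d,k\ge1$, every realizable PAC-learner for $\mathcal F^k$ with sample complexity $m$ satisfies $$m(\varepsilon,\delta)\ge c\,\frac{kd}{\varepsilon^2}\qquad\text{for all }0<\varepsilon<\varepsilon_0,\ 0<\delta\le\tfrac12.$$ -/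

import Mathlib

open MeasureTheory ProbabilityTheory

noncomputable section

/-- Total variation distance of two probability distributions: the supremum of
`|μ B - ν B|` over all measurable sets `B`. -/
def tvDist {X : Type*} [MeasurableSpace X] (μ ν : ProbabilityMeasure X) : ℝ :=
  ⨆ B : {B : Set X // MeasurableSet B},
    |(μ : Measure X).real (B : Set X) - (ν : Measure X).real (B : Set X)|

/-- The `L₁` distance `‖μ - ν‖₁` of two probability distributions, which is twice their total
variation distance. For distributions with densities `f₁, f₂` it is `∫ |f₁ - f₂|`. -/
def l1Dist {X : Type*} [MeasurableSpace X] (μ ν : ProbabilityMeasure X) : ℝ :=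
  2 * tvDist μ ν

/-- `OPT(F, g) = inf_{f ∈ F} ‖f - g‖₁`, for a nonempty class `F`. -/
def opt {X : Type*} [MeasurableSpace X] (F : Set (ProbabilityMeasure X))
    (g : ProbabilityMeasure X) : ℝ :=
  ⨅ f : F, l1Dist (f : ProbabilityMeasure X) g

/-- `h` is an `ε`-approximation of `g`. -/
def IsApprox {X : Type*} [MeasurableSpace X] (ε : ℝ) (g h : ProbabilityMeasure X) : Prop :=
  l1Dist h g ≤ ε

/-- `h` is an `(ε, C)`-approximation of `g` with respect to the class `F`. -/
def IsAgnosticApprox {X : Type*} [MeasurableSpace X] (F : Set (ProbabilityMeasure X))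
    (ε C : ℝ) (g h : ProbabilityMeasure X) : Prop :=
  l1Dist h g ≤ C * opt F g + ε

/-- A distribution learning method: from `ε`, `δ` and a finite sample of points of `X` it
produces a probability distribution on `X`. -/
abbrev LearningMethod (X : Type*) [MeasurableSpace X] : Type _ :=
  ℝ → ℝ → (n : ℕ) → (Fin n → X) → ProbabilityMeasure X

/-- The law of an i.i.d. sample of size `n` from `g`. -/
abbrev sampleLaw {X : Type*} [MeasurableSpace X] (g : ProbabilityMeasure X) (n : ℕ) :
    Measure (Fin n → X) :=
  Measure.pi fun _ => (g : Measure X)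

/-- `L` is a realizable PAC-learner for `F` with sample complexity `m`: for every `g ∈ F`, on an
i.i.d. sample of size `m ε δ` from `g`, it fails to output an `ε`-approximation of `g` with
probability at most `δ`. (The measure of a set of samples that is not measurable is its outer
measure, so some measurable event of probability at least `1 - δ` implies success.) -/
def IsRealizablePACLearner {X : Type*} [MeasurableSpace X] (F : Set (ProbabilityMeasure X))
    (L : LearningMethod X) (m : ℝ → ℝ → ℕ) : Prop :=
  ∀ g ∈ F, ∀ ε δ : ℝ, 0 < ε → 0 < δ →
    sampleLaw g (m ε δ) {S | ¬ IsApprox ε g (L ε δ (m ε δ) S)} ≤ ENNReal.ofReal δ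

/-- `L` is a `C`-agnostic PAC-learner for `F` with sample complexity `m`: the same for every
probability distribution `g`, with `(ε, C)`-approximations with respect to `F`. -/
def IsAgnosticPACLearner {X : Type*} [MeasurableSpace X] (C : ℝ)
    (F : Set (ProbabilityMeasure X)) (L : LearningMethod X) (m : ℝ → ℝ → ℕ) : Prop :=
  ∀ g : ProbabilityMeasure X, ∀ ε δ : ℝ, 0 < ε → 0 < δ →
    sampleLaw g (m ε δ) {S | ¬ IsAgnosticApprox F ε C g (L ε δ (m ε δ) S)} ≤ ENNReal.ofReal δ

/-- The class of `k`-mixtures `∑ i, w i • f i` of members of `F`, with `w` in the simplex. -/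
def kMixtures {X : Type*} [MeasurableSpace X] (F : Set (ProbabilityMeasure X)) (k : ℕ) :
    Set (ProbabilityMeasure X) :=
  {g | ∃ w ∈ stdSimplex ℝ (Fin k), ∃ f : Fin k → ProbabilityMeasure X,
    (∀ i, f i ∈ F) ∧ (g : Measure X) = ∑ i, ENNReal.ofReal (w i) • (f i : Measure X)}

/-- The class of axis-aligned Gaussians in `ℝ^d`: arbitrary mean, and a covariance matrix that is
diagonal and positive definite (so that there is a Gaussian density). -/
def axisAlignedGaussians (d : ℕ) : Set (ProbabilityMeasure (EuclideanSpace ℝ (Fin d))) :=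
  {g | ∃ (μ : EuclideanSpace ℝ (Fin d)) (S : Matrix (Fin d) (Fin d) ℝ),
    S.IsDiag ∧ S.PosDef ∧ (g : Measure (EuclideanSpace ℝ (Fin d))) = multivariateGaussian μ S}

end

/-! Upper bound. A finite list of candidates is computed from one part of the sample, and one of
them is selected with the other part. Selection compares the candidates on the sets where one of two
has the larger density. These finitely many sets determine all distances between candidates, so by
Hoeffding's inequality and a union bound, picking the candidate with the best worst-case fit costs a
factor 3 and `2 * t` in total variation (`exists_selector`). The price is the logarithm of the
number of candidates, divided by `t ^ 2`.

For the list, let `F` be a mixture close to `g`. The common part of `F` and `g` has mass at least `1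
- tvDist F g` and splits into pieces `ν i ≤ w i • f i` (`exists_submeasures_of_mixture`). Components
of weight below `κ / k` have total weight at most `κ`, and those that keep less than half of their
weight in `ν i` have total weight at most `2 * tvDist F g`. Giving up both kinds yields a candidate
at distance `3 * tvDist F g` plus small errors, and the selection turns this 3 into 9.

For any other component the normalised `ν i` is dominated by twice the Gaussian `f i`. In
standardised coordinates, a duality argument bounds the vectors of means and of second moments minus
one in Euclidean norm, independently of `d`, and anti-concentration bounds each variance from below
(`hasBoundedMoments_of_le`). The points of `g` can be thought of as labelled by the pieces `ν i`. By
Chebyshev's inequality the empirical moments of the points with label `i` are close to those of `ν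
i`, with probability one half in each of `B` independent blocks. The Gaussian with these empirical
moments then differs from `f i` by a correction of bounded Euclidean norm (`exists_correction`). The
learner cannot see the labels, so it lists all labellings of the sample, together with nets for the
corrections and for the weights. The logarithm of the number of candidates is of order `k * d * log
k * log (k / δ) / ε`, and selection divides it by `ε ^ 2`.

Lower bound. Unit-covariance Gaussians are placed around `k` distant centres, with offsets on a grid
indexed by words of length `k * d` over `q` letters. The distance of two such mixtures is at least
of order `ε` times the relative Hamming distance of the words, up to a small tail term
(`hammingDist_le_of_tvDist_le`), so an output that is accurate for several words confines them to a
small Hamming ball. A chi-square change of measure compares every sample law with the law of zero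
offsets, with factor `exp (C * n * ε ^ 2)`. Under that one law the success events have bounded
overlap, hence bounded total probability, while there are `q ^ (k * d)` of them. This forces `n` to
be of order `k * d / ε ^ 2`. -/

/-! ### Total variation distance and reductions between notions of learner. -/

section TotalVariation

variable {X : Type*} [MeasurableSpace X]

lemma abs_measureReal_sub_le_one (μ ν : ProbabilityMeasure X) (B : Set X) :
    |(μ : Measure X).real B - (ν : Measure X).real B| ≤ 1 := by
  have h1 : (μ : Measure X).real B ≤ 1 := measureReal_le_one
  have h2 : (ν : Measure X).real B ≤ 1 := measureReal_le_one
  have h3 : 0 ≤ (μ : Measure X).real B := measureReal_nonneg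
  have h4 : 0 ≤ (ν : Measure X).real B := measureReal_nonneg
  rw [abs_le]; constructor <;> linarith

lemma bddAbove_range_abs_measureReal_sub (μ ν : ProbabilityMeasure X) :
    BddAbove (Set.range fun B : {B : Set X // MeasurableSet B} =>
      |(μ : Measure X).real (B : Set X) - (ν : Measure X).real (B : Set X)|) :=
  ⟨1, by rintro _ ⟨B, rfl⟩; exact abs_measureReal_sub_le_one μ ν B⟩

lemma abs_measureReal_sub_le_tvDist (μ ν : ProbabilityMeasure X) {B : Set X}
    (hB : MeasurableSet B) :
    |(μ : Measure X).real B - (ν : Measure X).real B| ≤ tvDist μ ν :=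
  le_ciSup (bddAbove_range_abs_measureReal_sub μ ν) ⟨B, hB⟩

lemma measureReal_sub_le_tvDist (μ ν : ProbabilityMeasure X) {B : Set X}
    (hB : MeasurableSet B) :
    (μ : Measure X).real B - (ν : Measure X).real B ≤ tvDist μ ν :=
  (le_abs_self _).trans (abs_measureReal_sub_le_tvDist μ ν hB)

lemma tvDist_le {μ ν : ProbabilityMeasure X} {c : ℝ}
    (h : ∀ B, MeasurableSet B → |(μ : Measure X).real B - (ν : Measure X).real B| ≤ c) :
    tvDist μ ν ≤ c := by
  have : Nonempty {B : Set X // MeasurableSet B} := ⟨⟨∅, MeasurableSet.empty⟩⟩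
  exact ciSup_le fun B => h B B.2

/-- Passing to the complement flips the sign of the difference, so a one-sided bound suffices. -/
lemma tvDist_le_of_sub_le {μ ν : ProbabilityMeasure X} {c : ℝ}
    (h : ∀ B, MeasurableSet B → (μ : Measure X).real B - (ν : Measure X).real B ≤ c) :
    tvDist μ ν ≤ c := by
  refine tvDist_le fun B hB => abs_le.2 ⟨?_, h B hB⟩
  have := h Bᶜ hB.compl
  rw [probReal_compl_eq_one_sub hB, probReal_compl_eq_one_sub hB] at this
  linarith

lemma tvDist_nonneg (μ ν : ProbabilityMeasure X) : 0 ≤ tvDist μ ν := by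
  simpa using abs_measureReal_sub_le_tvDist μ ν MeasurableSet.empty

lemma tvDist_le_one (μ ν : ProbabilityMeasure X) : tvDist μ ν ≤ 1 :=
  tvDist_le fun B _ => abs_measureReal_sub_le_one μ ν B

lemma tvDist_comm (μ ν : ProbabilityMeasure X) : tvDist μ ν = tvDist ν μ := by
  simp only [tvDist, abs_sub_comm]

lemma tvDist_self (μ : ProbabilityMeasure X) : tvDist μ μ = 0 :=
  le_antisymm (tvDist_le fun B _ => by simp) (tvDist_nonneg _ _)

lemma tvDist_triangle (μ ν ρ : ProbabilityMeasure X) :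
    tvDist μ ρ ≤ tvDist μ ν + tvDist ν ρ := by
  refine tvDist_le_of_sub_le fun B hB => ?_
  have h1 := measureReal_sub_le_tvDist μ ν hB
  have h2 := measureReal_sub_le_tvDist ν ρ hB
  linarith

lemma l1Dist_nonneg (μ ν : ProbabilityMeasure X) : 0 ≤ l1Dist μ ν := by
  have := tvDist_nonneg μ ν
  unfold l1Dist; linarith

lemma l1Dist_le_two (μ ν : ProbabilityMeasure X) : l1Dist μ ν ≤ 2 := by
  have := tvDist_le_one μ ν
  unfold l1Dist; linarith

lemma opt_nonneg (F : Set (ProbabilityMeasure X)) (g : ProbabilityMeasure X) : 0 ≤ opt F g :=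
  Real.iInf_nonneg fun _ => l1Dist_nonneg _ _

lemma opt_eq_zero_of_mem {F : Set (ProbabilityMeasure X)} {g : ProbabilityMeasure X}
    (hg : g ∈ F) : opt F g = 0 := by
  refine le_antisymm ?_ (opt_nonneg F g)
  have : opt F g ≤ l1Dist g g :=
    ciInf_le (f := fun f : F => l1Dist (f : ProbabilityMeasure X) g)
      ⟨0, by rintro _ ⟨f, rfl⟩; exact l1Dist_nonneg _ _⟩ ⟨g, hg⟩
  simpa [l1Dist, tvDist_self] using this

lemma exists_l1Dist_lt_opt_add {F : Set (ProbabilityMeasure X)} (hF : F.Nonempty)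
    (g : ProbabilityMeasure X) {η : ℝ} (hη : 0 < η) : ∃ f ∈ F, l1Dist f g < opt F g + η := by
  have : Nonempty F := hF.to_subtype
  obtain ⟨f, hf⟩ := exists_lt_of_ciInf_lt (lt_add_of_pos_right (opt F g) hη)
  exact ⟨f, f.2, hf⟩

lemma IsAgnosticPACLearner.isRealizablePACLearner {C : ℝ} {F : Set (ProbabilityMeasure X)}
    {L : LearningMethod X} {m : ℝ → ℝ → ℕ} (h : IsAgnosticPACLearner C F L m) :
    IsRealizablePACLearner F L m := by
  intro g hg ε δ hε hδ
  have := h g ε δ hε hδ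
  simpa [IsAgnosticApprox, IsApprox, opt_eq_zero_of_mem hg] using this

/-- Learners for each accuracy `ε < 2` and confidence `δ < 1` assemble to a learning method;
larger parameters need no sample. -/
lemma exists_isAgnosticPACLearner [Nonempty (ProbabilityMeasure X)] {C : ℝ} (hC : 0 ≤ C)
    (F : Set (ProbabilityMeasure X)) (bound : ℝ → ℝ → ℝ)
    (hbound : ∀ ε δ, 0 < ε → 0 < δ → δ < 1 → 0 ≤ bound ε δ)
    (h : ∀ ε δ : ℝ, 0 < ε → ε < 2 → 0 < δ → δ < 1 →
      ∃ (n : ℕ) (A : (Fin n → X) → ProbabilityMeasure X), (n : ℝ) ≤ bound ε δ ∧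
        ∀ g : ProbabilityMeasure X,
          sampleLaw g n {S | ¬ IsAgnosticApprox F ε C g (A S)} ≤ ENNReal.ofReal δ) :
    ∃ (L : LearningMethod X) (m : ℝ → ℝ → ℕ), IsAgnosticPACLearner C F L m ∧
      ∀ ε δ : ℝ, 0 < ε → 0 < δ → δ < 1 → (m ε δ : ℝ) ≤ bound ε δ := by
  classical
  have h' : ∀ ε δ : ℝ, ∃ (n : ℕ) (A : (Fin n → X) → ProbabilityMeasure X),
      (0 < ε → 0 < δ → ∀ g : ProbabilityMeasure X,
        sampleLaw g n {S | ¬ IsAgnosticApprox F ε C g (A S)} ≤ ENNReal.ofReal δ) ∧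
      (0 < ε → 0 < δ → δ < 1 → (n : ℝ) ≤ bound ε δ) := by
    intro ε δ
    by_cases hc : 0 < ε ∧ ε < 2 ∧ 0 < δ ∧ δ < 1
    · obtain ⟨n, A, hn, hA⟩ := h ε δ hc.1 hc.2.1 hc.2.2.1 hc.2.2.2
      exact ⟨n, A, fun _ _ => hA, fun _ _ _ => hn⟩
    · refine ⟨0, fun _ => Classical.arbitrary _, fun hε hδ g => ?_, fun hε hδ hδ1 => ?_⟩
      · by_cases h2 : ε < 2
        · have h1 : 1 ≤ δ := by
            by_contra hlt
            exact hc ⟨hε, h2, hδ, not_le.1 hlt⟩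
          exact prob_le_one.trans (by simpa using ENNReal.ofReal_le_ofReal h1)
        · have : {S : Fin 0 → X |
              ¬ IsAgnosticApprox F ε C g (Classical.arbitrary (ProbabilityMeasure X))} = ∅ := by
            ext S
            simp only [Set.mem_ofPred_eq, Set.mem_empty_iff_false, iff_false, not_not]
            have h3 := l1Dist_le_two (Classical.arbitrary (ProbabilityMeasure X)) g
            have h4 := mul_nonneg hC (opt_nonneg F g)
            unfold IsAgnosticApprox
            linarith
          rw [this]; simp
      · simpa using hbound ε δ hε hδ hδ1
  choose n A hA hn using h'
  -- A sample whose size is not the prescribed `n ε δ` receives an arbitrary output; this case never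
  -- occurs in the learning guarantee.
  refine ⟨fun ε δ n' S => if e : n ε δ = n' then A ε δ (fun i => S (Fin.cast e i))
    else Classical.arbitrary _, n, ?_, hn⟩
  intro g ε δ hε hδ
  simpa using hA ε δ hε hδ g

end TotalVariation

/-! ### Minimum distance selection among finitely many candidates. -/

section Selection

variable {X : Type*} [MeasurableSpace X]

/-- The fraction of the points of the sample `y` that lie in `A`. -/
noncomputable def empiricalFreq {n : ℕ} (y : Fin n → X) (A : Set X) : ℝ :=
  (∑ i, A.indicator (fun _ => (1 : ℝ)) (y i)) / n

/-- One-sided Hoeffding bound for functions with values in `[-1, 1]` and range of length one. -/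
lemma measureReal_sum_ge_le_exp (g : Measure X) [IsProbabilityMeasure g] (n : ℕ) {φ : X → ℝ}
    (hφ : Measurable φ) {a : ℝ} (hb : ∀ x, φ x ∈ Set.Icc a (a + 1)) {t : ℝ} (ht : 0 ≤ t) :
    (Measure.pi fun _ : Fin n => g).real {y | n * t ≤ ∑ i, (φ (y i) - ∫ x, φ x ∂g)}
      ≤ Real.exp (-(2 * n * t ^ 2)) := by
  have hind : iIndepFun (fun (i : Fin n) (y : Fin n → X) => φ (y i) - ∫ x, φ x ∂g)
      (Measure.pi fun _ : Fin n => g) :=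
    iIndepFun_pi (μ := fun _ : Fin n => g) (X := fun _ x => φ x - ∫ x, φ x ∂g)
      (fun _ => (hφ.sub_const _).aemeasurable)
  have hsub : ∀ i ∈ (Finset.univ : Finset (Fin n)),
      HasSubgaussianMGF (fun y : Fin n → X => φ (y i) - ∫ x, φ x ∂g)
        ((‖(a + 1) - a‖₊ / 2) ^ 2) (Measure.pi fun _ : Fin n => g) := by
    intro i _
    have h1 := hasSubgaussianMGF_of_mem_Icc (μ := Measure.pi fun _ : Fin n => g)
      (X := fun y => φ (y i)) (a := a) (b := a + 1)
      (hφ.comp (measurable_pi_apply i)).aemeasurable (ae_of_all _ fun y => hb _)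
    have h2 : ∫ y, φ (y i) ∂(Measure.pi fun _ : Fin n => g) = ∫ x, φ x ∂g :=
      integral_comp_eval (μ := fun _ : Fin n => g) (i := i) hφ.aestronglyMeasurable
    rwa [h2] at h1
  have := HasSubgaussianMGF.measure_sum_ge_le_of_iIndepFun hind hsub (ε := n * t) (by positivity)
  refine this.trans (Real.exp_le_exp.2 ?_)
  have h4 : ∑ i : Fin n, ((‖(a + 1) - a‖₊ / 2) ^ 2 : NNReal) = (n : NNReal) * (1 / 4) := by
    simp only [add_sub_cancel_left, nnnorm_one, Finset.sum_const, Finset.card_univ,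
      Fintype.card_fin, nsmul_eq_mul]
    congr 1
    rw [div_pow]; norm_num
  rw [h4]
  push_cast
  rcases Nat.eq_zero_or_pos n with rfl | hn
  · simp
  · have : (0 : ℝ) < n := by exact_mod_cast hn
    apply le_of_eq
    field_simp
    ring

/-- Hoeffding's inequality for empirical frequencies. -/
lemma measure_lt_abs_empiricalFreq_sub_le (g : Measure X) [IsProbabilityMeasure g] (n : ℕ)
    {A : Set X} (hA : MeasurableSet A) {t : ℝ} (ht : 0 < t) :
    (Measure.pi fun _ : Fin n => g) {y | t < |empiricalFreq y A - g.real A|}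
      ≤ ENNReal.ofReal (2 * Real.exp (-(2 * n * t ^ 2))) := by
  rcases Nat.eq_zero_or_pos n with rfl | hn
  · refine prob_le_one.trans ?_
    simp only [Nat.cast_zero, mul_zero, zero_mul, neg_zero, Real.exp_zero, mul_one]
    norm_num
  have hn' : (0 : ℝ) < n := by exact_mod_cast hn
  set φ : X → ℝ := A.indicator fun _ => 1 with hφd
  have hφ : Measurable φ := measurable_const.indicator hA
  have hint : ∫ x, φ x ∂g = g.real A := by simp [hφd, integral_indicator hA]
  have hint' : ∫ x, -φ x ∂g = -g.real A := by rw [integral_neg, hint]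
  have h1 := measureReal_sum_ge_le_exp g n hφ (a := 0)
    (fun x => by
      by_cases hx : x ∈ A <;> simp [hφd, hx]) ht.le
  have h2 := measureReal_sum_ge_le_exp g n hφ.neg (a := -1)
    (fun x => by
      by_cases hx : x ∈ A <;> simp [hφd, hx]) ht.le
  have hsub : {y : Fin n → X | t < |empiricalFreq y A - g.real A|} ⊆
      {y | n * t ≤ ∑ i, (φ (y i) - ∫ x, φ x ∂g)} ∪
        {y | n * t ≤ ∑ i, ((-φ) (y i) - ∫ x, (-φ) x ∂g)} := by
    intro y hy
    have hE : ∑ i, φ (y i) = n * empiricalFreq y A := by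
      rw [empiricalFreq]; field_simp; rfl
    have e1 : ∑ i, (φ (y i) - ∫ x, φ x ∂g) = n * (empiricalFreq y A - g.real A) := by
      rw [Finset.sum_sub_distrib, hE, hint]; simp; ring
    have e2 : ∑ i, ((-φ) (y i) - ∫ x, (-φ) x ∂g) = n * -(empiricalFreq y A - g.real A) := by
      simp only [Pi.neg_apply]
      rw [Finset.sum_sub_distrib, hint', Finset.sum_neg_distrib, hE]; simp; ring
    rcases lt_abs.1 (show t < |empiricalFreq y A - g.real A| from hy) with h | h
    · left
      change n * t ≤ _
      rw [e1]; exact mul_le_mul_of_nonneg_left h.le hn'.le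
    · right
      change n * t ≤ _
      rw [e2]; exact mul_le_mul_of_nonneg_left h.le hn'.le
  refine (measure_mono hsub).trans ((measure_union_le _ _).trans ?_)
  rw [two_mul, ENNReal.ofReal_add (Real.exp_pos _).le (Real.exp_pos _).le]
  refine add_le_add ?_ ?_
  · rw [← ofReal_measureReal]; exact ENNReal.ofReal_le_ofReal h1
  · rw [← ofReal_measureReal]; exact ENNReal.ofReal_le_ofReal h2

variable {Ω : Type*} [MeasurableSpace Ω] [MeasurableSpace.CountablyGenerated X]

/-- The set of pairs `(ω, x)` at which the density of `κ` dominates that of `η`. -/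
noncomputable def yatracosSet (κ η : Kernel Ω X) : Set (Ω × X) :=
  {p | 1 / 2 < Kernel.rnDerivAux κ (κ + η) p.1 p.2}

lemma measurableSet_yatracosSet (κ η : Kernel Ω X) : MeasurableSet (yatracosSet κ η) :=
  measurableSet_lt measurable_const (Kernel.measurable_rnDerivAux κ (κ + η))

/-- `Kernel.rnDerivAux κ (κ + η)` is the share of `κ` in `κ + η`, jointly measurable in parameter
and point; where it exceeds one half, `κ` outweighs `η`. -/
lemma le_of_subset_yatracosSet (κ η : Kernel Ω X) [IsMarkovKernel κ] [IsMarkovKernel η] (ω : Ω)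
    {s : Set X} (hs : MeasurableSet s) (h : s ⊆ Prod.mk ω ⁻¹' yatracosSet κ η) :
    (η ω).real s ≤ (κ ω).real s := by
  have h1 : (2⁻¹ : ENNReal) * (κ ω s + η ω s) ≤ κ ω s := by
    conv_rhs => rw [← Kernel.setLIntegral_rnDerivAux κ η ω hs]
    calc (2⁻¹ : ENNReal) * (κ ω s + η ω s) = ∫⁻ _ in s, 2⁻¹ ∂(κ + η) ω := by
          simp
      _ ≤ _ := by
          refine setLIntegral_mono' hs fun x hx => ?_
          have := h hx
          have h3 : (1 / 2 : ℝ) < Kernel.rnDerivAux κ (κ + η) ω x := this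
          rw [show (2⁻¹ : ENNReal) = ENNReal.ofReal (1 / 2) by
            rw [one_div, ENNReal.ofReal_inv_of_pos (by norm_num)]; simp]
          exact ENNReal.ofReal_le_ofReal h3.le
  have h2 := ENNReal.toReal_mono (measure_ne_top _ _) h1
  rw [ENNReal.toReal_mul, ENNReal.toReal_add (measure_ne_top _ _) (measure_ne_top _ _)] at h2
  simp only [ENNReal.toReal_inv, ENNReal.toReal_ofNat] at h2
  simp only [Measure.real]
  linarith

lemma le_of_subset_compl_yatracosSet (κ η : Kernel Ω X) [IsMarkovKernel κ] [IsMarkovKernel η]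
    (ω : Ω) {s : Set X} (hs : MeasurableSet s) (h : s ⊆ (Prod.mk ω ⁻¹' yatracosSet κ η)ᶜ) :
    (κ ω).real s ≤ (η ω).real s := by
  have h1 : κ ω s ≤ (2⁻¹ : ENNReal) * (κ ω s + η ω s) := by
    conv_lhs => rw [← Kernel.setLIntegral_rnDerivAux κ η ω hs]
    calc _ ≤ ∫⁻ _ in s, 2⁻¹ ∂(κ + η) ω := by
          refine setLIntegral_mono' hs fun x hx => ?_
          have := h hx
          have h3 : Kernel.rnDerivAux κ (κ + η) ω x ≤ 1 / 2 := not_lt.1 this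
          rw [show (2⁻¹ : ENNReal) = ENNReal.ofReal (1 / 2) by
            rw [one_div, ENNReal.ofReal_inv_of_pos (by norm_num)]; simp]
          exact ENNReal.ofReal_le_ofReal h3
      _ = (2⁻¹ : ENNReal) * (κ ω s + η ω s) := by simp
  have hfin : (2⁻¹ : ENNReal) * (κ ω s + η ω s) ≠ ⊤ :=
    ENNReal.mul_ne_top (by simp) (by simp)
  have h2 := ENNReal.toReal_mono hfin h1
  rw [ENNReal.toReal_mul, ENNReal.toReal_add (measure_ne_top _ _) (measure_ne_top _ _)] at h2
  simp only [ENNReal.toReal_inv, ENNReal.toReal_ofNat] at h2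
  simp only [Measure.real]
  linarith

/-- The value of a Markov kernel as a bundled probability measure. -/
noncomputable def kernelAt (κ : Kernel Ω X) [IsMarkovKernel κ] (ω : Ω) : ProbabilityMeasure X :=
  ⟨κ ω, inferInstance⟩

/-- Scheffé's argument: replacing `B` by the set `A` removes points where the second density
dominates and adds points where the first does, so the difference cannot decrease. -/
lemma tvDist_kernelAt_le (κ η : Kernel Ω X) [IsMarkovKernel κ] [IsMarkovKernel η] (ω : Ω) :
    tvDist (kernelAt κ ω) (kernelAt η ω) ≤ (κ ω).real (Prod.mk ω ⁻¹' yatracosSet κ η) -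
      (η ω).real (Prod.mk ω ⁻¹' yatracosSet κ η) := by
  set A := Prod.mk ω ⁻¹' yatracosSet κ η with hAd
  have hA : MeasurableSet A := measurable_prodMk_left (measurableSet_yatracosSet κ η)
  refine tvDist_le_of_sub_le fun B hB => ?_
  change (κ ω).real B - (η ω).real B ≤ _
  have h1 := le_of_subset_compl_yatracosSet κ η ω (hB.diff hA) (fun x hx => hx.2)
  have h2 := le_of_subset_yatracosSet κ η ω (hA.diff hB) (fun x hx => hx.1)
  have e1 := measureReal_inter_add_sdiff (μ := κ ω) (s := B) hA
  have e2 := measureReal_inter_add_sdiff (μ := η ω) (s := B) hA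
  have e3 := measureReal_inter_add_sdiff (μ := κ ω) (s := A) hB
  have e4 := measureReal_inter_add_sdiff (μ := η ω) (s := A) hB
  rw [Set.inter_comm] at e3 e4
  linarith

/-- **Minimum distance selection** from a finite list of candidates that depend on data `ω`, with
a fresh sample of size `n`. -/
theorem exists_selector {ι : Type*} [Fintype ι] [Nonempty ι] (κ : ι → Kernel Ω X)
    [∀ a, IsMarkovKernel (κ a)] (n : ℕ) {t : ℝ} (ht : 0 < t) :
    ∃ sel : Ω → (Fin n → X) → ι, ∀ (P : Measure Ω) [IsProbabilityMeasure P]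
      (g : ProbabilityMeasure X),
      (P.prod (sampleLaw g n)) {p | ∃ a, 3 * tvDist (kernelAt (κ a) p.1) g + 2 * t <
        tvDist (kernelAt (κ (sel p.1 p.2)) p.1) g}
      ≤ ENNReal.ofReal (2 * (Fintype.card ι) ^ 2 * Real.exp (-(2 * n * t ^ 2))) := by
  classical
  let A : ι × ι → Ω → Set X := fun b ω => Prod.mk ω ⁻¹' yatracosSet (κ b.1) (κ b.2)
  have hA : ∀ b ω, MeasurableSet (A b ω) := fun b ω =>
    measurable_prodMk_left (measurableSet_yatracosSet _ _)
  -- Worst discrepancy between a candidate and the empirical frequencies over all pairwise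
  -- comparison sets; the selector minimises it.
  let W : Ω → (Fin n → X) → ι → ℝ := fun ω y a =>
    Finset.univ.sup' Finset.univ_nonempty
      fun b : ι × ι => |(κ a ω).real (A b ω) - empiricalFreq y (A b ω)|
  have hWle : ∀ ω y a b, |(κ a ω).real (A b ω) - empiricalFreq y (A b ω)| ≤ W ω y a :=
    fun ω y a b => Finset.le_sup'
      (fun b : ι × ι => |(κ a ω).real (A b ω) - empiricalFreq y (A b ω)|) (Finset.mem_univ b)
  have hmin : ∀ ω y, ∃ a, ∀ b, W ω y a ≤ W ω y b := fun ω y => Finite.exists_min (W ω y)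
  choose sel hsel using hmin
  refine ⟨sel, fun P _ g => ?_⟩
  let bad : ι × ι → Set (Ω × (Fin n → X)) := fun b =>
    {p | t < |empiricalFreq p.2 (A b p.1) - (g : Measure X).real (A b p.1)|}
  have hsub : {p : Ω × (Fin n → X) | ∃ a, 3 * tvDist (kernelAt (κ a) p.1) g + 2 * t <
        tvDist (kernelAt (κ (sel p.1 p.2)) p.1) g} ⊆ ⋃ b, bad b := by
    rintro ⟨ω, y⟩ ⟨a, ha⟩
    by_contra hgood
    simp only [Set.mem_iUnion, not_exists] at hgood
    have hg : ∀ b, |empiricalFreq y (A b ω) - (g : Measure X).real (A b ω)| ≤ t :=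
      fun b => not_lt.1 (hgood b)
    have hWa : W ω y a ≤ tvDist (kernelAt (κ a) ω) g + t := by
      refine Finset.sup'_le _ _ fun b _ => ?_
      have h1 := abs_measureReal_sub_le_tvDist (kernelAt (κ a) ω) g (hA b ω)
      have h2 := hg b
      rw [abs_sub_comm] at h2
      calc _ ≤ _ := abs_sub_le _ ((g : Measure X).real (A b ω)) _
        _ ≤ _ := add_le_add h1 h2
    -- On the comparison set of the selected candidate and `a`, both are close to the same empirical
    -- frequency. Their distance is thus at most `W sel + W a ≤ 2 * W a ≤ 2 * tvDist a g + 2 * t`,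
    -- and the triangle inequality adds one more `tvDist a g`.
    have h1 := tvDist_kernelAt_le (κ (sel ω y)) (κ a) ω
    have h2 := hWle ω y (sel ω y) (sel ω y, a)
    have h3 := hWle ω y a (sel ω y, a)
    have h4 := hsel ω y a
    have h5 := tvDist_triangle (kernelAt (κ (sel ω y)) ω) (kernelAt (κ a) ω) g
    have h6 := abs_le.1 h2
    have h7 := abs_le.1 h3
    change tvDist (kernelAt (κ (sel ω y)) ω) (kernelAt (κ a) ω) ≤
      (κ (sel ω y) ω).real (A (sel ω y, a) ω) - (κ a ω).real (A (sel ω y, a) ω) at h1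
    simp only at ha
    linarith
  have hbad : ∀ b, (P.prod (sampleLaw g n)) (bad b) ≤
      ENNReal.ofReal (2 * Real.exp (-(2 * n * t ^ 2))) := by
    intro b
    have hm : MeasurableSet (bad b) := by
      refine measurableSet_lt measurable_const (Measurable.abs (Measurable.sub ?_ ?_))
      · unfold empiricalFreq
        refine Measurable.div_const (Finset.measurable_sum _ fun i _ => ?_) _
        have : (fun p : Ω × (Fin n → X) => (A b p.1).indicator (fun _ => (1 : ℝ)) (p.2 i)) =
            fun p => (yatracosSet (κ b.1) (κ b.2)).indicator (fun _ => (1 : ℝ)) (p.1, p.2 i) := by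
          funext p; rfl
        rw [this]
        exact (measurable_const.indicator (measurableSet_yatracosSet _ _)).comp
          (by fun_prop)
      · exact ((measurable_measure_prodMk_left (ν := (g : Measure X))
          (measurableSet_yatracosSet (κ b.1) (κ b.2))).ennreal_toReal).comp measurable_fst
    -- For fixed `ω` the comparison set is deterministic, so Hoeffding's inequality applies to the
    -- fresh sample.
    rw [Measure.prod_apply hm]
    calc _ ≤ ∫⁻ _, ENNReal.ofReal (2 * Real.exp (-(2 * n * t ^ 2))) ∂P :=
          lintegral_mono fun ω =>
            measure_lt_abs_empiricalFreq_sub_le (g : Measure X) n (hA b ω) ht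
      _ = _ := by simp
  refine (measure_mono hsub).trans ((measure_iUnion_fintype_le _ _).trans ?_)
  refine (Finset.sum_le_sum fun b _ => hbad b).trans (le_of_eq ?_)
  rw [Finset.sum_const, nsmul_eq_mul, Finset.card_univ, Fintype.card_prod,
    ← ENNReal.ofReal_natCast, ← ENNReal.ofReal_mul (by positivity)]
  congr 1
  push_cast
  ring

end Selection

/-! ### Total variation and the Bhattacharyya coefficient. -/

section Densities

variable {X : Type*} [MeasurableSpace X]

/-- The total variation distance of two distributions with densities `p`, `q` is small when their
Bhattacharyya coefficient `∫ √(p q)` is close to one. -/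
lemma tvDist_le_of_le_integral_sqrt {ρ : Measure X} {p q : X → ℝ} (hp : Measurable p)
    (hq : Measurable q) (hp0 : ∀ x, 0 ≤ p x) (hq0 : ∀ x, 0 ≤ q x) (P Q : ProbabilityMeasure X)
    (hP : (P : Measure X) = ρ.withDensity fun x => ENNReal.ofReal (p x))
    (hQ : (Q : Measure X) = ρ.withDensity fun x => ENNReal.ofReal (q x))
    (hpi : Integrable p ρ) (hqi : Integrable q ρ) {η : ℝ} (hη : 0 < η)
    (h : 1 - η ^ 2 ≤ ∫ x, √(p x * q x) ∂ρ) : tvDist P Q ≤ 3 / 2 * η := by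
  have hset : ∀ (R : ProbabilityMeasure X) (r : X → ℝ), Integrable r ρ → (∀ x, 0 ≤ r x) →
      (R : Measure X) = ρ.withDensity (fun x => ENNReal.ofReal (r x)) →
      ∀ B, MeasurableSet B → (R : Measure X).real B = ∫ x in B, r x ∂ρ := by
    intro R r hr hr0 hR B hB
    rw [hR, Measure.real, withDensity_apply _ hB,
      ← ofReal_integral_eq_lintegral_ofReal hr.integrableOn (ae_of_all _ hr0),
      ENNReal.toReal_ofReal (integral_nonneg hr0)]
  have hone : ∀ (R : ProbabilityMeasure X) (r : X → ℝ), Integrable r ρ → (∀ x, 0 ≤ r x) →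
      (R : Measure X) = ρ.withDensity (fun x => ENNReal.ofReal (r x)) → ∫ x, r x ∂ρ = 1 := by
    intro R r hr hr0 hR
    have := hset R r hr hr0 hR Set.univ MeasurableSet.univ
    simpa using this.symm
  have hp1 := hone P p hpi hp0 hP
  have hq1 := hone Q q hqi hq0 hQ
  have hm : Integrable (fun x => √(p x * q x)) ρ := by
    refine (hpi.add hqi).mono' (hp.mul hq).sqrt.aestronglyMeasurable (ae_of_all _ fun x => ?_)
    rw [Real.norm_of_nonneg (Real.sqrt_nonneg _)]
    refine Real.sqrt_le_iff.2 ⟨add_nonneg (hp0 x) (hq0 x), ?_⟩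
    have := hp0 x; have := hq0 x
    simp only [Pi.add_apply]
    nlinarith [mul_nonneg (hp0 x) (hq0 x)]
  -- Weighted arithmetic-geometric mean inequality for `|p - q| = |√p - √q| * (√p + √q)`. After
  -- integration the first term is at most `η` and the second at most `2 * η`.
  have hpt : ∀ x, |p x - q x| ≤ (p x + q x - 2 * √(p x * q x)) / (2 * η) +
      η * (p x + q x + 2 * √(p x * q x)) / 2 := by
    intro x
    have h1 := Real.sq_sqrt (hp0 x)
    have h2 := Real.sq_sqrt (hq0 x)
    rw [Real.sqrt_mul (hp0 x)]
    set a := √(p x)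
    set b := √(q x)
    rw [← h1, ← h2]
    have h3 : (a ^ 2 + b ^ 2 - 2 * (a * b)) / (2 * η) + η * (a ^ 2 + b ^ 2 + 2 * (a * b)) / 2
        - (a - b) * (a + b) = ((a - b) - η * (a + b)) ^ 2 / (2 * η) := by
      field_simp; ring
    have h4 : (a ^ 2 + b ^ 2 - 2 * (a * b)) / (2 * η) + η * (a ^ 2 + b ^ 2 + 2 * (a * b)) / 2
        + (a - b) * (a + b) = ((a - b) + η * (a + b)) ^ 2 / (2 * η) := by
      field_simp; ring
    have h5 : 0 ≤ ((a - b) - η * (a + b)) ^ 2 / (2 * η) := by positivity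
    have h6 : 0 ≤ ((a - b) + η * (a + b)) ^ 2 / (2 * η) := by positivity
    rw [abs_le]
    constructor <;> nlinarith
  have hd : Integrable (fun x => p x - q x) ρ := hpi.sub hqi
  have hs : Integrable (fun x => p x + q x) ρ := hpi.add hqi
  have hint : ∫ x, |p x - q x| ∂ρ ≤ 3 * η := by
    have hA : Integrable (fun x => (p x + q x - 2 * √(p x * q x)) / (2 * η)) ρ :=
      (hs.sub (hm.const_mul 2)).div_const _
    have hB : Integrable (fun x => η * (p x + q x + 2 * √(p x * q x)) / 2) ρ :=
      ((hs.add (hm.const_mul 2)).const_mul η).div_const _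
    have e0 : ∫ x, (p x + q x) ∂ρ = 2 := by
      rw [integral_add hpi hqi, hp1, hq1]; norm_num
    have eA : ∫ x, (p x + q x - 2 * √(p x * q x)) / (2 * η) ∂ρ =
        (2 - 2 * ∫ x, √(p x * q x) ∂ρ) / (2 * η) := by
      rw [integral_div, integral_sub hs (hm.const_mul 2), integral_const_mul, e0]
    have eB : ∫ x, η * (p x + q x + 2 * √(p x * q x)) / 2 ∂ρ =
        η * (2 + 2 * ∫ x, √(p x * q x) ∂ρ) / 2 := by
      rw [integral_div, integral_const_mul, integral_add hs (hm.const_mul 2),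
        integral_const_mul, e0]
    have hle : ∫ x, √(p x * q x) ∂ρ ≤ 1 := by
      have : ∫ x, √(p x * q x) ∂ρ ≤ ∫ x, (p x + q x) / 2 ∂ρ := by
        refine integral_mono hm (hs.div_const 2) fun x => ?_
        refine Real.sqrt_le_iff.2 ⟨by have := hp0 x; have := hq0 x; positivity, ?_⟩
        nlinarith [sq_nonneg (p x - q x)]
      rw [integral_div, e0] at this
      simpa using this
    calc ∫ x, |p x - q x| ∂ρ ≤ ∫ x, ((p x + q x - 2 * √(p x * q x)) / (2 * η) +
          η * (p x + q x + 2 * √(p x * q x)) / 2) ∂ρ := integral_mono hd.abs (hA.add hB) hpt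
      _ = (2 - 2 * ∫ x, √(p x * q x) ∂ρ) / (2 * η) +
          η * (2 + 2 * ∫ x, √(p x * q x) ∂ρ) / 2 := by rw [integral_add hA hB, eA, eB]
      _ ≤ η + η * 4 / 2 := by
          refine add_le_add ?_ (by gcongr; linarith)
          rw [div_le_iff₀ (by positivity)]; nlinarith
      _ = 3 * η := by ring
  refine tvDist_le_of_sub_le fun B hB => ?_
  have e1 : (P : Measure X).real B - (Q : Measure X).real B = ∫ x in B, (p x - q x) ∂ρ := by
    rw [hset P p hpi hp0 hP B hB, hset Q q hqi hq0 hQ B hB,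
      integral_sub hpi.integrableOn hqi.integrableOn]
  have e2 : ∫ x in B, (p x - q x) ∂ρ + ∫ x in Bᶜ, (p x - q x) ∂ρ = 0 := by
    rw [integral_add_compl hB hd, integral_sub hpi hqi, hp1, hq1, sub_self]
  have e3 : ∫ x in B, |p x - q x| ∂ρ + ∫ x in Bᶜ, |p x - q x| ∂ρ = ∫ x, |p x - q x| ∂ρ :=
    integral_add_compl hB hd.abs
  have h1 : ∫ x in B, (p x - q x) ∂ρ ≤ ∫ x in B, |p x - q x| ∂ρ :=
    integral_mono hd.integrableOn hd.abs.integrableOn fun x => le_abs_self _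
  have h2 : -∫ x in Bᶜ, (p x - q x) ∂ρ ≤ ∫ x in Bᶜ, |p x - q x| ∂ρ := by
    rw [← integral_neg]
    exact integral_mono hd.neg.integrableOn hd.abs.integrableOn fun x => neg_le_abs _
  rw [e1]; linarith

lemma pi_withDensity_ofReal {ι : Type*} [Fintype ι] {E : ι → Type*}
    [∀ i, MeasurableSpace (E i)] (μ : ∀ i, Measure (E i)) [∀ i, SigmaFinite (μ i)]
    {f : ∀ i, E i → ℝ} (hf : ∀ i, Integrable (f i) (μ i))
    (hf0 : ∀ i x, 0 ≤ f i x) :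
    (Measure.pi fun i => (μ i).withDensity fun x => ENNReal.ofReal (f i x)) =
      (Measure.pi μ).withDensity fun x => ENNReal.ofReal (∏ i, f i (x i)) := by
  have : ∀ i, IsFiniteMeasure ((μ i).withDensity fun x => ENNReal.ofReal (f i x)) := fun i =>
    isFiniteMeasure_withDensity_ofReal (hf i).2
  refine Measure.pi_eq fun s hs => ?_
  have hi : ∀ i, Integrable (f i) ((μ i).restrict (s i)) := fun i => (hf i).integrableOn
  rw [withDensity_apply _ (MeasurableSet.univ_pi hs), Measure.restrict_pi_pi,
    ← ofReal_integral_eq_lintegral_ofReal (Integrable.fintype_prod_dep hi)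
      (ae_of_all _ fun x => Finset.prod_nonneg fun i _ => hf0 i _),
    integral_fintype_prod_eq_prod, ENNReal.ofReal_prod_of_nonneg
      (fun i _ => integral_nonneg (hf0 i))]
  refine Finset.prod_congr rfl fun i _ => ?_
  rw [withDensity_apply _ (hs i),
    ofReal_integral_eq_lintegral_ofReal (hf i).integrableOn (ae_of_all _ (hf0 i))]

end Densities

/-! ### Axis-aligned Gaussians and their total variation distance. -/

section AxisAligned

open Real

variable {d : ℕ}

/-- The distribution of `(m j + s j * z j)_j` for independent standard normal `z j`. -/
noncomputable def affineGaussian (m s : Fin d → ℝ) : ProbabilityMeasure (EuclideanSpace ℝ (Fin d)) :=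
  ⟨(Measure.pi fun _ : Fin d => gaussianReal 0 1).map
    (fun z => WithLp.toLp 2 fun j => m j + s j * z j),
    Measure.isProbabilityMeasure_map (Measurable.aemeasurable (by fun_prop))⟩

lemma gaussianReal_map_affine (m s : ℝ) :
    (gaussianReal 0 1).map (fun z => m + s * z) = gaussianReal m (.mk (s ^ 2) (sq_nonneg _)) := by
  have : (fun z : ℝ => m + s * z) = (fun z => m + z) ∘ (fun z => s * z) := rfl
  rw [this, ← Measure.map_map (by fun_prop) (by fun_prop), gaussianReal_map_const_mul,
    gaussianReal_map_const_add]
  simp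

lemma coe_affineGaussian (m s : Fin d → ℝ) :
    (affineGaussian m s : Measure (EuclideanSpace ℝ (Fin d))) =
      (Measure.pi fun j => gaussianReal (m j) (.mk (s j ^ 2) (sq_nonneg _))).map
        (WithLp.toLp 2) := by
  have h : (Measure.pi fun j => gaussianReal (m j) (.mk (s j ^ 2) (sq_nonneg _))) =
      (Measure.pi fun _ : Fin d => gaussianReal 0 1).map (fun z j => m j + s j * z j) := by
    have h2 := Measure.pi_map_pi (μ := fun _ : Fin d => gaussianReal 0 1)
      (f := fun j z => m j + s j * z) (fun j => by fun_prop)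
    rw [h2]
    simp only [gaussianReal_map_affine]
  rw [h, Measure.map_map (by fun_prop) (by fun_prop)]
  rfl

lemma affineGaussian_eq_multivariateGaussian (m : EuclideanSpace ℝ (Fin d))
    (s : Fin d → ℝ) :
    (affineGaussian m s : Measure (EuclideanSpace ℝ (Fin d))) =
      multivariateGaussian m (Matrix.diagonal fun j => s j ^ 2) := by
  have hS : (Matrix.diagonal fun j => s j ^ 2).PosSemidef :=
    Matrix.PosSemidef.diagonal fun j => sq_nonneg _
  rw [coe_affineGaussian]
  apply Measure.ext_of_charFun
  ext t
  rw [charFun_pi, charFun_multivariateGaussian hS]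
  simp_rw [charFun_gaussianReal, ← Complex.exp_sum]
  congr 1
  rw [Finset.sum_sub_distrib, PiLp.inner_apply]
  simp only [Matrix.mulVec_diagonal, dotProduct]
  push_cast
  rw [Finset.sum_mul, Finset.sum_div]
  congr 1
  · exact Finset.sum_congr rfl fun j _ => by simp [mul_comm]
  · refine Finset.sum_congr rfl fun j _ => ?_
    simp
    ring

lemma affineGaussian_mem (m : Fin d → ℝ) {s : Fin d → ℝ} (hs : ∀ j, 0 < s j) :
    affineGaussian m s ∈ axisAlignedGaussians d :=
  ⟨WithLp.toLp 2 m, Matrix.diagonal fun j => s j ^ 2, Matrix.isDiag_diagonal _,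
    Matrix.PosDef.diagonal fun j => pow_pos (hs j) 2,
    affineGaussian_eq_multivariateGaussian (WithLp.toLp 2 m) s⟩

lemma exists_eq_affineGaussian {f : ProbabilityMeasure (EuclideanSpace ℝ (Fin d))}
    (hf : f ∈ axisAlignedGaussians d) : ∃ m s : Fin d → ℝ, (∀ j, 0 < s j) ∧
      f = affineGaussian m s := by
  obtain ⟨μ, S, hd, hp, hfS⟩ := hf
  have hpos : ∀ j, 0 < S j j := fun j => hp.diag_pos
  refine ⟨μ, fun j => √(S j j), fun j => Real.sqrt_pos.2 (hpos j), ?_⟩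
  apply Subtype.ext
  refine hfS.trans (Eq.trans ?_ (affineGaussian_eq_multivariateGaussian μ _).symm)
  congr 1
  conv_lhs => rw [← hd.diagonal_diag]
  congr 1
  ext j
  simp [Real.sq_sqrt (hpos j).le]

/-- Completing the square, the geometric mean of two normal densities is a constant times the normal
density whose variance is the harmonic mean of the two. In logarithmic scales the constant is `cosh
(τ - τ') ^ (-1/2)` times an exponential in `(m - m') ^ 2`, and `cosh x ≤ exp (x ^ 2 / 2)`. Dropping
`s' ^ 2` from a denominator leaves a bound in terms of the first scale only. -/
lemma integral_sqrt_gaussianPDFReal_mul (m m' τ τ' : ℝ) :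
    rexp (-((τ - τ') ^ 2 / 4 + (m - m') ^ 2 / (4 * rexp τ ^ 2))) ≤
    ∫ x, √(gaussianPDFReal m (.mk (rexp τ ^ 2) (sq_nonneg _)) x *
      gaussianPDFReal m' (.mk (rexp τ' ^ 2) (sq_nonneg _)) x) := by
  set s := rexp τ with hs
  set s' := rexp τ' with hs'
  have hsp : 0 < s := Real.exp_pos _
  have hsp' : 0 < s' := Real.exp_pos _
  set w : ℝ := 2 * s ^ 2 * s' ^ 2 / (s ^ 2 + s' ^ 2) with hw
  have hwp : 0 < w := by positivity
  set c : ℝ := (m * s' ^ 2 + m' * s ^ 2) / (s ^ 2 + s' ^ 2) with hc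
  set K : ℝ := √(w / (s * s')) * rexp (-((m - m') ^ 2 / (4 * (s ^ 2 + s' ^ 2)))) with hK
  have hfun : ∀ x, √(gaussianPDFReal m (.mk (s ^ 2) (sq_nonneg _)) x *
      gaussianPDFReal m' (.mk (s' ^ 2) (sq_nonneg _)) x) =
      K * gaussianPDFReal c (.mk w hwp.le) x := by
    intro x
    simp only [gaussianPDFReal, NNReal.coe_mk]
    rw [Real.sqrt_eq_iff_mul_self_eq (by positivity) (by positivity), hK]
    have h1 : √(2 * π * s ^ 2) = √(2 * π) * s := by
      rw [Real.sqrt_mul (by positivity), Real.sqrt_sq hsp.le]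
    have h2 : √(2 * π * s' ^ 2) = √(2 * π) * s' := by
      rw [Real.sqrt_mul (by positivity), Real.sqrt_sq hsp'.le]
    have h3 : √(2 * π * w) = √(2 * π) * √w := Real.sqrt_mul (by positivity) _
    have h4 : √(w / (s * s')) * √(w / (s * s')) = w / (s * s') :=
      Real.mul_self_sqrt (by positivity)
    have h5 : √w * √w = w := Real.mul_self_sqrt hwp.le
    have h6 : rexp (-(x - m) ^ 2 / (2 * s ^ 2)) * rexp (-(x - m') ^ 2 / (2 * s' ^ 2)) =
        (rexp (-((m - m') ^ 2 / (4 * (s ^ 2 + s' ^ 2)))) * rexp (-(x - c) ^ 2 / (2 * w))) *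
        (rexp (-((m - m') ^ 2 / (4 * (s ^ 2 + s' ^ 2)))) * rexp (-(x - c) ^ 2 / (2 * w))) := by
      simp only [← Real.exp_add]
      congr 1
      rw [hw, hc]
      field_simp
      ring
    rw [h1, h2, h3]
    set r := √(2 * π) with hr
    have hrp : 0 < r := by positivity
    set v := √w with hv
    have hvp : 0 < v := Real.sqrt_pos.2 hwp
    set u := √(w / (s * s'))
    set e := rexp (-((m - m') ^ 2 / (4 * (s ^ 2 + s' ^ 2))))
    set e2 := rexp (-(x - c) ^ 2 / (2 * w))
    have lhs : u * e * ((r * v)⁻¹ * e2) * (u * e * ((r * v)⁻¹ * e2)) =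
        (u * u) * (r * r)⁻¹ * (v * v)⁻¹ * (e * e2 * (e * e2)) := by
      simp only [mul_inv]; ring
    rw [lhs, h4, h5, ← h6]
    have : w ≠ 0 := hwp.ne'
    field_simp
  simp_rw [hfun]
  rw [integral_const_mul, integral_gaussianPDFReal_eq_one c (v := .mk w hwp.le)
    (by intro h; rw [← NNReal.coe_inj] at h; exact hwp.ne' h), mul_one, hK, neg_add, Real.exp_add]
  refine mul_le_mul ?_ ?_ (by positivity) (by positivity)
  · refine Real.le_sqrt_of_sq_le ?_
    have h1 : w / (s * s') = 1 / Real.cosh (τ - τ') := by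
      rw [Real.cosh_eq, neg_sub, Real.exp_sub, Real.exp_sub, ← hs, ← hs', hw]
      field_simp
    rw [h1, ← Real.exp_nat_mul, le_div_iff₀ (Real.cosh_pos _)]
    calc rexp (((2 : ℕ) : ℝ) * -((τ - τ') ^ 2 / 4)) * cosh (τ - τ')
        ≤ rexp (((2 : ℕ) : ℝ) * -((τ - τ') ^ 2 / 4)) * rexp ((τ - τ') ^ 2 / 2) := by
          gcongr; exact Real.cosh_le_exp_half_sq _
      _ = 1 := by rw [← Real.exp_add, ← Real.exp_zero]; congr 1; push_cast; ring
  · refine Real.exp_le_exp.2 (neg_le_neg ?_)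
    gcongr
    nlinarith [sq_nonneg s']

/-- The Bhattacharyya coefficient is multiplicative over coordinates, so the exponents add up. Only
Euclidean distances of location and logarithmic scale enter, with no extra factor of the dimension.
-/
lemma tvDist_affineGaussian_le (m m' τ τ' : Fin d → ℝ) {η : ℝ} (hη : 0 < η)
    (h : ∑ j, ((τ j - τ' j) ^ 2 / 4 + (m j - m' j) ^ 2 / (4 * rexp (τ j) ^ 2)) ≤ η ^ 2) :
    tvDist (affineGaussian m fun j => rexp (τ j)) (affineGaussian m' fun j => rexp (τ' j)) ≤
      3 / 2 * η := by
  let v : ℝ → NNReal := fun τ => .mk (rexp τ ^ 2) (sq_nonneg _)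
  have hv : ∀ τ, v τ ≠ 0 := by
    intro τ h; rw [← NNReal.coe_inj] at h
    exact (pow_pos (Real.exp_pos τ) 2).ne' h
  let P : (Fin d → ℝ) → (Fin d → ℝ) → ProbabilityMeasure (Fin d → ℝ) := fun m τ =>
    ⟨Measure.pi fun j => gaussianReal (m j) (v (τ j)), inferInstance⟩
  have hP : ∀ m τ, (P m τ : Measure (Fin d → ℝ)) = (volume : Measure (Fin d → ℝ)).withDensity
      fun x => ENNReal.ofReal (∏ j, gaussianPDFReal (m j) (v (τ j)) (x j)) := by
    intro m τ
    rw [volume_pi, ← pi_withDensity_ofReal _ (fun j => integrable_gaussianPDFReal (m j) (v (τ j)))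
      (fun j => gaussianPDFReal_nonneg _ _)]
    change Measure.pi _ = _
    congr 1
    ext1 j
    rw [gaussianReal_of_var_ne_zero _ (hv _)]
    rfl
  have hmeas : ∀ m τ : Fin d → ℝ, Measurable fun x : Fin d → ℝ =>
      ∏ j, gaussianPDFReal (m j) (v (τ j)) (x j) := fun m τ =>
    Finset.measurable_prod _ fun j _ =>
      (measurable_gaussianPDFReal _ _).comp (measurable_pi_apply j)
  have hpos : ∀ (m τ : Fin d → ℝ) (x : Fin d → ℝ),
      0 ≤ ∏ j, gaussianPDFReal (m j) (v (τ j)) (x j) := fun m τ x =>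
    Finset.prod_nonneg fun j _ => gaussianPDFReal_nonneg _ _ _
  have hint : ∀ m τ : Fin d → ℝ, Integrable fun x : Fin d → ℝ =>
      ∏ j, gaussianPDFReal (m j) (v (τ j)) (x j) := fun m τ =>
    Integrable.fintype_prod fun j => integrable_gaussianPDFReal _ _
  have hBC : 1 - η ^ 2 ≤ ∫ x : Fin d → ℝ, √((∏ j, gaussianPDFReal (m j) (v (τ j)) (x j)) *
      ∏ j, gaussianPDFReal (m' j) (v (τ' j)) (x j)) := by
    have e : ∀ x : Fin d → ℝ, √((∏ j, gaussianPDFReal (m j) (v (τ j)) (x j)) *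
        ∏ j, gaussianPDFReal (m' j) (v (τ' j)) (x j)) =
        ∏ j, √(gaussianPDFReal (m j) (v (τ j)) (x j) *
          gaussianPDFReal (m' j) (v (τ' j)) (x j)) := by
      intro x
      rw [← Finset.prod_mul_distrib, Real.sqrt_prod _ fun j _ =>
        mul_nonneg (gaussianPDFReal_nonneg _ _ _) (gaussianPDFReal_nonneg _ _ _)]
    simp_rw [e]
    rw [integral_fintype_prod_volume_eq_prod (fun j y => √(gaussianPDFReal (m j) (v (τ j)) y *
          gaussianPDFReal (m' j) (v (τ' j)) y))]
    calc 1 - η ^ 2 ≤ rexp (-∑ j, ((τ j - τ' j) ^ 2 / 4 +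
          (m j - m' j) ^ 2 / (4 * rexp (τ j) ^ 2))) := by
          have := Real.add_one_le_exp (-∑ j, ((τ j - τ' j) ^ 2 / 4 +
            (m j - m' j) ^ 2 / (4 * rexp (τ j) ^ 2)))
          linarith
      _ = ∏ j, rexp (-((τ j - τ' j) ^ 2 / 4 + (m j - m' j) ^ 2 / (4 * rexp (τ j) ^ 2))) := by
          rw [← Real.exp_sum, Finset.sum_neg_distrib]
      _ ≤ _ := Finset.prod_le_prod (fun j _ => (Real.exp_pos _).le)
          fun j _ => integral_sqrt_gaussianPDFReal_mul _ _ _ _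
  have htv := tvDist_le_of_le_integral_sqrt (hmeas m τ) (hmeas m' τ') (hpos m τ) (hpos m' τ')
    (P m τ) (P m' τ') (hP m τ) (hP m' τ') (hint m τ) (hint m' τ') hη hBC
  refine (tvDist_le fun B hB => ?_).trans htv
  have hmp : Measurable (WithLp.toLp 2 : (Fin d → ℝ) → EuclideanSpace ℝ (Fin d)) := by fun_prop
  rw [coe_affineGaussian, coe_affineGaussian, map_measureReal_apply hmp hB,
    map_measureReal_apply hmp hB]
  exact abs_measureReal_sub_le_tvDist (P m τ) (P m' τ') (hmp hB)

end AxisAligned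

/-! ### Nets of Euclidean balls. -/

section Nets

variable (E : Type*) [NormedAddCommGroup E] [NormedSpace ℝ E] [FiniteDimensional ℝ E]

/-- A 1-separated subset of the ball of largest cardinality is a net: a point that it misses could
be added to it. -/
lemma exists_finset_net_ball_two : ∃ T : Finset E, T.card ≤ 5 ^ Module.finrank ℝ E ∧
    ∀ u : E, ‖u‖ ≤ 2 → ∃ t ∈ T, ‖u - t‖ ≤ 1 := by
  classical
  let good : Finset E → Prop := fun s => (∀ c ∈ s, ‖c‖ ≤ 2) ∧
    ∀ c ∈ s, ∀ d ∈ s, c ≠ d → 1 ≤ ‖c - d‖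
  let N : Set ℕ := {n | ∃ s, good s ∧ s.card = n}
  have hne : N.Nonempty := ⟨0, ∅, by simp [good], rfl⟩
  have hbdd : BddAbove N := ⟨5 ^ Module.finrank ℝ E, by
    rintro _ ⟨s, hs, rfl⟩; exact Besicovitch.card_le_of_separated s hs.1 hs.2⟩
  obtain ⟨T, hT, hcard⟩ := Nat.sSup_mem hne hbdd
  refine ⟨T, Besicovitch.card_le_of_separated T hT.1 hT.2, fun u hu => ?_⟩
  by_contra! hcon
  have hnot : u ∉ T := fun h => by have := hcon u h; simp at this; linarith
  have hgood : good (insert u T) := by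
    refine ⟨fun c hc => ?_, fun c hc d hd hcd => ?_⟩
    · rcases Finset.mem_insert.1 hc with rfl | hc
      · exact hu
      · exact hT.1 c hc
    · rcases Finset.mem_insert.1 hc with h1 | h1 <;> rcases Finset.mem_insert.1 hd with h2 | h2
      · exact absurd (h1.trans h2.symm) hcd
      · rw [h1]; exact (hcon d h2).le
      · rw [h2, norm_sub_rev]; exact (hcon c h1).le
      · exact hT.2 c h1 d h2 hcd
  have := le_csSup hbdd (show (insert u T).card ∈ N from ⟨_, hgood, rfl⟩)
  rw [Finset.card_insert_of_notMem hnot, hcard] at this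
  omega

/-- Iterated halving: a ball is covered by `5 ^ finrank` translates of the ball of half its radius.
-/
lemma exists_finset_net (j : ℕ) {r : ℝ} (hr : 0 < r) :
    ∃ T : Finset E, T.Nonempty ∧ T.card ≤ (5 ^ Module.finrank ℝ E) ^ j ∧
      ∀ u : E, ‖u‖ ≤ r * 2 ^ j → ∃ t ∈ T, ‖u - t‖ ≤ r := by
  classical
  induction j with
  | zero => exact ⟨{0}, by simp, by simp, fun u hu => ⟨0, by simp, by simpa using hu⟩⟩
  | succ j ih =>
    obtain ⟨T, hT0, hT1, hT2⟩ := ih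
    obtain ⟨S, hS1, hS2⟩ := exists_finset_net_ball_two E
    have hS0 : S.Nonempty := (hS2 0 (by simp)).imp fun _ h => h.1
    refine ⟨Finset.image₂ (fun s t => (r * 2 ^ j) • s + t) S T, hS0.image₂ hT0, ?_, fun u hu => ?_⟩
    · calc _ ≤ S.card * T.card := Finset.card_image₂_le _ _ _
        _ ≤ 5 ^ Module.finrank ℝ E * (5 ^ Module.finrank ℝ E) ^ j := Nat.mul_le_mul hS1 hT1
        _ = _ := by rw [pow_succ, mul_comm]
    · have hR : 0 < r * 2 ^ j := by positivity
      obtain ⟨s, hs, hs'⟩ := hS2 ((r * 2 ^ j)⁻¹ • u) (by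
        rw [norm_smul, norm_inv, Real.norm_of_nonneg hR.le, inv_mul_le_iff₀ hR]
        rw [pow_succ] at hu; linarith)
      obtain ⟨t, ht, ht'⟩ := hT2 (u - (r * 2 ^ j) • s) (by
        have : u - (r * 2 ^ j) • s = (r * 2 ^ j) • ((r * 2 ^ j)⁻¹ • u - s) := by
          rw [smul_sub, smul_inv_smul₀ hR.ne']
        rw [this, norm_smul, Real.norm_of_nonneg hR.le]
        exact mul_le_of_le_one_right hR.le hs')
      exact ⟨_, Finset.mem_image₂_of_mem hs ht, by rwa [← sub_sub]⟩

end Nets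

/-! ### The common part of two distributions, split along a mixture. -/

section Decomposition

variable {X : Type*} [MeasurableSpace X]

/-- The witness is the minimum of the two measures, glued from the two sides of a Hahn
decomposition. -/
lemma exists_le_le_one_sub_tvDist_le (f g : ProbabilityMeasure X) :
    ∃ ν : Measure X, ν ≤ f ∧ ν ≤ g ∧ 1 - tvDist f g ≤ ν.real Set.univ := by
  obtain ⟨s, hs, h1, h2⟩ := hahn_decomposition (f : Measure X) (g : Measure X)
  refine ⟨(g : Measure X).restrict s + (f : Measure X).restrict sᶜ, ?_, ?_, ?_⟩
  · refine Measure.le_iff.2 fun B hB => ?_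
    rw [Measure.add_apply, Measure.restrict_apply hB, Measure.restrict_apply hB,
      ← measure_inter_add_sdiff (μ := (f : Measure X)) B hs]
    exact add_le_add (h1 _ (hB.inter hs) Set.inter_subset_right) le_rfl
  · refine Measure.le_iff.2 fun B hB => ?_
    rw [Measure.add_apply, Measure.restrict_apply hB, Measure.restrict_apply hB,
      ← measure_inter_add_sdiff (μ := (g : Measure X)) B hs]
    exact add_le_add le_rfl (h2 _ (hB.inter hs.compl) Set.inter_subset_right)
  · have e : ((g : Measure X).restrict s + (f : Measure X).restrict sᶜ).real Set.univ =
        (g : Measure X).real s + (f : Measure X).real sᶜ := by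
      simp [Measure.real, ENNReal.toReal_add]
    have h3 := measureReal_sub_le_tvDist f g hs
    rw [e, probReal_compl_eq_one_sub hs]
    linarith

/-- The common part has a density at most one with respect to the mixture; the same density cuts a
piece out of each weighted component. -/
lemma exists_submeasures_of_mixture {k : ℕ} {w : Fin k → ℝ} (f : Fin k → ProbabilityMeasure X)
    (F g : ProbabilityMeasure X)
    (hF : (F : Measure X) = ∑ i, ENNReal.ofReal (w i) • (f i : Measure X)) :
    ∃ ν : Fin k → Measure X, (∀ i, ν i ≤ ENNReal.ofReal (w i) • (f i : Measure X)) ∧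
      ∑ i, ν i ≤ g ∧ 1 - tvDist F g ≤ (∑ i, ν i).real Set.univ := by
  obtain ⟨ν, h1, h2, h3⟩ := exists_le_le_one_sub_tvDist_le F g
  have : IsFiniteMeasure ν := isFiniteMeasure_of_le _ h1
  -- Truncation makes the density at most one everywhere, so the bound holds for every component
  -- without discussing null sets.
  let ρ : X → ENNReal := fun x => min (ν.rnDeriv F x) 1
  have hρm : Measurable ρ := (Measure.measurable_rnDeriv _ _).min measurable_const
  have hρ : (F : Measure X).withDensity ρ = ν := by
    rw [← Measure.withDensity_rnDeriv_eq ν F (Measure.absolutelyContinuous_of_le h1)]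
    refine withDensity_congr_ae ?_
    filter_upwards [Measure.rnDeriv_le_one_of_le h1] with x hx
    exact min_eq_left hx
  have hsum : ∑ i, (ENNReal.ofReal (w i) • (f i : Measure X)).withDensity ρ = ν := by
    rw [← hρ, hF, ← Measure.sum_fintype, ← Measure.sum_fintype, withDensity_sum]
  refine ⟨fun i => (ENNReal.ofReal (w i) • (f i : Measure X)).withDensity ρ, fun i => ?_, ?_, ?_⟩
  · calc _ ≤ (ENNReal.ofReal (w i) • (f i : Measure X)).withDensity 1 :=
          withDensity_mono (ae_of_all _ fun x => min_le_right _ _)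
      _ = _ := withDensity_one
  · rw [hsum]; exact h2
  · rw [hsum]; exact h3

end Decomposition

/-! ### Moments of distributions dominated by twice a Gaussian. -/

section Moments

variable {d : ℕ}

/-- The standard Gaussian measure on `Fin d → ℝ`. -/
noncomputable abbrev stdNormal (d : ℕ) : Measure (Fin d → ℝ) :=
  Measure.pi fun _ => gaussianReal 0 1

lemma integrable_of_le_two_smul {X : Type*} [MeasurableSpace X] {H γ : Measure X}
    (h : H ≤ (2 : ENNReal) • γ) {φ : X → ℝ} (hφ : Integrable φ γ) : Integrable φ H :=
  (hφ.smul_measure (by simp)).mono_measure h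

lemma integral_le_two_mul_of_le {X : Type*} [MeasurableSpace X] {H γ : Measure X}
    (h : H ≤ (2 : ENNReal) • γ) {φ : X → ℝ} (hφ : Integrable φ γ) (h0 : ∀ x, 0 ≤ φ x) :
    ∫ x, φ x ∂H ≤ 2 * ∫ x, φ x ∂γ := by
  calc ∫ x, φ x ∂H ≤ ∫ x, φ x ∂((2 : ENNReal) • γ) :=
        integral_mono_measure h (ae_of_all _ h0) (hφ.smul_measure (by simp))
    _ = _ := by rw [integral_smul_measure]; simp

lemma sq_integral_le_integral_sq {X : Type*} [MeasurableSpace X] (H : Measure X)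
    [IsProbabilityMeasure H] {φ : X → ℝ} (hφ : MemLp φ 2 H) :
    (∫ x, φ x ∂H) ^ 2 ≤ ∫ x, φ x ^ 2 ∂H := by
  have h1 := variance_nonneg φ H
  rw [variance_eq_sub hφ] at h1
  simp only [Pi.pow_apply] at h1
  linarith

/-- Dual estimate of the mean of a coordinatewise centred statistic, under a distribution
dominated by twice the standard Gaussian. -/
lemma sum_sq_integral_le (H : Measure (Fin d → ℝ)) [IsProbabilityMeasure H]
    (hH : H ≤ (2 : ENNReal) • stdNormal d) {ψ : ℝ → ℝ} (hψ : MemLp ψ 2 (gaussianReal 0 1))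
    (h0 : ∫ x, ψ x ∂gaussianReal 0 1 = 0) :
    ∑ j, (∫ z, ψ (z j) ∂H) ^ 2 ≤ 2 * ∫ x, ψ x ^ 2 ∂gaussianReal 0 1 := by
  set b : Fin d → ℝ := fun j => ∫ z, ψ (z j) ∂H with hb
  set M := ∫ x, ψ x ^ 2 ∂gaussianReal 0 1 with hM
  have hM0 : 0 ≤ M := integral_nonneg fun x => sq_nonneg _
  have hψj : ∀ j, MemLp (fun z : Fin d → ℝ => ψ (z j)) 2 (stdNormal d) := fun j =>
    hψ.comp_measurePreserving (measurePreserving_eval (fun _ : Fin d => gaussianReal 0 1) j)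
  -- Test function whose coefficients are the unknown means `b j`. Its mean under `H` is `∑ b j ^
  -- 2`, and by independence its second moment under the Gaussian is `(∑ b j ^ 2) * M`.
  -- Cauchy–Schwarz and the domination give `(∑ b j ^ 2) ^ 2 ≤ 2 * M * ∑ b j ^ 2`.
  set F : (Fin d → ℝ) → ℝ := ∑ j, fun z => b j * ψ (z j) with hF
  have hFL : MemLp F 2 (stdNormal d) := memLp_finsetSum' _ fun j _ => (hψj j).const_mul _
  have hle : MemLp F 2 H := (hFL.smul_measure (c := 2) (by simp)).mono_measure hH
  have hvar : ∫ z, F z ^ 2 ∂stdNormal d = (∑ j, b j ^ 2) * M := by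
    have e0 : ∫ z, F z ∂stdNormal d = 0 := by
      simp only [hF, Finset.sum_apply]
      rw [integral_finsetSum _ fun j _ => ((hψj j).const_mul (b j)).integrable one_le_two]
      refine Finset.sum_eq_zero fun j _ => ?_
      rw [integral_const_mul, integral_comp_eval (μ := fun _ : Fin d => gaussianReal 0 1)
        (i := j) hψ.aestronglyMeasurable, h0, mul_zero]
    have e1 : Var[F; stdNormal d] = ∑ j, Var[fun x => b j * ψ x; gaussianReal 0 1] :=
      variance_sum_pi (μ := fun _ : Fin d => gaussianReal 0 1) (X := fun j x => b j * ψ x)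
        fun j => hψ.const_mul _
    rw [variance_of_integral_eq_zero hFL.aemeasurable e0] at e1
    rw [e1, Finset.sum_mul]
    refine Finset.sum_congr rfl fun j _ => ?_
    rw [variance_const_mul, variance_of_integral_eq_zero hψ.aemeasurable h0]
  have h1 : ∑ j, b j ^ 2 = ∫ z, F z ∂H := by
    simp only [hF, Finset.sum_apply]
    rw [integral_finsetSum _ fun j _ => (integrable_of_le_two_smul hH
      ((hψj j).integrable one_le_two)).const_mul (b j)]
    refine Finset.sum_congr rfl fun j _ => ?_
    rw [integral_const_mul, sq]
  have h2 : (∑ j, b j ^ 2) ^ 2 ≤ 2 * ((∑ j, b j ^ 2) * M) := by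
    calc (∑ j, b j ^ 2) ^ 2 = (∫ z, F z ∂H) ^ 2 := by rw [h1]
      _ ≤ ∫ z, F z ^ 2 ∂H := sq_integral_le_integral_sq H hle
      _ ≤ 2 * ∫ z, F z ^ 2 ∂stdNormal d :=
          integral_le_two_mul_of_le hH hFL.integrable_sq fun _ => sq_nonneg _
      _ = _ := by rw [hvar]
  have h3 : 0 ≤ ∑ j, b j ^ 2 := Finset.sum_nonneg fun j _ => sq_nonneg _
  rcases h3.eq_or_lt with h4 | h4
  · rw [← h4]; positivity
  · nlinarith

/-- The fourth moment of the standard normal distribution. -/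
noncomputable def normalFourthMoment : ℝ := ∫ x, x ^ 4 ∂gaussianReal 0 1

lemma integrable_pow_gaussianReal (n : ℕ) : Integrable (fun x : ℝ => x ^ n) (gaussianReal 0 1) := by
  have := (memLp_id_gaussianReal (μ := 0) (v := 1) n).integrable_norm_pow'
  refine (integrable_norm_iff (by fun_prop)).1 ?_
  simpa using this

lemma memLp_pow_gaussianReal (n : ℕ) : MemLp (fun x : ℝ => x ^ n) 2 (gaussianReal 0 1) := by
  rw [memLp_two_iff_integrable_sq (by fun_prop)]
  simp_rw [← pow_mul]
  exact integrable_pow_gaussianReal _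

lemma integral_sq_gaussianReal : ∫ x, x ^ 2 ∂gaussianReal 0 1 = 1 := by
  have h := variance_fun_id_gaussianReal (μ := 0) (v := 1)
  rw [variance_of_integral_eq_zero (by fun_prop) (by simp)] at h
  simpa using h

lemma one_le_normalFourthMoment : 1 ≤ normalFourthMoment := by
  have := sq_integral_le_integral_sq (gaussianReal 0 1) (memLp_pow_gaussianReal 2)
  rw [integral_sq_gaussianReal] at this
  simp_rw [← pow_mul] at this
  simpa [normalFourthMoment] using this

lemma gaussianReal_Ioo_le (m t : ℝ) :
    gaussianReal 0 1 (Set.Ioo (m - t) (m + t)) ≤ ENNReal.ofReal (2 * t) := by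
  rw [gaussianReal_apply _ one_ne_zero]
  have hpdf : ∀ x, gaussianPDF 0 1 x ≤ 1 := by
    intro x
    rw [gaussianPDF, ← ENNReal.ofReal_one]
    refine ENNReal.ofReal_le_ofReal ?_
    simp only [gaussianPDFReal, NNReal.coe_one, mul_one]
    refine mul_le_one₀ (inv_le_one_of_one_le₀ ?_) (Real.exp_pos _).le ?_
    · rw [Real.one_le_sqrt]
      have := Real.pi_gt_three
      linarith
    · rw [Real.exp_le_one_iff]
      have : 0 ≤ (x - 0) ^ 2 := sq_nonneg _
      rw [neg_div]
      linarith [div_nonneg this (zero_le_two (α := ℝ))]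
  calc _ ≤ ∫⁻ _ in Set.Ioo (m - t) (m + t), 1 := lintegral_mono fun x => hpdf x
    _ = _ := by
      rw [setLIntegral_one, Real.volume_Ioo]
      congr 1; ring

/-- Anti-concentration: a distribution dominated by twice the standard normal one has variance
bounded below. -/
lemma le_integral_sq_sub_sq_integral (H : Measure ℝ) [IsProbabilityMeasure H]
    (hH : H ≤ (2 : ENNReal) • gaussianReal 0 1) :
    1 / 512 ≤ ∫ x, x ^ 2 ∂H - (∫ x, x ∂H) ^ 2 := by
  have hL : MemLp (fun x : ℝ => x) 2 H := by
    have := memLp_pow_gaussianReal 1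
    simp only [pow_one] at this
    exact (this.smul_measure (c := 2) (by simp)).mono_measure hH
  set m := ∫ x, x ∂H with hm
  have hvar : ∫ x, x ^ 2 ∂H - m ^ 2 = ∫ x, (x - m) ^ 2 ∂H := by
    have h1 := variance_eq_sub hL
    have h2 := variance_eq_integral (μ := H) (X := fun x : ℝ => x) (by fun_prop)
    simp only [Pi.pow_apply] at h1
    rw [← h1, h2]
  rw [hvar]
  -- An interval of half-width `1 / 16` has normal mass at most `1 / 8`, hence mass at most `1 / 4`
  -- under `H`. The remaining `3 / 4` lies at squared distance at least `1 / 256` from the mean.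
  set A : Set ℝ := (Set.Ioo (m - 1 / 16) (m + 1 / 16))ᶜ with hA
  have hAm : MeasurableSet A := measurableSet_Ioo.compl
  have h1 : H.real (Set.Ioo (m - 1 / 16) (m + 1 / 16)) ≤ 1 / 4 := by
    refine ENNReal.toReal_le_of_le_ofReal (by norm_num) ?_
    calc H (Set.Ioo (m - 1 / 16) (m + 1 / 16))
        ≤ 2 * gaussianReal 0 1 (Set.Ioo (m - 1 / 16) (m + 1 / 16)) := hH _
      _ ≤ 2 * ENNReal.ofReal (2 * (1 / 16)) := by gcongr; exact gaussianReal_Ioo_le _ _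
      _ = ENNReal.ofReal (1 / 4) := by
          rw [← ENNReal.ofReal_ofNat 2, ← ENNReal.ofReal_mul (by norm_num)]; norm_num
  have h2 : 3 / 4 ≤ H.real A := by
    rw [hA, probReal_compl_eq_one_sub measurableSet_Ioo]; linarith
  have hsq : Integrable (fun x => (x - m) ^ 2) H := (hL.sub (memLp_const m)).integrable_sq
  calc (1 / 512 : ℝ) ≤ H.real A * (1 / 256) := by linarith
    _ = ∫ x, A.indicator (fun _ => (1 / 256 : ℝ)) x ∂H := by
        rw [integral_indicator hAm]; simp
    _ ≤ ∫ x, (x - m) ^ 2 ∂H := by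
        refine integral_mono ((integrable_const _).indicator hAm) hsq fun x => ?_
        by_cases hx : x ∈ A
        · simp only [Set.indicator_of_mem hx]
          simp only [hA, Set.mem_compl_iff, Set.mem_Ioo, not_and_or, not_lt] at hx
          rcases hx with hx | hx <;> nlinarith
        · simp only [Set.indicator_of_notMem hx]; positivity

/-- Moments of a distribution on `ℝ^d` that is dominated by twice the standard Gaussian. -/
structure HasBoundedMoments (H : Measure (Fin d → ℝ)) : Prop where
  memLp_pow : ∀ j, ∀ n : ℕ, MemLp (fun z : Fin d → ℝ => z j ^ n) 2 H
  integral_sq_le : ∀ j, ∫ z, z j ^ 2 ∂H ≤ 2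
  integral_four_le : ∀ j, ∫ z, z j ^ 4 ∂H ≤ 2 * normalFourthMoment
  sum_mean_sq_le : ∑ j, (∫ z, z j ∂H) ^ 2 ≤ 2
  sum_second_sq_le : ∑ j, (∫ z, z j ^ 2 ∂H - 1) ^ 2 ≤ 2 * normalFourthMoment
  le_variance : ∀ j, 1 / 512 ≤ ∫ z, z j ^ 2 ∂H - (∫ z, z j ∂H) ^ 2

/-- Individual moments are inherited from the domination. The two dimension-free sums come from
`sum_sq_integral_le` with the centred statistics `x` and `x ^ 2 - 1`. -/
lemma hasBoundedMoments_of_le (H : Measure (Fin d → ℝ)) [IsProbabilityMeasure H]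
    (hH : H ≤ (2 : ENNReal) • stdNormal d) : HasBoundedMoments H := by
  have hint : ∀ j, ∀ n : ℕ, Integrable (fun z : Fin d → ℝ => z j ^ n) (stdNormal d) := fun j n =>
    integrable_comp_eval (μ := fun _ : Fin d => gaussianReal 0 1) (i := j)
      (integrable_pow_gaussianReal n)
  have hev : ∀ j, ∀ n : ℕ, ∫ z, z j ^ n ∂stdNormal d = ∫ x, x ^ n ∂gaussianReal 0 1 := fun j n =>
    integral_comp_eval (μ := fun _ : Fin d => gaussianReal 0 1) (i := j) (f := fun x => x ^ n)
      (by fun_prop)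
  have hmem : ∀ j, ∀ n : ℕ, MemLp (fun z : Fin d → ℝ => z j ^ n) 2 H := fun j n =>
    (((memLp_pow_gaussianReal n).comp_measurePreserving
      (measurePreserving_eval (fun _ : Fin d => gaussianReal 0 1) j)).smul_measure
        (c := 2) (by simp)).mono_measure hH
  refine ⟨hmem, fun j => ?_, fun j => ?_, ?_, ?_, fun j => ?_⟩
  · have := integral_le_two_mul_of_le hH (hint j 2) fun z => by positivity
    rwa [hev, integral_sq_gaussianReal, mul_one] at this
  · have := integral_le_two_mul_of_le hH (hint j 4) fun z => by positivity
    rwa [hev] at this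
  · have := sum_sq_integral_le H hH (ψ := fun x => x) (by simpa using memLp_pow_gaussianReal 1)
      (by simp)
    simpa [integral_sq_gaussianReal] using this
  · have hL : MemLp (fun x : ℝ => x ^ 2 - 1) 2 (gaussianReal 0 1) :=
      (memLp_pow_gaussianReal 2).sub (memLp_const 1)
    have h0 : ∫ x, (x ^ 2 - 1 : ℝ) ∂gaussianReal 0 1 = 0 := by
      rw [integral_sub (integrable_pow_gaussianReal 2) (integrable_const _),
        integral_sq_gaussianReal]; simp
    have h2 : ∫ x, (x ^ 2 - 1 : ℝ) ^ 2 ∂gaussianReal 0 1 = normalFourthMoment - 1 := by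
      have e : ∀ x : ℝ, (x ^ 2 - 1) ^ 2 = x ^ 4 - 2 * x ^ 2 + 1 := fun x => by ring
      simp_rw [e]
      have hd : Integrable (fun x : ℝ => x ^ 4 - 2 * x ^ 2) (gaussianReal 0 1) :=
        (integrable_pow_gaussianReal 4).sub ((integrable_pow_gaussianReal 2).const_mul 2)
      rw [integral_add hd (integrable_const _),
        integral_sub (integrable_pow_gaussianReal 4) ((integrable_pow_gaussianReal 2).const_mul 2),
        integral_const_mul, integral_sq_gaussianReal]
      simp [normalFourthMoment]; ring
    have := sum_sq_integral_le H hH hL h0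
    rw [h2] at this
    calc _ = ∑ j, (∫ z, (z j ^ 2 - 1) ∂H) ^ 2 := by
          refine Finset.sum_congr rfl fun j _ => ?_
          rw [integral_sub ((hmem j 2).integrable one_le_two) (integrable_const _)]
          simp
      _ ≤ _ := this
      _ ≤ _ := by linarith
  · have hm : Measurable fun z : Fin d → ℝ => z j := measurable_pi_apply j
    have : IsProbabilityMeasure (H.map fun z => z j) :=
      Measure.isProbabilityMeasure_map hm.aemeasurable
    have hle : H.map (fun z => z j) ≤ (2 : ENNReal) • gaussianReal 0 1 := by
      rw [← (measurePreserving_eval (fun _ : Fin d => gaussianReal 0 1) j).map_eq,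
        ← Measure.map_smul]
      exact Measure.map_mono hH hm
    have h := le_integral_sq_sub_sq_integral (H.map fun z => z j) hle
    rwa [integral_map hm.aemeasurable (by fun_prop), integral_map hm.aemeasurable (by fun_prop)]
      at h

end Moments

/-! ### Concentration of averages over a random subsample. -/

section Blocks

variable {Y : Type*} [MeasurableSpace Y]

lemma integral_sq_sum_pi (lam : Measure Y) [IsProbabilityMeasure lam] (n : ℕ) {ψ : Y → ℝ}
    (hψ : MemLp ψ 2 lam) (h0 : ∫ y, ψ y ∂lam = 0) :
    Integrable (fun y : Fin n → Y => (∑ l, ψ (y l)) ^ 2) (Measure.pi fun _ => lam) ∧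
    ∫ y, (∑ l, ψ (y l)) ^ 2 ∂(Measure.pi fun _ : Fin n => lam) = n * ∫ y, ψ y ^ 2 ∂lam := by
  have hl : ∀ l : Fin n, MemLp (fun y : Fin n → Y => ψ (y l)) 2 (Measure.pi fun _ => lam) :=
    fun l => hψ.comp_measurePreserving (measurePreserving_eval (fun _ : Fin n => lam) l)
  have hF : MemLp (∑ l, fun y : Fin n → Y => ψ (y l)) 2 (Measure.pi fun _ => lam) :=
    memLp_finsetSum' _ fun l _ => hl l
  have e : (∑ l, fun y : Fin n → Y => ψ (y l)) = fun y => ∑ l, ψ (y l) := by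
    ext y; simp
  refine ⟨by rw [e] at hF; exact hF.integrable_sq, ?_⟩
  have hv := variance_sum_pi (μ := fun _ : Fin n => lam) (X := fun _ => ψ) fun _ => hψ
  rw [e] at hv hF
  rw [variance_of_integral_eq_zero hF.aemeasurable] at hv
  · rw [hv, Finset.sum_const, variance_of_integral_eq_zero hψ.aemeasurable h0]; simp
  · rw [integral_finsetSum _ fun l _ => (hl l).integrable one_le_two]
    refine Finset.sum_eq_zero fun l _ => ?_
    rw [integral_comp_eval (μ := fun _ : Fin n => lam) (i := l) hψ.aestronglyMeasurable, h0]

variable {J : Type*} [Fintype J]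

/-- The points of index in `S` have averages of the statistics `φ` that are `η`-close to `a`. -/
def AveragesClose {ι : Type*} (φ : J → Y → ℝ) (a : J → ℝ) (η : ℝ) (y : ι → Y)
    (S : Finset ι) : Prop :=
  S.Nonempty ∧ ∑ j, ((∑ l ∈ S, φ j (y l)) / S.card - a j) ^ 2 ≤ η ^ 2

open Classical in
/-- In an i.i.d. sample, the averages of statistics over the points that fall into `A` are close
to the conditional means with probability at least one half. -/
lemma measure_not_averagesClose_le (lam : Measure Y) [IsProbabilityMeasure lam] {A : Set Y}
    (hA : MeasurableSet A) {φ : J → Y → ℝ} (hφ : ∀ j, MemLp (φ j) 2 (lam.restrict A))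
    {V η : ℝ} (hη : 0 < η) (hηV : η ^ 2 ≤ V) {n : ℕ} (hc : 0 < lam.real A)
    (hV : ∑ j, ∫ y in A, φ j y ^ 2 ∂lam ≤ lam.real A * V)
    (hn : 16 * V ≤ n * lam.real A * η ^ 2) :
    (Measure.pi fun _ : Fin n => lam) {y | ¬ AveragesClose φ
      (fun j => (∫ z in A, φ j z ∂lam) / lam.real A) η y
      (Finset.univ.filter fun l => y l ∈ A)} ≤ 2⁻¹ := by
  set c := lam.real A with hcd
  set a : J → ℝ := fun j => (∫ z in A, φ j z ∂lam) / c with ha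
  have hη2 : 0 < η ^ 2 := by positivity
  have hVp : 0 < V := hη2.trans_le hηV
  have hnc : 16 ≤ n * c := by
    by_contra! h
    nlinarith
  have hfin : IsFiniteMeasure (lam.restrict A) := inferInstance
  -- Centred summands: `∑ ψ j` measures the deviation of the average over the points in `A`, and `∑
  -- χ` the deviation of their number from `n * c`.
  let ψ : J → Y → ℝ := fun j => A.indicator fun y => φ j y - a j
  let χ : Y → ℝ := fun y => A.indicator (fun _ => (1 : ℝ)) y - c
  have hψL : ∀ j, MemLp (ψ j) 2 lam := fun j =>
    (memLp_indicator_iff_restrict hA).2 ((hφ j).sub (memLp_const _))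
  have hχL : MemLp χ 2 lam := (memLp_indicator_const 2 hA 1 (Or.inr (by simp))).sub (memLp_const c)
  have hφI : ∀ j, Integrable (φ j) (lam.restrict A) := fun j => (hφ j).integrable one_le_two
  have hψ0 : ∀ j, ∫ y, ψ j y ∂lam = 0 := by
    intro j
    rw [integral_indicator hA, integral_sub (hφI j) (integrable_const _)]
    simp only [integral_const, measureReal_restrict_apply_univ, smul_eq_mul, ha]
    rw [← hcd]; field_simp; ring
  have hχ0 : ∫ y, χ y ∂lam = 0 := by
    rw [integral_sub ((integrable_const _).indicator hA) (integrable_const _),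
      integral_indicator hA]
    simp [hcd]
  have hψ2 : ∀ j, ∫ y, ψ j y ^ 2 ∂lam ≤ ∫ y in A, φ j y ^ 2 ∂lam := by
    intro j
    have e : ∀ y, ψ j y ^ 2 = A.indicator (fun y => (φ j y - a j) ^ 2) y := by
      intro y; by_cases hy : y ∈ A <;> simp [ψ, hy]
    simp_rw [e]
    rw [integral_indicator hA]
    have e2 : ∀ y, (φ j y - a j) ^ 2 = φ j y ^ 2 - 2 * a j * φ j y + a j ^ 2 := fun y => by ring
    simp_rw [e2]
    have h1 : Integrable (fun y => φ j y ^ 2 - 2 * a j * φ j y) (lam.restrict A) :=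
      (hφ j).integrable_sq.sub ((hφI j).const_mul _)
    rw [integral_add h1 (integrable_const _), integral_sub (hφ j).integrable_sq
      ((hφI j).const_mul _), integral_const_mul]
    have h3 : ∫ y in A, φ j y ∂lam = a j * c := by simp only [ha]; field_simp
    simp only [h3, integral_const, measureReal_restrict_apply_univ, smul_eq_mul]
    rw [← hcd]
    nlinarith [mul_nonneg hc.le (sq_nonneg (a j))]
  have hχ2 : ∫ y, χ y ^ 2 ∂lam ≤ c := by
    have e : ∀ y, χ y ^ 2 = (1 - 2 * c) * A.indicator (fun _ => (1 : ℝ)) y + c ^ 2 := by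
      intro y; by_cases hy : y ∈ A <;> simp [χ, hy]; ring
    simp_rw [e]
    rw [integral_add (((integrable_const _).indicator hA).const_mul _) (integrable_const _),
      integral_const_mul, integral_indicator hA]
    simp only [integral_const, measureReal_restrict_apply_univ, smul_eq_mul, probReal_univ]
    rw [← hcd]
    nlinarith [sq_nonneg c]
  -- The weight `V` balances the two parts, so that a single application of Markov's inequality
  -- controls the averages and the subsample size together.
  let T : (Fin n → Y) → ℝ := fun y => ∑ j, (∑ l, ψ j (y l)) ^ 2 + V * (∑ l, χ (y l)) ^ 2
  have hI1 : Integrable (fun y : Fin n → Y => ∑ j, (∑ l, ψ j (y l)) ^ 2)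
      (Measure.pi fun _ => lam) :=
    integrable_finsetSum _ fun j _ => (integral_sq_sum_pi lam n (hψL j) (hψ0 j)).1
  have hI2 := (integral_sq_sum_pi lam n hχL hχ0).1
  have hTI : Integrable T (Measure.pi fun _ => lam) := hI1.add (hI2.const_mul V)
  have hTle : ∫ y, T y ∂(Measure.pi fun _ : Fin n => lam) ≤ 2 * (n * c * V) := by
    rw [integral_add hI1 (hI2.const_mul V), integral_const_mul,
      (integral_sq_sum_pi lam n hχL hχ0).2,
      integral_finsetSum _ fun j _ => (integral_sq_sum_pi lam n (hψL j) (hψ0 j)).1]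
    simp_rw [fun j => (integral_sq_sum_pi lam n (hψL j) (hψ0 j)).2]
    rw [← Finset.mul_sum]
    have h1 : ∑ j, ∫ y, ψ j y ^ 2 ∂lam ≤ c * V := (Finset.sum_le_sum fun j _ => hψ2 j).trans hV
    have h2 : (n : ℝ) * ∑ j, ∫ y, ψ j y ^ 2 ∂lam ≤ n * (c * V) := by gcongr
    have h3 : V * ((n : ℝ) * ∫ y, χ y ^ 2 ∂lam) ≤ V * (n * c) := by gcongr
    linarith
  have hncV : 0 < n * c * V := by positivity
  have hmarkov := mul_meas_ge_le_integral_of_nonneg (μ := Measure.pi fun _ : Fin n => lam)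
    (f := T) (ae_of_all _ fun y => by positivity) hTI (4 * (n * c * V))
  have hprob : (Measure.pi fun _ : Fin n => lam).real {y | 4 * (n * c * V) ≤ T y} ≤ 1 / 2 := by
    have := hmarkov.trans hTle
    by_contra! h
    nlinarith
  have hsub : {y : Fin n → Y | ¬ AveragesClose φ a η y (Finset.univ.filter fun l => y l ∈ A)} ⊆
      {y | 4 * (n * c * V) ≤ T y} := by
    intro y hy
    by_contra hlt
    refine hy ?_
    have hlt' : T y < 4 * (n * c * V) := not_le.1 hlt
    set S := Finset.univ.filter fun l => y l ∈ A with hS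
    have hψS : ∀ j, ∑ l, ψ j (y l) = ∑ l ∈ S, φ j (y l) - S.card * a j := by
      intro j
      simp only [ψ, Set.indicator_apply]
      rw [← Finset.sum_filter, Finset.sum_sub_distrib]
      simp [hS]
    have hχS : ∑ l, χ (y l) = S.card - n * c := by
      simp only [χ, Set.indicator_apply]
      rw [Finset.sum_sub_distrib, ← Finset.sum_filter]
      simp [hS]
    have hT1 : ∑ j, (∑ l, ψ j (y l)) ^ 2 ≤ 4 * (n * c * V) := by
      have : 0 ≤ V * (∑ l, χ (y l)) ^ 2 := by positivity
      have h : T y = ∑ j, (∑ l, ψ j (y l)) ^ 2 + V * (∑ l, χ (y l)) ^ 2 := rfl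
      linarith
    have hT2 : (∑ l, χ (y l)) ^ 2 ≤ 4 * (n * c) := by
      have : 0 ≤ ∑ j, (∑ l, ψ j (y l)) ^ 2 := Finset.sum_nonneg fun j _ => sq_nonneg _
      have h : T y = ∑ j, (∑ l, ψ j (y l)) ^ 2 + V * (∑ l, χ (y l)) ^ 2 := rfl
      have : V * (∑ l, χ (y l)) ^ 2 ≤ V * (4 * (n * c)) := by nlinarith
      exact le_of_mul_le_mul_left this hVp
    -- Fewer than `n * c / 2` points would mean a squared deviation above `(n * c) ^ 2 / 4`, which
    -- is at least `4 * (n * c)` since `n * c ≥ 16`.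
    have hcard : n * c / 2 ≤ S.card := by
      rw [hχS] at hT2
      by_contra! h
      nlinarith
    have hSpos : (0 : ℝ) < S.card := by linarith
    refine ⟨Finset.card_pos.1 (by exact_mod_cast hSpos), ?_⟩
    have e : ∀ j, ((∑ l ∈ S, φ j (y l)) / S.card - a j) ^ 2 =
        (∑ l, ψ j (y l)) ^ 2 / (S.card : ℝ) ^ 2 := by
      intro j; rw [hψS, ← div_pow]; congr 1; field_simp
    simp_rw [e]
    rw [← Finset.sum_div, div_le_iff₀ (by positivity)]
    calc _ ≤ 4 * (n * c * V) := hT1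
      _ ≤ η ^ 2 * (n * c / 2) ^ 2 := by nlinarith
      _ ≤ _ := by gcongr
  refine (measure_mono hsub).trans ?_
  rw [← ofReal_measureReal]
  calc _ ≤ ENNReal.ofReal (1 / 2) := ENNReal.ofReal_le_ofReal hprob
    _ = 2⁻¹ := by rw [one_div, ENNReal.ofReal_inv_of_pos (by norm_num)]; simp

end Blocks

/-! ### Hidden labels and amplification over independent blocks. -/

section Labels

lemma measurableSet_snd_eq {X O : Type*} [MeasurableSpace X] [MeasurableSpace O]
    [MeasurableSingletonClass O] (o : O) : MeasurableSet {p : X × O | p.2 = o} :=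
  measurable_snd (measurableSet_singleton o)

variable {X : Type*} [MeasurableSpace X] {O : Type*} [Fintype O]

/-- The joint law of a point and its label, where the points with label `o` have intensity
`ν o`. -/
noncomputable def labelledLaw [MeasurableSpace O] (ν : O → Measure X) : Measure (X × O) :=
  ∑ o, (ν o).map fun x => (x, o)

variable [MeasurableSpace O]

lemma map_fst_labelledLaw (ν : O → Measure X) :
    (labelledLaw ν).map Prod.fst = ∑ o, ν o := by
  rw [labelledLaw, ← Measure.sum_fintype, Measure.map_sum measurable_fst.aemeasurable,
    Measure.sum_fintype]
  refine Finset.sum_congr rfl fun o _ => ?_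
  rw [Measure.map_map measurable_fst (by fun_prop)]
  exact Measure.map_id

lemma isProbabilityMeasure_labelledLaw (ν : O → Measure X) (g : Measure X)
    [IsProbabilityMeasure g] (hν : ∑ o, ν o = g) : IsProbabilityMeasure (labelledLaw ν) := by
  have h := map_fst_labelledLaw ν
  rw [hν] at h
  constructor
  rw [← measure_univ (μ := g), ← h, Measure.map_apply measurable_fst MeasurableSet.univ]
  rfl

variable [MeasurableSingletonClass O]

lemma restrict_labelledLaw (ν : O → Measure X) (o : O) :
    (labelledLaw ν).restrict {p | p.2 = o} = (ν o).map fun x => (x, o) := by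
  ext B hB
  rw [Measure.restrict_apply hB, labelledLaw, Measure.finsetSum_apply,
    Measure.map_apply (by fun_prop) hB, Finset.sum_eq_single o]
  · rw [Measure.map_apply (by fun_prop) (hB.inter (measurableSet_snd_eq o))]
    congr 1; ext x; simp
  · intro o' _ ho
    rw [Measure.map_apply (by fun_prop) (hB.inter (measurableSet_snd_eq o))]
    convert measure_empty (μ := ν o')
    ext x; simp [ho]
  · simp

variable {J : Type*} [Fintype J]

lemma averagesClose_map {Y : Type*} {ι ι' : Type*} (e : ι ↪ ι') (φ : J → Y → ℝ)
    (a : J → ℝ) (η : ℝ) (y : ι' → Y) (S : Finset ι) :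
    AveragesClose φ a η y (S.map e) ↔ AveragesClose φ a η (fun l => y (e l)) S := by
  simp [AveragesClose]

lemma measurableSet_averagesClose {ι : Type*} {φ : J → X → ℝ} (hφ : ∀ j, Measurable (φ j))
    (a : J → ℝ) (η : ℝ) (S : Finset ι) :
    MeasurableSet {y : ι → X | AveragesClose φ a η y S} := by
  change MeasurableSet ({_y | S.Nonempty} ∩
    {y : ι → X | ∑ j, ((∑ l ∈ S, φ j (y l)) / S.card - a j) ^ 2 ≤ η ^ 2})
  refine (MeasurableSet.const _).inter (measurableSet_le ?_ measurable_const)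
  refine Finset.measurable_sum _ fun j _ => Measurable.pow_const ?_ 2
  refine ((Finset.measurable_sum _ fun l _ => ?_).div_const _).sub_const _
  exact (hφ j).comp (measurable_pi_apply l)

/-- Sample points can be labelled, so that for each label in `I` the averages of the statistics
over the points with this label are close to their means under the normalised intensity. -/
theorem measure_not_exists_labelling_le [DecidableEq O] (ν : O → Measure X) (g : Measure X)
    [IsProbabilityMeasure g] (hν : ∑ o, ν o = g) (I : Finset O) {o₀ : O} (ho₀ : o₀ ∉ I)
    {φ : O → J → X → ℝ} (hφm : ∀ o j, Measurable (φ o j))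
    (hφ : ∀ o ∈ I, ∀ j, MemLp (φ o j) 2 (ν o)) {V η : ℝ} (hη : 0 < η) (hηV : η ^ 2 ≤ V)
    (B n : ℕ) (hpos : ∀ o ∈ I, 0 < (ν o).real Set.univ)
    (hV : ∀ o ∈ I, ∑ j, ∫ x, φ o j x ^ 2 ∂(ν o) ≤ (ν o).real Set.univ * V)
    (hn : ∀ o ∈ I, 16 * V ≤ n * (ν o).real Set.univ * η ^ 2) :
    (Measure.pi fun _ : Fin B => Measure.pi fun _ : Fin n => g)
      {x | ¬ ∃ L : Fin B × Fin n → O, ∀ o ∈ I, AveragesClose (φ o)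
        (fun j => (∫ z, φ o j z ∂(ν o)) / (ν o).real Set.univ) η
        (fun p : Fin B × Fin n => x p.1 p.2) (Finset.univ.filter fun p => L p = o)}
      ≤ I.card * (2⁻¹ : ENNReal) ^ B := by
  have hlam := isProbabilityMeasure_labelledLaw ν g hν
  set lam := labelledLaw ν with hlamd
  set a : O → J → ℝ := fun o j => (∫ z, φ o j z ∂(ν o)) / (ν o).real Set.univ with ha
  set D : Set (Fin B → Fin n → X) := {x | ¬ ∃ L : Fin B × Fin n → O, ∀ o ∈ I,
    AveragesClose (φ o) (a o) η (fun p : Fin B × Fin n => x p.1 p.2)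
      (Finset.univ.filter fun p => L p = o)} with hD
  have hDm : MeasurableSet D := by
    refine MeasurableSet.compl ?_
    have : {x : Fin B → Fin n → X | ∃ L : Fin B × Fin n → O, ∀ o ∈ I,
        AveragesClose (φ o) (a o) η (fun p : Fin B × Fin n => x p.1 p.2)
          (Finset.univ.filter fun p => L p = o)} = ⋃ L : Fin B × Fin n → O, ⋂ o ∈ I,
        (fun (x : Fin B → Fin n → X) (p : Fin B × Fin n) => x p.1 p.2) ⁻¹'
          {y | AveragesClose (φ o) (a o) η y (Finset.univ.filter fun p => L p = o)} := by
      ext x; simp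
    change MeasurableSet {x : Fin B → Fin n → X | ∃ L : Fin B × Fin n → O, ∀ o ∈ I,
        AveragesClose (φ o) (a o) η (fun p : Fin B × Fin n => x p.1 p.2)
          (Finset.univ.filter fun p => L p = o)}
    rw [this]
    refine MeasurableSet.iUnion fun L => Finset.measurableSet_biInter _ fun o _ => ?_
    exact (show Measurable fun (x : Fin B → Fin n → X) (p : Fin B × Fin n) => x p.1 p.2 by
      fun_prop) (measurableSet_averagesClose (hφm o) _ _ _)
  -- Forgetting the labels turns the labelled sample into an i.i.d. sample from `g`, so the
  -- existence of a good labelling may be proved in the labelled model.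
  have hmap : (Measure.pi fun _ : Fin B => Measure.pi fun _ : Fin n => lam).map
      (fun y b l => (y b l).1) = Measure.pi fun _ : Fin B => Measure.pi fun _ : Fin n => g := by
    have hg : lam.map Prod.fst = g := by rw [hlamd, map_fst_labelledLaw, hν]
    have h1 : (Measure.pi fun _ : Fin n => lam).map (fun y l => (y l).1) =
        Measure.pi fun _ : Fin n => g := by
      have : ∀ _ : Fin n, IsProbabilityMeasure (lam.map Prod.fst) := fun _ => by
        rw [hg]; infer_instance
      rw [Measure.pi_map_pi (μ := fun _ : Fin n => lam) (f := fun _ => Prod.fst)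
        fun _ => measurable_fst.aemeasurable, hg]
    have : ∀ _ : Fin B, IsProbabilityMeasure ((Measure.pi fun _ : Fin n => lam).map
        (fun y l => (y l).1)) := fun _ => by
      rw [h1]; infer_instance
    rw [Measure.pi_map_pi (μ := fun _ : Fin B => Measure.pi fun _ : Fin n => lam)
      (f := fun _ y l => (y l).1) fun _ => Measurable.aemeasurable (by fun_prop), h1]
  rw [← hmap, Measure.map_apply (by fun_prop) hDm]
  let bad : O → Set (Fin n → X × O) := fun o => {y | ¬ AveragesClose
    (fun j p => φ o j p.1) (a o) η y (Finset.univ.filter fun l => (y l).2 = o)}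
  have hbad : ∀ o ∈ I, (Measure.pi fun _ : Fin n => lam) (bad o) ≤ 2⁻¹ := by
    intro o ho
    have hrestr : lam.restrict {p | p.2 = o} = (ν o).map fun x => (x, o) :=
      restrict_labelledLaw ν o
    have hmp : Measurable fun x : X => (x, o) := by fun_prop
    have hreal : lam.real {p | p.2 = o} = (ν o).real Set.univ := by
      rw [← measureReal_restrict_apply_univ, hrestr, map_measureReal_apply hmp MeasurableSet.univ]
      rfl
    have hm1 : ∀ j, AEStronglyMeasurable (fun p : X × O => φ o j p.1)
        ((ν o).map fun x => (x, o)) := fun j =>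
      ((hφm o j).comp measurable_fst).aestronglyMeasurable
    have hm2 : ∀ j, AEStronglyMeasurable (fun p : X × O => φ o j p.1 ^ 2)
        ((ν o).map fun x => (x, o)) := fun j =>
      (((hφm o j).comp measurable_fst).pow_const 2).aestronglyMeasurable
    have hint : ∀ j, ∫ p in {p | p.2 = o}, φ o j p.1 ∂lam = ∫ x, φ o j x ∂(ν o) := fun j => by
      rw [hrestr, integral_map hmp.aemeasurable (hm1 j)]
    have hint2 : ∀ j, ∫ p in {p | p.2 = o}, φ o j p.1 ^ 2 ∂lam = ∫ x, φ o j x ^ 2 ∂(ν o) :=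
      fun j => by rw [hrestr, integral_map hmp.aemeasurable (hm2 j)]
    have h := measure_not_averagesClose_le lam (measurableSet_snd_eq o)
      (φ := fun j p => φ o j p.1) (V := V) (η := η) (n := n)
      (fun j => by
        rw [hrestr, memLp_map_measure_iff (hm1 j) hmp.aemeasurable]
        exact hφ o ho j) hη hηV (by rw [hreal]; exact hpos o ho)
      (by simp_rw [hint2]; rw [hreal]; exact hV o ho) (by rw [hreal]; exact hn o ho)
    simp_rw [hint, hreal] at h
    convert h using 8
    exact Iff.rfl
  have hsub : (fun (y : Fin B → Fin n → X × O) b l => (y b l).1) ⁻¹' D ⊆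
      ⋃ o ∈ I, Set.univ.pi fun _ : Fin B => bad o := by
    intro y hy
    by_contra hcon
    refine hy ?_
    simp only [Set.mem_iUnion, Set.mem_pi, Set.mem_univ, true_implies, not_exists, not_forall]
      at hcon
    have hgood : ∀ o : I, ∃ b : Fin B, AveragesClose (fun j p => φ o j p.1) (a o) η (y b)
        (Finset.univ.filter fun l => (y b l).2 = o) := fun o => by
      obtain ⟨b, hb⟩ := hcon o o.2
      exact ⟨b, not_not.1 hb⟩
    choose β hβ using hgood
    -- For each label in `I` the true labels are kept only in one block `β` where its averages are
    -- good; every other point gets the dummy label `o₀`. Failure for a label thus requires all `B`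
    -- blocks to be bad.
    refine ⟨fun p => if h : (y p.1 p.2).2 ∈ I then
      (if β ⟨_, h⟩ = p.1 then (y p.1 p.2).2 else o₀) else o₀, fun o ho => ?_⟩
    have hfilter : (Finset.univ.filter fun p : Fin B × Fin n =>
        (if h : (y p.1 p.2).2 ∈ I then
          (if β ⟨_, h⟩ = p.1 then (y p.1 p.2).2 else o₀) else o₀) = o) =
        (Finset.univ.filter fun l => (y (β ⟨o, ho⟩) l).2 = o).map
          ⟨fun l => (β ⟨o, ho⟩, l), fun l l' h => (Prod.mk.inj h).2⟩ := by
      have hne : o₀ ≠ o := fun h => ho₀ (h ▸ ho)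
      ext ⟨b, l⟩
      simp only [Finset.mem_filter, Finset.mem_univ, true_and, Finset.mem_map]
      constructor
      · intro h
        split_ifs at h with h1 h2
        · subst h
          exact ⟨l, by rw [h2], Prod.ext h2 rfl⟩
        · exact absurd h hne
        · exact absurd h hne
      · rintro ⟨l', hl', he⟩
        have hb : β ⟨o, ho⟩ = b := congrArg Prod.fst he
        have hl : l' = l := congrArg Prod.snd he
        rw [hb, hl] at hl'
        subst hl'
        rw [dif_pos ho, if_pos hb]
    rw [hfilter, averagesClose_map]
    exact hβ ⟨o, ho⟩
  refine (measure_mono hsub).trans ((measure_biUnion_finset_le _ _).trans ?_)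
  calc _ ≤ ∑ _o ∈ I, (2⁻¹ : ENNReal) ^ B := by
        refine Finset.sum_le_sum fun o ho => ?_
        rw [Measure.pi_pi, Finset.prod_const, Finset.card_univ, Fintype.card_fin]
        exact pow_le_pow_left₀ zero_le (hbad o ho) B
    _ = _ := by rw [Finset.sum_const, nsmul_eq_mul]

end Labels

/-! ### Recovering a Gaussian from empirical moments and a bounded correction. -/

section Reconstruction

variable {d : ℕ}

/-- The standardised `j`-th coordinate with respect to location `μ` and scale `s`. -/
noncomputable def standardized (μ s : Fin d → ℝ) (x : EuclideanSpace ℝ (Fin d)) (j : Fin d) : ℝ :=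
  (x j - μ j) / s j

/-- First and second powers of the standardised coordinates. -/
noncomputable def momentStatistic (μ s : Fin d → ℝ) :
    Fin d ⊕ Fin d → EuclideanSpace ℝ (Fin d) → ℝ
  | Sum.inl j, x => standardized μ s x j
  | Sum.inr j, x => standardized μ s x j ^ 2

lemma measurable_standardized (μ s : Fin d → ℝ) : Measurable (standardized μ s) := by
  unfold standardized
  fun_prop

lemma measurable_momentStatistic (μ s : Fin d → ℝ) (j : Fin d ⊕ Fin d) :
    Measurable (momentStatistic μ s j) := by
  have h := fun j => (measurable_pi_apply j).comp (measurable_standardized μ s)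
  cases j with
  | inl j => exact h j
  | inr j => exact (h j).pow_const 2

lemma map_standardized_affineGaussian (μ : Fin d → ℝ) {s : Fin d → ℝ} (hs : ∀ j, 0 < s j) :
    (affineGaussian μ s : Measure (EuclideanSpace ℝ (Fin d))).map (standardized μ s) =
      stdNormal d := by
  change (Measure.map _ _).map _ = _
  rw [Measure.map_map (measurable_standardized μ s) (by fun_prop)]
  convert Measure.map_id
  ext z j
  have := (hs j).ne'
  simp only [Function.comp, standardized, id]
  field_simp
  ring

/-- The normalised means of the moment statistics under an intensity `ν`. -/
noncomputable def meanStatistic (μ s : Fin d → ℝ) (ν : Measure (EuclideanSpace ℝ (Fin d)))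
    (j : Fin d ⊕ Fin d) : ℝ :=
  (∫ x, momentStatistic μ s j x ∂ν) / ν.real Set.univ

/-- As `ν` keeps at least half of the weight `w`, its normalisation is at most twice the Gaussian,
and standardisation turns this into domination by twice the standard normal law. -/
lemma moments_of_le_affineGaussian {μ s : Fin d → ℝ} (hs : ∀ j, 0 < s j) {w : ℝ} (hw : 0 < w)
    {ν : Measure (EuclideanSpace ℝ (Fin d))}
    (hν : ν ≤ ENNReal.ofReal w • (affineGaussian μ s : Measure (EuclideanSpace ℝ (Fin d))))
    (hc : w / 2 ≤ ν.real Set.univ) :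
    (∀ j, MemLp (momentStatistic μ s j) 2 ν) ∧
    ∑ j, ∫ x, momentStatistic μ s j x ^ 2 ∂ν ≤
      ν.real Set.univ * (2 * d * (1 + normalFourthMoment)) ∧
    ∑ j, meanStatistic μ s ν (Sum.inl j) ^ 2 ≤ 2 ∧
    ∑ j, (meanStatistic μ s ν (Sum.inr j) - 1) ^ 2 ≤ 2 * normalFourthMoment ∧
    ∀ j, 1 / 512 ≤ meanStatistic μ s ν (Sum.inr j) - meanStatistic μ s ν (Sum.inl j) ^ 2 := by
  set c := ν.real Set.univ with hcd
  have hcpos : 0 < c := by linarith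
  have hfin' : IsFiniteMeasure
      (ENNReal.ofReal w • (affineGaussian μ s : Measure (EuclideanSpace ℝ (Fin d)))) :=
    Measure.smul_finite _ ENNReal.ofReal_ne_top
  have hfin : IsFiniteMeasure ν := isFiniteMeasure_of_le _ hν
  have hcE : ENNReal.ofReal c = ν Set.univ := ofReal_measureReal
  have hc0 : ν Set.univ ≠ 0 := by
    rw [← hcE]; exact (ENNReal.ofReal_pos.2 hcpos).ne'
  set h : Measure (EuclideanSpace ℝ (Fin d)) := (ν Set.univ)⁻¹ • ν with hh
  have hprob : IsProbabilityMeasure h := by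
    constructor
    rw [hh, Measure.smul_apply, smul_eq_mul, ENNReal.inv_mul_cancel hc0 (measure_ne_top _ _)]
  have hνh : ν = ν Set.univ • h := by
    rw [hh, smul_smul, ENNReal.mul_inv_cancel hc0 (measure_ne_top _ _), one_smul]
  have hle : h ≤ (2 : ENNReal) • (affineGaussian μ s : Measure (EuclideanSpace ℝ (Fin d))) := by
    refine Measure.le_iff.2 fun B _ => ?_
    rw [hh, Measure.smul_apply, Measure.smul_apply, smul_eq_mul, smul_eq_mul]
    calc (ν Set.univ)⁻¹ * ν B
        ≤ (ν Set.univ)⁻¹ * (ENNReal.ofReal w * (affineGaussian μ s : Measure _) B) := by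
          gcongr; exact hν B
      _ ≤ (ν Set.univ)⁻¹ * (2 * ν Set.univ * (affineGaussian μ s : Measure _) B) := by
          gcongr
          rw [← hcE, ← ENNReal.ofReal_ofNat 2, ← ENNReal.ofReal_mul (by norm_num)]
          exact ENNReal.ofReal_le_ofReal (by linarith)
      _ = (ν Set.univ)⁻¹ * ν Set.univ * (2 * (affineGaussian μ s : Measure _) B) := by ring
      _ = _ := by rw [ENNReal.inv_mul_cancel hc0 (measure_ne_top _ _), one_mul]
  have hzm := measurable_standardized μ s
  have hHp : IsProbabilityMeasure (h.map (standardized μ s)) :=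
    Measure.isProbabilityMeasure_map hzm.aemeasurable
  have hH : h.map (standardized μ s) ≤ (2 : ENNReal) • stdNormal d := by
    rw [← map_standardized_affineGaussian μ hs, ← Measure.map_smul]
    exact Measure.map_mono hle hzm
  obtain ⟨h1, h2, h3, h4, h5, h6⟩ := hasBoundedMoments_of_le _ hH
  have hint : ∀ j n, ∫ x, standardized μ s x j ^ n ∂ν =
      c * ∫ z, z j ^ n ∂(h.map (standardized μ s)) := by
    intro j n
    rw [integral_map hzm.aemeasurable (Measurable.aestronglyMeasurable (by fun_prop))]
    conv_lhs => rw [hνh]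
    rw [integral_smul_measure]; rfl
  have hmem : ∀ j n, MemLp (fun x => standardized μ s x j ^ n) 2 ν := by
    intro j n
    have := (h1 j n).comp_of_map hzm.aemeasurable
    rw [hνh]
    exact this.smul_measure (measure_ne_top _ _)
  have hml : ∀ j, meanStatistic μ s ν (Sum.inl j) = ∫ z, z j ∂(h.map (standardized μ s)) := by
    intro j
    have := hint j 1
    simp only [pow_one] at this
    simp only [meanStatistic, momentStatistic, this, ← hcd]
    field_simp
  have hmr : ∀ j, meanStatistic μ s ν (Sum.inr j) =
      ∫ z, z j ^ 2 ∂(h.map (standardized μ s)) := by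
    intro j
    simp only [meanStatistic, momentStatistic, hint j 2, ← hcd]
    field_simp
  refine ⟨fun j => ?_, ?_, ?_, ?_, fun j => ?_⟩
  · cases j with
    | inl j =>
      have := hmem j 1
      simp only [pow_one] at this
      exact this
    | inr j => exact hmem j 2
  · rw [Fintype.sum_sum_type]
    simp only [momentStatistic, ← pow_mul, hint]
    rw [← Finset.mul_sum, ← Finset.mul_sum, ← mul_add]
    refine mul_le_mul_of_nonneg_left ?_ hcpos.le
    have e1 : ∑ j, ∫ z, z j ^ 2 ∂(h.map (standardized μ s)) ≤ ∑ _j : Fin d, (2 : ℝ) :=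
      Finset.sum_le_sum fun j _ => h2 j
    have e2 : ∑ j, ∫ z, z j ^ (2 * 2) ∂(h.map (standardized μ s)) ≤
        ∑ _j : Fin d, 2 * normalFourthMoment := Finset.sum_le_sum fun j _ => h3 j
    simp only [Finset.sum_const, Finset.card_univ, Fintype.card_fin, nsmul_eq_mul] at e1 e2
    linarith
  · simpa only [hml] using h4
  · simpa only [hmr] using h5
  · rw [hml, hmr]; exact h6 j

variable {ι : Type*}

/-- Coordinatewise mean of the points with index in `S`. -/
noncomputable def subsampleMean (S : Finset ι) (y : ι → EuclideanSpace ℝ (Fin d)) (j : Fin d) : ℝ :=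
  (∑ l ∈ S, y l j) / S.card

/-- Coordinatewise standard deviation of the points with index in `S`. -/
noncomputable def subsampleDev (S : Finset ι) (y : ι → EuclideanSpace ℝ (Fin d)) (j : Fin d) : ℝ :=
  √((∑ l ∈ S, y l j ^ 2) / S.card - subsampleMean S y j ^ 2)

/-- The Gaussian fitted to a subsample, with corrections `α` of the location and `τ` of the
logarithmic scale. -/
noncomputable def fittedGaussian (S : Finset ι) (α τ : EuclideanSpace ℝ (Fin d))
    (y : ι → EuclideanSpace ℝ (Fin d)) : ProbabilityMeasure (EuclideanSpace ℝ (Fin d)) :=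
  affineGaussian (fun j => subsampleMean S y j + subsampleDev S y j * α j)
    (fun j => subsampleDev S y j * Real.exp (τ j))

/-- Bound of the squared deviation of the empirical variances from one. -/
noncomputable def devConst : ℝ := 3 * (26 + 2 * normalFourthMoment)

lemma one_le_devConst : 1 ≤ devConst := by
  have := one_le_normalFourthMoment
  unfold devConst; linarith

lemma abs_log_le_mul {v : ℝ} (hv : 1 / 1024 ≤ v) : |Real.log v| ≤ 1024 * |v - 1| := by
  have hv0 : 0 < v := by linarith
  rw [abs_le]
  constructor
  · have h1 := Real.one_sub_inv_le_log_of_pos hv0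
    have h2 : -(1024 * |v - 1|) ≤ 1 - v⁻¹ := by
      have h3 : 1 - v⁻¹ = (v - 1) / v := by field_simp
      rw [h3, le_div_iff₀ hv0]
      have := neg_abs_le (v - 1)
      nlinarith [abs_nonneg (v - 1)]
    linarith
  · have h1 := Real.log_le_sub_one_of_pos hv0
    have := le_abs_self (v - 1)
    have := abs_nonneg (v - 1)
    linarith

/-- If the averages of the moment statistics over a subsample are close to their means, then
suitable corrections of bounded size turn the fitted Gaussian into the true one. -/
lemma exists_correction {μ s : Fin d → ℝ} (hs : ∀ j, 0 < s j) {a : Fin d ⊕ Fin d → ℝ}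
    (h1 : ∑ j, a (Sum.inl j) ^ 2 ≤ 2)
    (h2 : ∑ j, (a (Sum.inr j) - 1) ^ 2 ≤ 2 * normalFourthMoment)
    (h3 : ∀ j, 1 / 512 ≤ a (Sum.inr j) - a (Sum.inl j) ^ 2)
    {y : ι → EuclideanSpace ℝ (Fin d)} {S : Finset ι}
    (hS : AveragesClose (momentStatistic μ s) a (1 / 8192) y S) :
    ∃ α τ : EuclideanSpace ℝ (Fin d), ‖α‖ ≤ 1024 * devConst ∧ ‖τ‖ ≤ 1024 * devConst ∧
      ∀ α' τ' : EuclideanSpace ℝ (Fin d), ∀ ξ : ℝ, 0 < ξ → ‖α - α'‖ ≤ ξ → ‖τ - τ'‖ ≤ ξ →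
        tvDist (affineGaussian μ s) (fittedGaussian S α' τ' y) ≤
          3 / 2 * ((2 + devConst) * ξ) := by
  obtain ⟨hne, hsum⟩ := hS
  have hcard : (0 : ℝ) < S.card := by exact_mod_cast Finset.card_pos.2 hne
  set p : Fin d → ℝ := fun j => (∑ l ∈ S, standardized μ s (y l) j) / S.card with hp
  set q : Fin d → ℝ := fun j => (∑ l ∈ S, standardized μ s (y l) j ^ 2) / S.card with hq
  have hsum' : ∑ j, (p j - a (Sum.inl j)) ^ 2 + ∑ j, (q j - a (Sum.inr j)) ^ 2 ≤
      (1 / 8192) ^ 2 := by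
    rw [Fintype.sum_sum_type] at hsum
    exact hsum
  have hP0 : 0 ≤ ∑ j, (p j - a (Sum.inl j)) ^ 2 := Finset.sum_nonneg fun j _ => sq_nonneg _
  have hQ0 : 0 ≤ ∑ j, (q j - a (Sum.inr j)) ^ 2 := Finset.sum_nonneg fun j _ => sq_nonneg _
  have hpj : ∀ j, |p j - a (Sum.inl j)| ≤ 1 / 8192 := by
    intro j
    refine abs_le_of_sq_le_sq ?_ (by norm_num)
    have := Finset.single_le_sum (f := fun j => (p j - a (Sum.inl j)) ^ 2)
      (fun j _ => sq_nonneg _) (Finset.mem_univ j)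
    linarith
  have hqj : ∀ j, |q j - a (Sum.inr j)| ≤ 1 / 8192 := by
    intro j
    refine abs_le_of_sq_le_sq ?_ (by norm_num)
    have := Finset.single_le_sum (f := fun j => (q j - a (Sum.inr j)) ^ 2)
      (fun j _ => sq_nonneg _) (Finset.mem_univ j)
    linarith
  have haj : ∀ j, |a (Sum.inl j)| ≤ 3 / 2 := by
    intro j
    refine abs_le_of_sq_le_sq ?_ (by norm_num)
    have := Finset.single_le_sum (f := fun j => a (Sum.inl j) ^ 2)
      (fun j _ => sq_nonneg _) (Finset.mem_univ j)
    linarith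
  -- Empirical variance in standardised coordinates.
  set v : Fin d → ℝ := fun j => q j - p j ^ 2 with hv
  -- Passing from the means `a` to the averages `p`, `q` costs a little more than `4 / 8192`, which
  -- leaves at least `1 / 1024` of the lower bound `1 / 512`.
  have hvj : ∀ j, 1 / 1024 ≤ v j := by
    intro j
    have e1 := abs_le.1 (hpj j)
    have e2 := abs_le.1 (hqj j)
    have e3 := abs_le.1 (haj j)
    have e4 := h3 j
    have e5 : p j ^ 2 - a (Sum.inl j) ^ 2 ≤ 1 / 8192 * (1 / 8192 + 3) := by
      have : p j ^ 2 - a (Sum.inl j) ^ 2 =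
        (p j - a (Sum.inl j)) * (p j - a (Sum.inl j) + 2 * a (Sum.inl j)) := by ring
      rw [this]
      refine (le_abs_self _).trans ?_
      rw [abs_mul]
      refine mul_le_mul (hpj j) ?_ (abs_nonneg _) (by norm_num)
      rw [abs_le]; constructor <;> linarith
    simp only [hv]
    linarith
  have hv0 : ∀ j, 0 < v j := fun j => by have := hvj j; linarith
  have hp2 : ∑ j, p j ^ 2 ≤ 5 := by
    have : ∑ j, p j ^ 2 ≤ ∑ j, (2 * (p j - a (Sum.inl j)) ^ 2 + 2 * a (Sum.inl j) ^ 2) :=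
      Finset.sum_le_sum fun j _ => by nlinarith [sq_nonneg (p j - 2 * a (Sum.inl j))]
    rw [Finset.sum_add_distrib, ← Finset.mul_sum, ← Finset.mul_sum] at this
    linarith
  have hp20 : 0 ≤ ∑ j, p j ^ 2 := Finset.sum_nonneg fun j _ => sq_nonneg _
  have hp4 : ∑ j, (p j ^ 2) ^ 2 ≤ 25 := by
    calc ∑ j, (p j ^ 2) ^ 2 ≤ (∑ j, p j ^ 2) ^ 2 :=
          Finset.sum_sq_le_sq_sum_of_nonneg fun j _ => sq_nonneg _
      _ ≤ 5 ^ 2 := by gcongr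
      _ = 25 := by norm_num
  have hv1 : ∑ j, (v j - 1) ^ 2 ≤ devConst := by
    have : ∑ j, (v j - 1) ^ 2 ≤ ∑ j, (3 * (q j - a (Sum.inr j)) ^ 2 +
        3 * (a (Sum.inr j) - 1) ^ 2 + 3 * (p j ^ 2) ^ 2) := by
      refine Finset.sum_le_sum fun j _ => ?_
      simp only [hv]
      nlinarith [sq_nonneg ((q j - a (Sum.inr j)) - (a (Sum.inr j) - 1)),
        sq_nonneg ((q j - a (Sum.inr j)) + p j ^ 2), sq_nonneg ((a (Sum.inr j) - 1) + p j ^ 2)]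
    rw [Finset.sum_add_distrib, Finset.sum_add_distrib, ← Finset.mul_sum, ← Finset.mul_sum,
      ← Finset.mul_sum] at this
    unfold devConst
    linarith
  have hD1 := one_le_devConst
  have hvle : ∀ j, v j ≤ 1 + devConst := by
    intro j
    have := Finset.single_le_sum (f := fun j => (v j - 1) ^ 2)
      (fun j _ => sq_nonneg _) (Finset.mem_univ j)
    nlinarith
  have hmean : ∀ j, subsampleMean S y j = μ j + s j * p j := by
    intro j
    have := (hs j).ne'
    simp only [subsampleMean, hp, standardized]
    rw [← Finset.sum_div, Finset.sum_sub_distrib, Finset.sum_const, nsmul_eq_mul]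
    field_simp
    ring
  have hdev : ∀ j, subsampleDev S y j = s j * √(v j) := by
    intro j
    have hsj := (hs j).ne'
    have : (∑ l ∈ S, y l j ^ 2) / S.card - subsampleMean S y j ^ 2 = s j ^ 2 * v j := by
      have e : ∀ l, y l j ^ 2 = s j ^ 2 * standardized μ s (y l) j ^ 2 +
          2 * μ j * s j * standardized μ s (y l) j + μ j ^ 2 := by
        intro l
        simp only [standardized]
        field_simp
        ring
      have e2 : (∑ l ∈ S, y l j ^ 2) / S.card =
          s j ^ 2 * q j + 2 * μ j * s j * p j + μ j ^ 2 := by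
        simp_rw [e]
        rw [Finset.sum_add_distrib, Finset.sum_add_distrib, ← Finset.mul_sum, ← Finset.mul_sum,
          Finset.sum_const, nsmul_eq_mul]
        simp only [hp, hq]
        field_simp
      rw [e2, hmean]
      simp only [hv]
      ring
    rw [subsampleDev, this, Real.sqrt_mul (by positivity), Real.sqrt_sq (hs j).le]
  have hsv : ∀ j, 0 < √(v j) := fun j => Real.sqrt_pos.2 (hv0 j)
  -- The subsample has mean `μ + s * p` and deviation `s * √v`; these corrections undo both exactly.
  -- Their norms are bounded because `v` stays away from zero while `p` and `v - 1` are bounded in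
  -- Euclidean norm.
  refine ⟨WithLp.toLp 2 fun j => -p j / √(v j), WithLp.toLp 2 fun j => -(Real.log (v j) / 2),
    ?_, ?_, fun α' τ' ξ hξ hα hτ => ?_⟩
  · refine le_of_sq_le_sq ?_ (by positivity)
    rw [EuclideanSpace.real_norm_sq_eq]
    simp only [div_pow, neg_sq, Real.sq_sqrt (hv0 _).le]
    calc ∑ j, p j ^ 2 / v j ≤ ∑ j, 1024 * p j ^ 2 := by
          refine Finset.sum_le_sum fun j _ => ?_
          rw [div_le_iff₀ (hv0 j)]
          nlinarith [hvj j, sq_nonneg (p j)]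
      _ ≤ 1024 * 5 := by rw [← Finset.mul_sum]; gcongr
      _ ≤ (1024 * devConst) ^ 2 := by nlinarith
  · refine le_of_sq_le_sq ?_ (by positivity)
    rw [EuclideanSpace.real_norm_sq_eq]
    calc ∑ j, (-(Real.log (v j) / 2)) ^ 2 ≤ ∑ j, 1024 ^ 2 * (v j - 1) ^ 2 := by
          refine Finset.sum_le_sum fun j _ => ?_
          have := sq_le_sq' (by linarith [abs_nonneg (Real.log (v j)), abs_nonneg (v j - 1)])
            (abs_log_le_mul (hvj j))
          rw [mul_pow, sq_abs, sq_abs] at this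
          nlinarith [sq_nonneg (Real.log (v j))]
      _ ≤ 1024 ^ 2 * devConst := by rw [← Finset.mul_sum]; gcongr
      _ ≤ (1024 * devConst) ^ 2 := by nlinarith
  · have hα2 : ∑ j, (-p j / √(v j) - α' j) ^ 2 ≤ ξ ^ 2 := by
      have := pow_le_pow_left₀ (norm_nonneg _) hα 2
      rw [EuclideanSpace.real_norm_sq_eq] at this
      simpa using this
    have hτ2 : ∑ j, (-(Real.log (v j) / 2) - τ' j) ^ 2 ≤ ξ ^ 2 := by
      have := pow_le_pow_left₀ (norm_nonneg _) hτ 2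
      rw [EuclideanSpace.real_norm_sq_eq] at this
      simpa using this
    have hscale : ∀ j, subsampleDev S y j * Real.exp (τ' j) =
        Real.exp (Real.log (s j) + Real.log (v j) / 2 + τ' j) := by
      intro j
      rw [hdev, Real.exp_add, Real.exp_add, Real.exp_log (hs j)]
      congr 2
      rw [← Real.log_sqrt (hv0 j).le, Real.exp_log (hsv j)]
    have hs' : s = fun j => Real.exp (Real.log (s j)) := by
      ext j; rw [Real.exp_log (hs j)]
    have hfit : fittedGaussian S α' τ' y = affineGaussian
        (fun j => subsampleMean S y j + subsampleDev S y j * α' j)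
        (fun j => Real.exp (Real.log (s j) + Real.log (v j) / 2 + τ' j)) := by
      unfold fittedGaussian
      congr 1
      ext j
      exact hscale j
    rw [hfit]
    rw [show affineGaussian μ s = affineGaussian μ fun j => Real.exp (Real.log (s j)) from
      congrArg _ hs']
    refine tvDist_affineGaussian_le _ _ _ _ (by positivity) ?_
    calc _ ≤ ∑ j, ((-(Real.log (v j) / 2) - τ' j) ^ 2 / 4 +
          (1 + devConst) / 4 * (-p j / √(v j) - α' j) ^ 2) := by
          refine Finset.sum_le_sum fun j _ => ?_
          rw [hmean, hdev, Real.exp_log (hs j)]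
          refine add_le_add (le_of_eq (by ring)) ?_
          have e : μ j - (μ j + s j * p j + s j * √(v j) * α' j) =
              s j * √(v j) * (-p j / √(v j) - α' j) := by
            have := (hsv j).ne'
            field_simp
            ring
          rw [e, mul_pow, mul_pow, Real.sq_sqrt (hv0 j).le]
          have hsj := hs j
          have : s j ^ 2 * v j * (-p j / √(v j) - α' j) ^ 2 / (4 * s j ^ 2) =
              v j / 4 * (-p j / √(v j) - α' j) ^ 2 := by field_simp
          rw [this]
          gcongr
          exact hvle j
      _ ≤ ξ ^ 2 / 4 + (1 + devConst) / 4 * ξ ^ 2 := by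
          rw [Finset.sum_add_distrib, ← Finset.sum_div, ← Finset.mul_sum]
          gcongr
      _ ≤ ((2 + devConst) * ξ) ^ 2 := by nlinarith [sq_nonneg ξ]

end Reconstruction

/-! ### Mixtures and a net for their weights. -/

section Mixtures

variable {X : Type*} [MeasurableSpace X] {k : ℕ}

/-- The mixture with weights `w` of the distributions `f i`. -/
noncomputable def mixture (w : stdSimplex ℝ (Fin k)) (f : Fin k → ProbabilityMeasure X) :
    ProbabilityMeasure X :=
  ⟨∑ i, ENNReal.ofReal (w.1 i) • (f i : Measure X), by
    constructor
    rw [Measure.finsetSum_apply]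
    simp only [Measure.smul_apply, measure_univ, smul_eq_mul, mul_one]
    rw [← ENNReal.ofReal_sum_of_nonneg fun i _ => w.2.1 i, w.2.2, ENNReal.ofReal_one]⟩

lemma mixture_mem_kMixtures {F : Set (ProbabilityMeasure X)} (w : stdSimplex ℝ (Fin k))
    {f : Fin k → ProbabilityMeasure X} (hf : ∀ i, f i ∈ F) : mixture w f ∈ kMixtures F k :=
  ⟨w.1, w.2, f, hf, rfl⟩

lemma exists_eq_mixture {F : Set (ProbabilityMeasure X)} {g : ProbabilityMeasure X}
    (hg : g ∈ kMixtures F k) : ∃ (w : stdSimplex ℝ (Fin k)) (f : Fin k → ProbabilityMeasure X),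
      (∀ i, f i ∈ F) ∧ g = mixture w f := by
  obtain ⟨w, hw, f, hf, h⟩ := hg
  exact ⟨⟨w, hw⟩, f, hf, Subtype.ext h⟩

lemma mixture_real_apply (w : stdSimplex ℝ (Fin k)) (f : Fin k → ProbabilityMeasure X)
    (B : Set X) :
    (mixture w f : Measure X).real B = ∑ i, w.1 i * (f i : Measure X).real B := by
  change (∑ i, ENNReal.ofReal (w.1 i) • (f i : Measure X)).real B = _
  rw [Measure.real, Measure.finsetSum_apply, ENNReal.toReal_sum fun i _ => by
    rw [Measure.smul_apply, smul_eq_mul]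
    exact ENNReal.mul_ne_top ENNReal.ofReal_ne_top (measure_ne_top _ _)]
  refine Finset.sum_congr rfl fun i _ => ?_
  rw [Measure.smul_apply, smul_eq_mul, ENNReal.toReal_mul, ENNReal.toReal_ofReal (w.2.1 i)]
  rfl

lemma tvDist_mixture_le (w w' : stdSimplex ℝ (Fin k)) (f f' : Fin k → ProbabilityMeasure X) :
    tvDist (mixture w f) (mixture w' f') ≤
      ∑ i, w.1 i * tvDist (f i) (f' i) + ∑ i, |w.1 i - w'.1 i| := by
  refine tvDist_le_of_sub_le fun B hB => ?_
  rw [mixture_real_apply, mixture_real_apply, ← Finset.sum_sub_distrib, ← Finset.sum_add_distrib]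
  refine Finset.sum_le_sum fun i _ => ?_
  have h1 := measureReal_sub_le_tvDist (f i) (f' i) hB
  have h2 : w.1 i * ((f i : Measure X).real B - (f' i : Measure X).real B) ≤
      w.1 i * tvDist (f i) (f' i) := mul_le_mul_of_nonneg_left h1 (w.2.1 i)
  have h3 : (w.1 i - w'.1 i) * (f' i : Measure X).real B ≤ |w.1 i - w'.1 i| := by
    calc _ ≤ |w.1 i - w'.1 i| * (f' i : Measure X).real B :=
          mul_le_mul_of_nonneg_right (le_abs_self _) measureReal_nonneg
      _ ≤ _ := mul_le_of_le_one_right (abs_nonneg _) measureReal_le_one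
  linarith

/-- A finite net of the simplex. -/
lemma exists_net_stdSimplex (hk : 0 < k) {Q : ℕ} (hQ : 0 < Q) :
    ∃ W : Finset (stdSimplex ℝ (Fin k)), W.Nonempty ∧ W.card ≤ (Q + 1) ^ k ∧
      ∀ w : stdSimplex ℝ (Fin k), ∃ w' ∈ W, ∑ i, |w.1 i - w'.1 i| ≤ 2 * k / Q := by
  classical
  have hQ' : (0 : ℝ) < Q := by exact_mod_cast hQ
  have hne : Nonempty (stdSimplex ℝ (Fin k)) :=
    ⟨⟨Pi.single ⟨0, hk⟩ 1, single_mem_stdSimplex _ _⟩⟩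
  -- Net points are normalised integer vectors. Given `w`, the entries `Q * w i` are rounded up, so
  -- their sum `C` lies between `Q` and `Q + k`, and the total error is at most `2 * (C / Q - 1)`.
  let nrm : (Fin k → Fin (Q + 1)) → stdSimplex ℝ (Fin k) := fun c =>
    if h : 0 < ∑ i, ((c i : ℕ) : ℝ) then ⟨fun i => ((c i : ℕ) : ℝ) / ∑ i, ((c i : ℕ) : ℝ),
      fun i => div_nonneg (Nat.cast_nonneg _) h.le, by
        rw [← Finset.sum_div, div_self h.ne']⟩ else Classical.arbitrary _
  have hne' : Nonempty (Fin k → Fin (Q + 1)) := inferInstance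
  refine ⟨Finset.univ.image nrm, Finset.univ_nonempty.image _, ?_, fun w => ?_⟩
  · refine Finset.card_image_le.trans (le_of_eq ?_)
    simp
  · have hw1 : ∀ i, w.1 i ≤ 1 := fun i => by
      rw [← w.2.2]
      exact Finset.single_le_sum (f := w.1) (fun i _ => w.2.1 i) (Finset.mem_univ i)
    have hceil : ∀ i, ⌈Q * w.1 i⌉₊ < Q + 1 := fun i => by
      refine Nat.lt_succ_of_le (Nat.ceil_le.2 ?_)
      exact mul_le_of_le_one_right hQ'.le (hw1 i)
    set c : Fin k → Fin (Q + 1) := fun i => ⟨⌈Q * w.1 i⌉₊, hceil i⟩ with hc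
    set C : ℝ := ∑ i, ((c i : ℕ) : ℝ) with hC
    have hlo : ∀ i, Q * w.1 i ≤ ((c i : ℕ) : ℝ) := fun i => Nat.le_ceil _
    have hhi : ∀ i, ((c i : ℕ) : ℝ) ≤ Q * w.1 i + 1 := fun i =>
      (Nat.ceil_lt_add_one (mul_nonneg hQ'.le (w.2.1 i))).le
    have hClo : Q ≤ C := by
      have : ∑ i, Q * w.1 i ≤ C := Finset.sum_le_sum fun i _ => hlo i
      rwa [← Finset.mul_sum, w.2.2, mul_one] at this
    have hChi : C ≤ Q + k := by
      have : C ≤ ∑ i, (Q * w.1 i + 1) := Finset.sum_le_sum fun i _ => hhi i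
      rw [Finset.sum_add_distrib, ← Finset.mul_sum, w.2.2] at this
      simpa using this
    have hCpos : 0 < C := hQ'.trans_le hClo
    refine ⟨nrm c, Finset.mem_image_of_mem _ (Finset.mem_univ _), ?_⟩
    have e : ∀ i, (nrm c).1 i = ((c i : ℕ) : ℝ) / C := fun i => by
      simp only [nrm]
      rw [dif_pos hCpos]
    calc ∑ i, |w.1 i - (nrm c).1 i| ≤
        ∑ i, ((((c i : ℕ) : ℝ) / Q - w.1 i) + (((c i : ℕ) : ℝ) / Q - ((c i : ℕ) : ℝ) / C)) := by
          refine Finset.sum_le_sum fun i _ => ?_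
          rw [e]
          have h1 : w.1 i ≤ ((c i : ℕ) : ℝ) / Q := by
            rw [le_div_iff₀ hQ', mul_comm]; exact hlo i
          have h2 : ((c i : ℕ) : ℝ) / C ≤ ((c i : ℕ) : ℝ) / Q :=
            div_le_div_of_nonneg_left (Nat.cast_nonneg _) hQ' hClo
          rw [abs_le]; constructor <;> linarith
      _ = 2 * (C / Q - 1) := by
          rw [Finset.sum_add_distrib, Finset.sum_sub_distrib, Finset.sum_sub_distrib,
            ← Finset.sum_div, ← Finset.sum_div, w.2.2, ← hC, div_self hCpos.ne']
          ring
      _ ≤ 2 * k / Q := by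
          rw [mul_div_assoc]
          refine mul_le_mul_of_nonneg_left ?_ zero_le_two
          rw [sub_le_iff_le_add, div_le_iff₀ hQ', add_mul, div_mul_cancel₀ _ hQ'.ne']
          linarith

end Mixtures

/-! ### Measurable dependence of the candidates on the data. -/

section Candidates

variable {Ω : Type*} [MeasurableSpace Ω] {d k : ℕ}

/-- Makes the candidates Markov kernels in the data, as the selection theorem requires. -/
lemma measurable_affineGaussian {m s : Ω → Fin d → ℝ} (hm : Measurable m) (hs : Measurable s) :
    Measurable fun ω => (affineGaussian (m ω) (s ω) : Measure (EuclideanSpace ℝ (Fin d))) := by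
  refine Measure.measurable_of_measurable_coe _ fun B hB => ?_
  have hF : Measurable fun p : Ω × (Fin d → ℝ) =>
      (WithLp.toLp 2 fun j => m p.1 j + s p.1 j * p.2 j : EuclideanSpace ℝ (Fin d)) := by
    fun_prop
  have h := measurable_measure_prodMk_left (ν := stdNormal d) (hF hB)
  convert h using 2 with ω
  exact Measure.map_apply (by fun_prop) hB

lemma measurable_fittedGaussian {ι : Type*} (S : Finset ι) (α τ : EuclideanSpace ℝ (Fin d)) :
    Measurable fun y : ι → EuclideanSpace ℝ (Fin d) =>
      (fittedGaussian S α τ y : Measure (EuclideanSpace ℝ (Fin d))) := by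
  have h1 : ∀ j, Measurable fun y : ι → EuclideanSpace ℝ (Fin d) => subsampleMean S y j := by
    intro j; unfold subsampleMean; fun_prop
  have h2 : ∀ j, Measurable fun y : ι → EuclideanSpace ℝ (Fin d) => subsampleDev S y j := by
    intro j; unfold subsampleDev
    exact ((Measurable.div_const (by fun_prop) _).sub ((h1 j).pow_const 2)).sqrt
  exact measurable_affineGaussian
    (measurable_pi_lambda _ fun j => (h1 j).add ((h2 j).mul_const _))
    (measurable_pi_lambda _ fun j => (h2 j).mul_const _)

/-- A mixture of measurable families as a Markov kernel. -/
noncomputable def mixtureKernel {X : Type*} [MeasurableSpace X] (w : stdSimplex ℝ (Fin k))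
    (f : Fin k → Ω → ProbabilityMeasure X)
    (hf : ∀ i, Measurable fun ω => (f i ω : Measure X)) : Kernel Ω X where
  toFun ω := mixture w fun i => f i ω
  measurable' := by
    refine Measure.measurable_of_measurable_coe _ fun B hB => ?_
    change Measurable fun ω => (∑ i, ENNReal.ofReal (w.1 i) • (f i ω : Measure X)) B
    simp only [Measure.finsetSum_apply, Measure.smul_apply, smul_eq_mul]
    exact Finset.measurable_sum _ fun i _ =>
      ((Measure.measurable_coe hB).comp (hf i)).const_mul _

instance {X : Type*} [MeasurableSpace X] (w : stdSimplex ℝ (Fin k))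
    (f : Fin k → Ω → ProbabilityMeasure X)
    (hf : ∀ i, Measurable fun ω => (f i ω : Measure X)) :
    IsMarkovKernel (mixtureKernel w f hf) :=
  ⟨fun ω => (mixture w fun i => f i ω).2⟩

end Candidates

/-! ### Splitting a sample into independent parts. -/

section Splitting

variable {X : Type*} [MeasurableSpace X]

/-- Splits a sample into `B` blocks of size `n` and a remainder of size `r`. -/
def splitSample (B n r : ℕ) (S : Fin (B * n + r) → X) : (Fin B → Fin n → X) × (Fin r → X) :=
  (fun b l => S (Fin.castAdd r (finProdFinEquiv (b, l))), fun i => S (Fin.natAdd (B * n) i))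

/-- The law of the whole sample is identified on boxes as the image of the product law under `join`,
which `splitSample` inverts. -/
lemma measurePreserving_splitSample (g : Measure X) [IsProbabilityMeasure g] (B n r : ℕ) :
    MeasurePreserving (splitSample (X := X) B n r) (Measure.pi fun _ => g)
      ((Measure.pi fun _ : Fin B => Measure.pi fun _ : Fin n => g).prod
        (Measure.pi fun _ : Fin r => g)) := by
  have hm : Measurable (splitSample (X := X) B n r) := by
    unfold splitSample
    fun_prop
  let join : (Fin B → Fin n → X) × (Fin r → X) → Fin (B * n + r) → X := fun p =>
    Fin.addCases (fun i => p.1 (finProdFinEquiv.symm i).1 (finProdFinEquiv.symm i).2) p.2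
  have hjl : ∀ p (i : Fin (B * n)), join p (Fin.castAdd r i) =
      p.1 (finProdFinEquiv.symm i).1 (finProdFinEquiv.symm i).2 := fun p i => by
    simp only [join, Fin.addCases_left]
  have hjr : ∀ p (i : Fin r), join p (Fin.natAdd (B * n) i) = p.2 i := fun p i => by
    simp only [join, Fin.addCases_right]
  have hjm : Measurable join := by
    refine measurable_pi_lambda _ fun i => ?_
    refine Fin.addCases (fun i => ?_) (fun i => ?_) i
    · simp only [hjl]; fun_prop
    · simp only [hjr]; fun_prop
  have hinv : ∀ p, splitSample B n r (join p) = p := by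
    intro p
    refine Prod.ext ?_ ?_
    · ext b l
      change join p (Fin.castAdd r (finProdFinEquiv (b, l))) = _
      rw [hjl, Equiv.symm_apply_apply]
    · ext i
      exact hjr p i
  have hpi : (Measure.pi fun _ : Fin (B * n + r) => g) =
      (((Measure.pi fun _ : Fin B => Measure.pi fun _ : Fin n => g).prod
        (Measure.pi fun _ : Fin r => g))).map join := by
    refine Measure.pi_eq fun s hs => ?_
    rw [Measure.map_apply hjm (MeasurableSet.univ_pi hs)]
    have : join ⁻¹' Set.univ.pi s =
        (Set.univ.pi fun b : Fin B => Set.univ.pi fun l : Fin n =>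
          s (Fin.castAdd r (finProdFinEquiv (b, l)))) ×ˢ
        (Set.univ.pi fun i : Fin r => s (Fin.natAdd (B * n) i)) := by
      ext p
      simp only [Set.mem_preimage, Set.mem_pi, Set.mem_univ, true_implies, Set.mem_prod]
      constructor
      · intro h
        refine ⟨fun b l => ?_, fun i => ?_⟩
        · have := h (Fin.castAdd r (finProdFinEquiv (b, l)))
          rwa [hjl, Equiv.symm_apply_apply] at this
        · have := h (Fin.natAdd (B * n) i)
          rwa [hjr] at this
      · rintro ⟨h1, h2⟩ i
        refine Fin.addCases (fun i => ?_) (fun i => ?_) i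
        · rw [hjl]
          have := h1 (finProdFinEquiv.symm i).1 (finProdFinEquiv.symm i).2
          rwa [Prod.mk.eta, Equiv.apply_symm_apply] at this
        · rw [hjr]; exact h2 i
    rw [this, Measure.prod_prod, Measure.pi_pi, Measure.pi_pi, Fin.prod_univ_add]
    congr 1
    rw [← finProdFinEquiv.prod_comp, Fintype.prod_prod_type]
    exact Finset.prod_congr rfl fun b _ => Measure.pi_pi _ _
  refine ⟨hm, ?_⟩
  rw [hpi, Measure.map_map hm hjm]
  convert Measure.map_id
  ext1 p
  exact hinv p

end Splitting

/-! ### The learner for given sizes. -/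

section UpperBound

variable {d k : ℕ}

/-- The error of the best candidate in terms of the resolution of the nets. -/
noncomputable def candidateError (k : ℕ) (ξ κ : ℝ) (Q : ℕ) : ℝ :=
  3 / 2 * ((2 + devConst) * ξ) + κ + 2 * k / Q

/-- Components of small weight or with a large part outside of `g` have small total weight, the
others can be reconstructed from a labelled sample. -/
lemma tvDist_mixture_le_of_reconstruction {X : Type*} [MeasurableSpace X] (hk : 0 < k)
    (w w' : stdSimplex ℝ (Fin k)) (f f' : Fin k → ProbabilityMeasure X)
    (g : ProbabilityMeasure X) (c : Fin k → ℝ) (hc : ∀ i, c i ≤ w.1 i)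
    (hcsum : 1 - tvDist (mixture w f) g ≤ ∑ i, c i) {e κ e' : ℝ} (he : 0 ≤ e) (hκ : 0 ≤ κ)
    (hgood : ∀ i, κ / k ≤ w.1 i → w.1 i / 2 ≤ c i → tvDist (f i) (f' i) ≤ e)
    (hw : ∑ i, |w.1 i - w'.1 i| ≤ e') :
    tvDist (mixture w' f') g ≤ 3 * tvDist (mixture w f) g + (e + κ + e') := by
  have hk' : (0 : ℝ) < k := by exact_mod_cast hk
  have h1 := tvDist_mixture_le w w' f f'
  have h2 := tvDist_triangle (mixture w' f') (mixture w f) g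
  rw [tvDist_comm (mixture w' f') (mixture w f)] at h2
  -- Each component falls under one summand: it is reconstructed up to `e`, or has weight below `κ /
  -- k`, or satisfies `w i < 2 * (w i - c i)`.
  have h3 : ∑ i, w.1 i * tvDist (f i) (f' i) ≤ ∑ i, (w.1 i * e + κ / k + 2 * (w.1 i - c i)) := by
    refine Finset.sum_le_sum fun i _ => ?_
    have hwi := w.2.1 i
    have hd0 := tvDist_nonneg (f i) (f' i)
    have hd1 := tvDist_le_one (f i) (f' i)
    have hci := hc i
    have hκk : 0 ≤ κ / k := by positivity
    have hwe : 0 ≤ w.1 i * e := mul_nonneg hwi he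
    by_cases ha : κ / k ≤ w.1 i
    · by_cases hb : w.1 i / 2 ≤ c i
      · have := mul_le_mul_of_nonneg_left (hgood i ha hb) hwi
        linarith
      · have := mul_le_of_le_one_right hwi hd1
        push Not at hb
        linarith
    · have := mul_le_of_le_one_right hwi hd1
      push Not at ha
      linarith
  have h4 : ∑ i, (w.1 i * e + κ / k + 2 * (w.1 i - c i)) = e + κ + 2 * (1 - ∑ i, c i) := by
    rw [Finset.sum_add_distrib, Finset.sum_add_distrib, ← Finset.sum_mul, w.2.2,
      ← Finset.mul_sum, Finset.sum_sub_distrib, w.2.2, Finset.sum_const, Finset.card_univ,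
      Fintype.card_fin, nsmul_eq_mul, mul_div_cancel₀ _ hk'.ne']
    ring
  linarith

open Classical in
/-- With high probability some labelling of the sample allows to reconstruct all relevant
components of a mixture close to the sampled distribution. -/
lemma measure_not_exists_reconstruction_le (hd : 0 < d) (hk : 0 < k)
    (w : stdSimplex ℝ (Fin k)) {μ s : Fin k → Fin d → ℝ} (hs : ∀ i j, 0 < s i j)
    (g : ProbabilityMeasure (EuclideanSpace ℝ (Fin d))) {κ : ℝ} (hκ : 0 < κ) (B n : ℕ)
    (hn : 32 * (2 * d * (1 + normalFourthMoment)) * k * 8192 ^ 2 ≤ n * κ) :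
    ∃ c : Fin k → ℝ, (∀ i, c i ≤ w.1 i) ∧
      1 - tvDist (mixture w fun i => affineGaussian (μ i) (s i)) g ≤ ∑ i, c i ∧
      (Measure.pi fun _ : Fin B => Measure.pi fun _ : Fin n =>
        (g : Measure (EuclideanSpace ℝ (Fin d))))
        {x | ¬ ∃ L : Fin B × Fin n → Option (Fin k), ∀ i, κ / k ≤ w.1 i → w.1 i / 2 ≤ c i →
          ∃ α τ : EuclideanSpace ℝ (Fin d), ‖α‖ ≤ 1024 * devConst ∧ ‖τ‖ ≤ 1024 * devConst ∧
          ∀ α' τ' : EuclideanSpace ℝ (Fin d), ∀ ξ : ℝ, 0 < ξ → ‖α - α'‖ ≤ ξ → ‖τ - τ'‖ ≤ ξ →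
            tvDist (affineGaussian (μ i) (s i))
              (fittedGaussian (Finset.univ.filter fun p => L p = some i) α' τ'
                (fun p => x p.1 p.2)) ≤ 3 / 2 * ((2 + devConst) * ξ)}
        ≤ k * (2⁻¹ : ENNReal) ^ B := by
  have hk' : (0 : ℝ) < k := by exact_mod_cast hk
  obtain ⟨ν, hν1, hν2, hν3⟩ := exists_submeasures_of_mixture (w := w.1)
    (fun i => affineGaussian (μ i) (s i)) (mixture w fun i => affineGaussian (μ i) (s i)) g rfl
  have hfin : ∀ i, IsFiniteMeasure (ν i) := fun i => by
    have : IsFiniteMeasure (ENNReal.ofReal (w.1 i) •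
      (affineGaussian (μ i) (s i) : Measure (EuclideanSpace ℝ (Fin d)))) :=
        Measure.smul_finite _ ENNReal.ofReal_ne_top
    exact isFiniteMeasure_of_le _ (hν1 i)
  refine ⟨fun i => (ν i).real Set.univ, fun i => ?_, ?_, ?_⟩
  · refine ENNReal.toReal_le_of_le_ofReal (w.2.1 i) ?_
    have := hν1 i Set.univ
    simpa using this
  · refine hν3.trans (le_of_eq ?_)
    rw [Measure.real, Measure.finsetSum_apply, ENNReal.toReal_sum fun i _ => measure_ne_top _ _]
    rfl
  · let _ : MeasurableSpace (Option (Fin k)) := ⊤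
    have _ : MeasurableSingletonClass (Option (Fin k)) := ⟨fun _ => trivial⟩
    -- The label `none` carries the rest of `g`, outside of the common part.
    let ν' : Option (Fin k) → Measure (EuclideanSpace ℝ (Fin d)) := fun o =>
      o.elim ((g : Measure _) - ∑ i, ν i) ν
    have hν' : ∑ o, ν' o = g := by
      rw [Fintype.sum_option]
      exact Measure.sub_add_cancel_of_le hν2
    let φ : Option (Fin k) → Fin d ⊕ Fin d → EuclideanSpace ℝ (Fin d) → ℝ := fun o =>
      o.elim (fun _ _ => 0) fun i => momentStatistic (μ i) (s i)
    set I : Finset (Option (Fin k)) := (Finset.univ.filter fun i : Fin k =>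
      κ / k ≤ w.1 i ∧ w.1 i / 2 ≤ (ν i).real Set.univ).image some with hI
    have hIcard : I.card ≤ k := by
      refine Finset.card_image_le.trans ((Finset.card_filter_le _ _).trans ?_)
      simp
    have hM1 := one_le_normalFourthMoment
    have hd1 : (1 : ℝ) ≤ d := by exact_mod_cast hd
    have key : ∀ o ∈ I, (∀ j, MemLp (φ o j) 2 (ν' o)) ∧
        0 < (ν' o).real Set.univ ∧
        ∑ j, ∫ x, φ o j x ^ 2 ∂(ν' o) ≤ (ν' o).real Set.univ *
          (2 * d * (1 + normalFourthMoment)) ∧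
        16 * (2 * d * (1 + normalFourthMoment)) ≤
          n * (ν' o).real Set.univ * (1 / 8192 : ℝ) ^ 2 := by
      intro o ho
      obtain ⟨i, hi, rfl⟩ := Finset.mem_image.1 ho
      obtain ⟨-, hi1, hi2⟩ := Finset.mem_filter.1 hi
      have hw : 0 < w.1 i := lt_of_lt_of_le (by positivity) hi1
      obtain ⟨h1, h2, -⟩ := moments_of_le_affineGaussian (hs i) hw (hν1 i) hi2
      refine ⟨h1, ?_, h2, ?_⟩
      · change 0 < (ν i).real Set.univ
        linarith
      · change _ ≤ n * (ν i).real Set.univ * (1 / 8192 : ℝ) ^ 2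
        -- Half of a weight of at least `κ / k` remains; this halving turns the constant 16 of the
        -- block estimate into 32.
        have h3 : κ / k / 2 ≤ (ν i).real Set.univ := by linarith
        have h4 : 32 * (2 * d * (1 + normalFourthMoment)) * 8192 ^ 2 ≤ n * (κ / k) := by
          rw [← mul_div_assoc, le_div_iff₀ hk']; linarith
        have h5 : (n : ℝ) * (κ / k / 2) ≤ n * (ν i).real Set.univ := by gcongr
        linarith
    have hmain := measure_not_exists_labelling_le ν' (g : Measure (EuclideanSpace ℝ (Fin d))) hν' I
      (o₀ := none) (by simp [hI]) (φ := φ)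
      (fun o j => by
        cases o with
        | none => exact measurable_const
        | some i => exact measurable_momentStatistic _ _ j)
      (fun o ho => (key o ho).1) (V := 2 * d * (1 + normalFourthMoment)) (η := 1 / 8192)
      (by norm_num) (by nlinarith) B n (fun o ho => (key o ho).2.1)
      (fun o ho => (key o ho).2.2.1) (fun o ho => (key o ho).2.2.2)
    refine (measure_mono ?_).trans (hmain.trans ?_)
    · intro x hx hL
      obtain ⟨L, hL⟩ := hL
      refine hx ⟨L, fun i hi1 hi2 => ?_⟩
      have hw : 0 < w.1 i := lt_of_lt_of_le (by positivity) hi1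
      obtain ⟨-, -, h3, h4, h5⟩ := moments_of_le_affineGaussian (hs i) hw (hν1 i) hi2
      have hi : some i ∈ I :=
        Finset.mem_image_of_mem _ (Finset.mem_filter.2 ⟨Finset.mem_univ _, hi1, hi2⟩)
      exact exists_correction (hs i) h3 h4 h5 (hL (some i) hi)
    · gcongr

open Classical in
/-- The learner for prescribed sizes of the two parts of the sample and of the nets. -/
theorem exists_learner_of_sizes (hd : 0 < d) (hk : 0 < k) {ξ κ t : ℝ} (hξ : 0 < ξ) (hκ : 0 < κ)
    (ht : 0 < t) (B n r Q j : ℕ) (hQ : 0 < Q)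
    (hn : 32 * (2 * d * (1 + normalFourthMoment)) * k * 8192 ^ 2 ≤ n * κ)
    (hj : 1024 * devConst ≤ ξ * 2 ^ j) :
    ∃ A : (Fin (B * n + r) → EuclideanSpace ℝ (Fin d)) →
        ProbabilityMeasure (EuclideanSpace ℝ (Fin d)),
      ∀ g, ∀ F ∈ kMixtures (axisAlignedGaussians d) k,
        sampleLaw g (B * n + r) {S | 3 * (3 * tvDist F g + candidateError k ξ κ Q) + 2 * t <
          tvDist (A S) g} ≤ k * (2⁻¹ : ENNReal) ^ B + ENNReal.ofReal (2 *
            ((((k + 1) ^ (B * n) * (Q + 1) ^ k * (((5 ^ d) ^ j) ^ 2) ^ k : ℕ) : ℝ)) ^ 2 *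
              Real.exp (-(2 * r * t ^ 2))) := by
  obtain ⟨W, hW0, hW1, hW2⟩ := exists_net_stdSimplex hk hQ
  obtain ⟨T, hT0, hT1, hT2⟩ := exists_finset_net (EuclideanSpace ℝ (Fin d)) j hξ
  rw [finrank_euclideanSpace, Fintype.card_fin] at hT1
  let Ω := Fin B → Fin n → EuclideanSpace ℝ (Fin d)
  -- A candidate is a labelling of the first part of the sample, a weight vector from the net, and a
  -- pair of net corrections for each component.
  let ι := (Fin B × Fin n → Option (Fin k)) × W × (Fin k → T × T)
  have : Nonempty W := hW0.to_subtype
  have : Nonempty T := hT0.to_subtype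
  let fit : ι → Fin k → Ω → ProbabilityMeasure (EuclideanSpace ℝ (Fin d)) := fun c i x =>
    fittedGaussian (Finset.univ.filter fun p => c.1 p = some i) (c.2.2 i).1 (c.2.2 i).2
      (fun p => x p.1 p.2)
  have hfit : ∀ c i, Measurable fun x => (fit c i x : Measure (EuclideanSpace ℝ (Fin d))) :=
    fun c i => (measurable_fittedGaussian _ _ _).comp
      (show Measurable fun (x : Ω) (p : Fin B × Fin n) => x p.1 p.2 by fun_prop)
  let K : ι → Kernel Ω (EuclideanSpace ℝ (Fin d)) := fun c =>
    mixtureKernel c.2.1.1 (fit c) (hfit c)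
  have hK : ∀ c, IsMarkovKernel (K c) := fun c =>
    inferInstanceAs (IsMarkovKernel (mixtureKernel c.2.1.1 (fit c) (hfit c)))
  obtain ⟨sel, hsel⟩ := exists_selector K r ht
  refine ⟨fun S => kernelAt (K (sel (splitSample B n r S).1 (splitSample B n r S).2))
    (splitSample B n r S).1, fun g F hF => ?_⟩
  obtain ⟨w, f, hf, rfl⟩ := exists_eq_mixture hF
  choose μ s hs hfe using fun i => exists_eq_affineGaussian (hf i)
  obtain rfl : f = fun i => affineGaussian (μ i) (s i) := funext hfe
  obtain ⟨c, hc1, hc2, hc3⟩ := measure_not_exists_reconstruction_le hd hk w hs g hκ B n hn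
  set P : Measure Ω := Measure.pi fun _ : Fin B => Measure.pi fun _ : Fin n =>
    (g : Measure (EuclideanSpace ℝ (Fin d))) with hP
  set D : Set Ω := {x | ¬ ∃ L : Fin B × Fin n → Option (Fin k), ∀ i, κ / k ≤ w.1 i →
    w.1 i / 2 ≤ c i →
    ∃ α τ : EuclideanSpace ℝ (Fin d), ‖α‖ ≤ 1024 * devConst ∧ ‖τ‖ ≤ 1024 * devConst ∧
    ∀ α' τ' : EuclideanSpace ℝ (Fin d), ∀ ξ : ℝ, 0 < ξ → ‖α - α'‖ ≤ ξ → ‖τ - τ'‖ ≤ ξ →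
      tvDist (affineGaussian (μ i) (s i))
        (fittedGaussian (Finset.univ.filter fun p => L p = some i) α' τ'
          (fun p => x p.1 p.2)) ≤ 3 / 2 * ((2 + devConst) * ξ)} with hD
  set G := mixture w fun i => affineGaussian (μ i) (s i) with hG
  set bad : Set (Ω × (Fin r → EuclideanSpace ℝ (Fin d))) := {p | ∃ a : ι,
    3 * tvDist (kernelAt (K a) p.1) g + 2 * t <
      tvDist (kernelAt (K (sel p.1 p.2)) p.1) g} with hbad
  have hcand : ∀ x, x ∉ D → ∃ a : ι, tvDist (kernelAt (K a) x) g
      ≤ 3 * tvDist G g + candidateError k ξ κ Q := by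
    intro x hx
    obtain ⟨L, hL⟩ := not_not.1 hx
    obtain ⟨w', hw', hww⟩ := hW2 w
    have hcor : ∀ i, ∃ q : T × T, κ / k ≤ w.1 i → w.1 i / 2 ≤ c i →
        tvDist (affineGaussian (μ i) (s i))
          (fittedGaussian (Finset.univ.filter fun p => L p = some i) q.1 q.2
            (fun p => x p.1 p.2)) ≤ 3 / 2 * ((2 + devConst) * ξ) := by
      intro i
      by_cases hi : κ / k ≤ w.1 i ∧ w.1 i / 2 ≤ c i
      · obtain ⟨α, τ, hα, hτ, h⟩ := hL i hi.1 hi.2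
        obtain ⟨α', hα', h1⟩ := hT2 α (hα.trans hj)
        obtain ⟨τ', hτ', h2⟩ := hT2 τ (hτ.trans hj)
        exact ⟨(⟨α', hα'⟩, ⟨τ', hτ'⟩), fun _ _ => h α' τ' ξ hξ h1 h2⟩
      · exact ⟨Classical.arbitrary _, fun h1 h2 => absurd ⟨h1, h2⟩ hi⟩
    choose q hq using hcor
    have hdev := one_le_devConst
    exact ⟨(L, ⟨w', hw'⟩, q), tvDist_mixture_le_of_reconstruction hk w w' _
      (fun i => fit (L, ⟨w', hw'⟩, q) i x) g c hc1 hc2 (by positivity) hκ.le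
      (fun i h1 h2 => hq i h1 h2) hww⟩
  have hsub : {S | 3 * (3 * tvDist G g + candidateError k ξ κ Q) + 2 * t <
      tvDist (kernelAt (K (sel (splitSample B n r S).1 (splitSample B n r S).2))
        (splitSample B n r S).1) g} ⊆ splitSample B n r ⁻¹' (Prod.fst ⁻¹' D ∪ bad) := by
    intro S hS
    by_contra hcon
    simp only [Set.mem_preimage, Set.mem_union, not_or] at hcon
    obtain ⟨a, ha⟩ := hcand _ hcon.1
    refine hcon.2 ⟨a, lt_of_le_of_lt ?_ hS⟩
    linarith
  have hmp := measurePreserving_splitSample (g : Measure (EuclideanSpace ℝ (Fin d))) B n r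
  -- The failure event need not be measurable; `Measure.le_map_apply` transports its outer measure
  -- to the split sample.
  refine (measure_mono hsub).trans ((Measure.le_map_apply hmp.measurable.aemeasurable _).trans ?_)
  rw [hmp.map_eq]
  refine (measure_union_le _ _).trans (add_le_add ?_ ?_)
  · refine (Measure.le_map_apply measurable_fst.aemeasurable _).trans ?_
    rw [show Measure.map Prod.fst (P.prod (Measure.pi fun _ : Fin r =>
      (g : Measure (EuclideanSpace ℝ (Fin d))))) = P from measurePreserving_fst.map_eq]
    exact hc3
  · refine (hsel P g).trans (ENNReal.ofReal_le_ofReal ?_)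
    have hcard : Fintype.card ι ≤ (k + 1) ^ (B * n) * (Q + 1) ^ k * (((5 ^ d) ^ j) ^ 2) ^ k := by
      have : Fintype.card ι = (k + 1) ^ (B * n) * (W.card * (T.card * T.card) ^ k) := by
        simp [ι, Fintype.card_prod]
      rw [this, mul_assoc]
      gcongr
      rw [sq]
      gcongr
    gcongr

end UpperBound

/-! ### Choice of the sizes and the agnostic guarantee. -/

section SampleSize

set_option maxHeartbeats 1000000 in
/-- Sizes of the blocks, nets and of the selection sample for the learner of
`exists_learner_of_sizes`, with `A₁`, `A₂` constants. -/
lemma exists_sizes {A₁ A₂ : ℝ} (hA₁ : 0 ≤ A₁) (hA₂ : 0 ≤ A₂) : ∃ K : ℝ, 0 < K ∧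
    ∀ d k : ℕ, 1 ≤ d → 2 ≤ k → ∀ ε δ : ℝ, 0 < ε → ε < 2 → 0 < δ → δ < 1 →
    ∃ B n r Q j : ℕ, 0 < Q ∧ A₁ * (k * d / ε) ≤ n ∧ A₂ / ε ≤ 2 ^ j ∧ 80 * k / ε ≤ Q ∧
      (k : ℝ) / 2 ^ B ≤ δ / 2 ∧
      2 * ((((k + 1) ^ (B * n) * (Q + 1) ^ k * (((5 ^ d) ^ j) ^ 2) ^ k : ℕ) : ℝ)) ^ 2 *
        Real.exp (-(2 * r * (ε / 16) ^ 2)) ≤ δ / 2 ∧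
      ((B * n + r : ℕ) : ℝ) ≤ K * ((k : ℝ) * d * Real.log k * Real.log (k / δ) / ε ^ 4) := by
  set A₃ : ℝ := 16 * (A₁ + 1) + 32 * (A₂ + 2) + 340 with hA₃
  set A₄ : ℝ := 64 * (A₁ + 1) + 128 * (4 + 2 * A₃) + 16 with hA₄
  have hA₃0 : 0 ≤ A₃ := by positivity
  have hA₄0 : 0 < A₄ := by positivity
  clear_value A₃ A₄
  refine ⟨2 * A₄, by positivity, fun d k hd hk ε δ hε hε2 hδ hδ1 => ?_⟩
  have hd' : (1 : ℝ) ≤ d := by exact_mod_cast hd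
  have hk' : (2 : ℝ) ≤ k := by exact_mod_cast hk
  have hk0 : (0 : ℝ) < k := by linarith
  have hlog2 := Real.log_two_gt_d9
  have hlog2' := Real.log_two_lt_d9
  set D := Real.log (k / δ) with hD
  set ℓ := Real.log k with hℓ
  set u : ℝ := k * d / ε with hu
  -- The order of the logarithm of the number of candidates; every other quantity is compared with
  -- it.
  set Z : ℝ := u * ℓ * D with hZ
  clear_value D ℓ u Z
  have hℓ1 : 1 / 2 ≤ ℓ := by
    have := Real.log_le_log (by norm_num) hk'
    rw [hℓ]; linarith
  have hkδ : (k : ℝ) ≤ k / δ := by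
    rw [le_div_iff₀ hδ]; exact mul_le_of_le_one_right hk0.le hδ1.le
  have hD1 : 1 / 2 ≤ D := by
    have := Real.log_le_log hk0 hkδ
    rw [hD]; linarith
  have hkd : (k : ℝ) ≤ k * d := le_mul_of_one_le_right hk0.le hd'
  have hu1 : 1 ≤ u := by
    rw [hu, le_div_iff₀ hε]; linarith
  have hku : (k : ℝ) ≤ 2 * u := by
    have : (k : ℝ) * d = u * ε := by rw [hu]; field_simp
    have h2 : u * ε ≤ u * 2 := by gcongr
    linarith
  have hkε : k / ε ≤ u := by rw [hu]; gcongr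
  have huD : u * D ≤ 2 * Z := by
    have : u * D * (1 / 2) ≤ u * D * ℓ := by gcongr
    rw [hZ]; linarith
  have hDu : D ≤ u * D := le_mul_of_one_le_left (by linarith) hu1
  have huu : u ≤ 4 * Z := by
    have : u * (1 / 2) ≤ u * D := by gcongr
    linarith
  have hZ0 : 1 / 4 ≤ Z := by linarith
  have hkℓ : k * ℓ ≤ 4 * Z := by
    have h1 : k * ℓ ≤ 2 * u * ℓ := by gcongr
    have h2 : u * ℓ * (1 / 2) ≤ u * ℓ * D := by gcongr
    rw [hZ]; linarith
  set B := ⌈2 * (Real.log 2 + D)⌉₊ with hB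
  set n := ⌈A₁ * u⌉₊ with hn
  set Q := ⌈80 * k / ε⌉₊ with hQ
  -- Only `2 ^ j ≥ A₂ / ε` is needed, but the wasteful linear choice is affordable: the nets then
  -- cost `k * d * j`, of order `k * d / ε`, which is absorbed in `Z`.
  set j := ⌈A₂ / ε⌉₊ with hj
  -- Solves `2 * r * (ε / 16) ^ 2 ≥ log (4 / δ) + 2 * log N` for the number `N` of candidates.
  set r := ⌈(Real.log (4 / δ) + 2 * A₃ * Z) * (128 / ε ^ 2)⌉₊ with hr
  have hBle : (B : ℝ) ≤ 8 * D := by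
    have := (Nat.ceil_lt_add_one (show 0 ≤ 2 * (Real.log 2 + D) by positivity)).le
    rw [← hB] at this
    linarith
  have hnle : (n : ℝ) ≤ (A₁ + 1) * u := by
    have := (Nat.ceil_lt_add_one (show 0 ≤ A₁ * u by positivity)).le
    rw [← hn] at this
    linarith
  have hjle : (j : ℝ) ≤ (A₂ + 2) / ε := by
    have := (Nat.ceil_lt_add_one (show 0 ≤ A₂ / ε by positivity)).le
    rw [← hj] at this
    have h1 : 1 ≤ 2 / ε := by rw [le_div_iff₀ hε]; linarith
    rw [add_div]; linarith
  have hQle : (Q : ℝ) + 1 ≤ 84 * (k / ε) := by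
    have := (Nat.ceil_lt_add_one (show 0 ≤ 80 * k / ε by positivity)).le
    rw [← hQ] at this
    have h1 : 1 ≤ k / ε := by rw [le_div_iff₀ hε]; linarith
    rw [mul_div_assoc] at this
    linarith
  have hQpos : 0 < Q := Nat.ceil_pos.2 (by positivity)
  have hB' : 2 * (Real.log 2 + D) ≤ B := Nat.le_ceil _
  have hn' : A₁ * u ≤ n := Nat.le_ceil _
  have hQ' : 80 * k / ε ≤ Q := Nat.le_ceil _
  have hj' : A₂ / ε ≤ j := Nat.le_ceil _
  have hr' : (Real.log (4 / δ) + 2 * A₃ * Z) * (128 / ε ^ 2) ≤ r := Nat.le_ceil _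
  clear_value B n Q j
  have hBn : (B : ℝ) * n ≤ 8 * (A₁ + 1) * (u * D) := by
    calc (B : ℝ) * n ≤ 8 * D * ((A₁ + 1) * u) := by gcongr
      _ = _ := by ring
  set N : ℝ := (((k + 1) ^ (B * n) * (Q + 1) ^ k * (((5 ^ d) ^ j) ^ 2) ^ k : ℕ) : ℝ) with hN
  have hNpos : 0 < N := by rw [hN]; exact_mod_cast (by positivity)
  have hlogN : Real.log N ≤ A₃ * Z := by
    have e : Real.log N = B * n * Real.log (k + 1) + k * Real.log (Q + 1) +
        k * d * j * (2 * Real.log 5) := by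
      rw [hN]
      push_cast
      rw [Real.log_mul (by positivity) (by positivity), Real.log_mul (by positivity)
        (by positivity)]
      simp only [Real.log_pow]
      push_cast
      ring
    have h1 : Real.log (k + 1) ≤ 2 * ℓ := by
      have : Real.log (k + 1) ≤ Real.log ((k : ℝ) ^ 2) :=
        Real.log_le_log (by positivity) (by rw [sq]; linarith [mul_le_mul_of_nonneg_right hk' hk0.le])
      rw [Real.log_pow, ← hℓ] at this
      exact_mod_cast this
    have h2 : Real.log (Q + 1) ≤ ℓ + 84 / ε := by
      have h3 : Real.log ((Q : ℝ) + 1) ≤ Real.log (k * (84 / ε)) :=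
        Real.log_le_log (by positivity) (hQle.trans (le_of_eq (by ring)))
      rw [Real.log_mul (by positivity) (by positivity)] at h3
      have h4 := Real.log_le_sub_one_of_pos (show 0 < 84 / ε by positivity)
      linarith
    have h5 : Real.log 5 ≤ 4 := by
      have := Real.log_le_sub_one_of_pos (show (0 : ℝ) < 5 by norm_num)
      linarith
    have p1 : B * n * Real.log (k + 1) ≤ 16 * (A₁ + 1) * Z := by
      calc B * n * Real.log (k + 1) ≤ 8 * (A₁ + 1) * (u * D) * (2 * ℓ) := by
            have := Real.log_nonneg (show (1 : ℝ) ≤ k + 1 by linarith)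
            gcongr
        _ = _ := by rw [hZ]; ring
    have p2 : k * Real.log (Q + 1) ≤ 340 * Z := by
      calc k * Real.log (Q + 1) ≤ k * (ℓ + 84 / ε) := by gcongr
        _ = k * ℓ + 84 * (k / ε) := by ring
        _ ≤ 4 * Z + 84 * (4 * Z) := by gcongr; exact hkε.trans huu
        _ = 340 * Z := by ring
    have p3 : k * d * j * (2 * Real.log 5) ≤ 32 * (A₂ + 2) * Z := by
      calc k * d * j * (2 * Real.log 5) ≤ k * d * ((A₂ + 2) / ε) * (2 * 4) := by gcongr
        _ = 8 * (A₂ + 2) * u := by rw [hu]; ring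
        _ ≤ 8 * (A₂ + 2) * (4 * Z) := by gcongr
        _ = _ := by ring
    rw [e, hA₃]; linarith
  have hlogδ : Real.log (4 / δ) ≤ 4 * Z := by
    have h1 : Real.log (4 / δ) ≤ Real.log ((k / δ) ^ 2) := by
      refine Real.log_le_log (by positivity) ?_
      rw [div_pow, div_le_div_iff₀ hδ (by positivity)]
      have h2 : 4 ≤ (k : ℝ) ^ 2 := by
        calc (4 : ℝ) = 2 ^ 2 := by norm_num
          _ ≤ _ := by gcongr
      have h3 : δ ^ 2 ≤ δ := pow_le_of_le_one hδ.le hδ1.le two_ne_zero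
      calc 4 * δ ^ 2 ≤ (k : ℝ) ^ 2 * δ := by gcongr
        _ = _ := rfl
    rw [Real.log_pow] at h1
    push_cast at h1
    linarith
  have hlogδ0 : 0 ≤ Real.log (4 / δ) :=
    Real.log_nonneg (by rw [le_div_iff₀ hδ]; linarith)
  refine ⟨B, n, r, Q, j, hQpos, hn', ?_, hQ', ?_, ?_, ?_⟩
  · refine hj'.trans ?_
    exact_mod_cast (Nat.lt_two_pow_self (n := j)).le
  · rw [div_le_iff₀ (by positivity)]
    have h1 : 2 * k / δ ≤ (2 : ℝ) ^ B := by
      rw [← Real.log_le_log_iff (by positivity) (by positivity), Real.log_pow, mul_div_assoc,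
        Real.log_mul (by norm_num) (by positivity)]
      rw [← hD]
      have h3 : (B : ℝ) * (1 / 2) ≤ B * Real.log 2 := by gcongr; linarith
      linarith
    rw [div_le_iff₀ hδ] at h1
    linarith
  · have h1 : Real.log (4 / δ) + 2 * A₃ * Z ≤ 2 * r * (ε / 16) ^ 2 := by
      have h2 := hr'
      rw [← mul_div_assoc, div_le_iff₀ (by positivity)] at h2
      linarith
    have h2 : N ^ 2 = Real.exp (2 * Real.log N) := by
      rw [mul_comm, Real.exp_mul, Real.exp_log hNpos]; norm_cast
    have h3 : δ / 4 = Real.exp (-Real.log (4 / δ)) := by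
      rw [Real.exp_neg, Real.exp_log (by positivity), inv_div]
    have h4 : N ^ 2 * Real.exp (-(2 * r * (ε / 16) ^ 2)) ≤ δ / 4 := by
      rw [h2, ← Real.exp_add, h3]
      refine Real.exp_le_exp.2 ?_
      linarith
    linarith
  · have hrle : (r : ℝ) ≤ (4 + 2 * A₃) * Z * (128 / ε ^ 2) + 1 := by
      have := (Nat.ceil_lt_add_one (show 0 ≤ (Real.log (4 / δ) + 2 * A₃ * Z) * (128 / ε ^ 2) by
        positivity)).le
      rw [← hr] at this
      refine this.trans ?_
      gcongr
      linarith
    have hZε : Z ≤ 4 * (Z / ε ^ 2) := by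
      rw [← mul_div_assoc, le_div_iff₀ (by positivity), mul_comm 4]
      have h4 : ε ^ 2 ≤ 2 ^ 2 := by gcongr
      exact mul_le_mul_of_nonneg_left (by linarith) (by linarith)
    have h1 : ((B * n + r : ℕ) : ℝ) ≤ A₄ * (Z / ε ^ 2) := by
      push_cast
      calc (B : ℝ) * n + r ≤ 8 * (A₁ + 1) * (2 * Z) + ((4 + 2 * A₃) * Z * (128 / ε ^ 2) + 4 * Z) := by
            exact add_le_add (hBn.trans (by gcongr)) (by linarith)
        _ = (16 * (A₁ + 1) + 4) * Z + 128 * (4 + 2 * A₃) * (Z / ε ^ 2) := by ring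
        _ ≤ (16 * (A₁ + 1) + 4) * (4 * (Z / ε ^ 2)) + 128 * (4 + 2 * A₃) * (Z / ε ^ 2) := by gcongr
        _ = _ := by rw [hA₄]; ring
    refine h1.trans ?_
    -- The sizes give the exponent `ε ^ (-3)`; the stated `ε ^ (-4)` follows from `ε < 2`.
    have h2 : Z / ε ^ 2 ≤ 2 * ((k : ℝ) * d * ℓ * D / ε ^ 4) := by
      have : Z / ε ^ 2 = ε * ((k : ℝ) * d * ℓ * D / ε ^ 4) := by
        rw [hZ, hu]; field_simp
      rw [this]
      gcongr
    calc A₄ * (Z / ε ^ 2) ≤ A₄ * (2 * ((k : ℝ) * d * ℓ * D / ε ^ 4)) := by gcongr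
      _ = _ := by ring

/-- Mixtures of axis-aligned Gaussians are agnostically learnable. -/
theorem exists_agnostic_learner_kMixtures : ∃ K : ℝ, 0 < K ∧ ∀ d k : ℕ, 1 ≤ d → 2 ≤ k →
    ∃ (L : LearningMethod (EuclideanSpace ℝ (Fin d))) (m : ℝ → ℝ → ℕ),
      IsAgnosticPACLearner 9 (kMixtures (axisAlignedGaussians d) k) L m ∧
      ∀ ε δ : ℝ, 0 < ε → 0 < δ → δ < 1 →
        (m ε δ : ℝ) ≤ K * ((k : ℝ) * d * Real.log k * Real.log (k / δ) / ε ^ 4) := by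
  have hM := one_le_normalFourthMoment
  have hdev := one_le_devConst
  obtain ⟨K, hK, hsizes⟩ := exists_sizes
    (A₁ := 32 * (2 * (1 + normalFourthMoment)) * 8192 ^ 2 * 40)
    (A₂ := 1024 * devConst * (60 * (2 + devConst))) (by positivity) (by positivity)
  refine ⟨K, hK, fun d k hd hk => ?_⟩
  have hk0 : (0 : ℝ) < k := by exact_mod_cast (by omega : 0 < k)
  have hk1 : (1 : ℝ) ≤ k := by exact_mod_cast (by omega : 1 ≤ k)
  have hne : Nonempty (ProbabilityMeasure (EuclideanSpace ℝ (Fin d))) := ⟨affineGaussian 0 1⟩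
  have w₀ : stdSimplex ℝ (Fin k) :=
    ⟨Pi.single ⟨0, by omega⟩ 1, single_mem_stdSimplex _ _⟩
  have hFne : (kMixtures (axisAlignedGaussians d) k).Nonempty :=
    ⟨_, mixture_mem_kMixtures w₀ fun _ => affineGaussian_mem 0 (s := 1) fun _ => one_pos⟩
  refine exists_isAgnosticPACLearner (by norm_num) _ _ ?_ ?_
  · intro ε δ hε hδ hδ1
    have h1 : 0 ≤ Real.log k := Real.log_nonneg hk1
    have h2 : 0 ≤ Real.log (k / δ) :=
      Real.log_nonneg (by rw [le_div_iff₀ hδ]; linarith)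
    positivity
  · intro ε δ hε hε2 hδ hδ1
    obtain ⟨B, n, r, Q, j, hQ, hn, hj, hQk, hB, hr, hm⟩ := hsizes d k hd hk ε δ hε hε2 hδ hδ1
    -- Each of the three terms of `candidateError` is at most `ε / 40`. Doubled for the `L₁`
    -- distance, the total error is at most `9 * ε / 20` from the candidates, `ε / 4` from the
    -- selection and `9 * ε / 50` from a near-optimal `F`, which is less than `ε`.
    obtain ⟨A, hA⟩ := exists_learner_of_sizes (d := d) (k := k) (by omega) (by omega)
      (ξ := ε / (60 * (2 + devConst))) (κ := ε / 40) (t := ε / 16) (by positivity)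
      (by positivity) (by positivity) B n r Q j hQ
      (by
        rw [← mul_div_assoc, mul_div_assoc, ← div_le_iff₀ (by positivity)]
        refine le_trans (le_of_eq ?_) hn
        field_simp)
      (by
        rw [div_le_iff₀ hε] at hj
        rw [div_mul_eq_mul_div, le_div_iff₀ (by positivity)]
        linarith)
    refine ⟨B * n + r, A, hm, fun g => ?_⟩
    obtain ⟨F, hF, hFg⟩ := exists_l1Dist_lt_opt_add hFne g (show 0 < ε / 50 by positivity)
    refine (measure_mono ?_).trans ((hA g F hF).trans ?_)
    · intro S hS
      simp only [IsAgnosticApprox, not_le, Set.mem_ofPred_eq] at hS ⊢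
      have herr : candidateError k (ε / (60 * (2 + devConst))) (ε / 40) Q ≤ 3 * (ε / 40) := by
        unfold candidateError
        have h1 : 3 / 2 * ((2 + devConst) * (ε / (60 * (2 + devConst)))) = ε / 40 := by
          field_simp; norm_num
        have hQ' : (0 : ℝ) < Q := by exact_mod_cast hQ
        have h2 : 2 * (k : ℝ) / Q ≤ ε / 40 := by
          rw [div_le_iff₀ hε] at hQk
          rw [div_le_iff₀ hQ']
          linarith
        linarith
      unfold l1Dist at hS hFg
      linarith
    · have h1 : (k : ENNReal) * (2⁻¹ : ENNReal) ^ B = ENNReal.ofReal (k / 2 ^ B) := by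
        rw [ENNReal.ofReal_div_of_pos (by positivity), ENNReal.ofReal_natCast, div_eq_mul_inv,
          ENNReal.ofReal_pow (by norm_num), ENNReal.ofReal_ofNat, ENNReal.inv_pow]
      rw [h1, ← ENNReal.ofReal_add (by positivity) (by positivity)]
      exact ENNReal.ofReal_le_ofReal (by linarith)

end SampleSize

/-! ### Shifted normal laws: densities, half-spaces, tails. -/

section NormalShifts

variable {d : ℕ}

lemma gaussianReal_eq_withDensity_shift (a : ℝ) :
    gaussianReal a 1 = (gaussianReal 0 1).withDensity
      fun x => ENNReal.ofReal (Real.exp (a * x - a ^ 2 / 2)) := by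
  rw [gaussianReal_of_var_ne_zero _ one_ne_zero, gaussianReal_of_var_ne_zero _ one_ne_zero,
    ← withDensity_mul _ (measurable_gaussianPDF 0 1) (by fun_prop)]
  congr 1
  ext x
  rw [Pi.mul_apply, gaussianPDF, gaussianPDF, ← ENNReal.ofReal_mul (gaussianPDFReal_nonneg _ _ _)]
  congr 1
  rw [gaussianPDFReal, gaussianPDFReal, mul_assoc (Real.sqrt _)⁻¹, ← Real.exp_add]
  congr 2
  simp
  ring

lemma integrable_exp_shift (a : ℝ) :
    Integrable (fun x => Real.exp (a * x - a ^ 2 / 2)) (gaussianReal 0 1) := by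
  simp_rw [sub_eq_add_neg, Real.exp_add]
  exact (integrable_exp_mul_gaussianReal a).mul_const _

lemma pi_gaussianReal_eq_withDensity_shift (a : Fin d → ℝ) :
    (Measure.pi fun j => gaussianReal (a j) 1) = (Measure.pi fun _ => gaussianReal 0 1).withDensity
      fun z => ENNReal.ofReal (∏ j, Real.exp (a j * z j - a j ^ 2 / 2)) := by
  rw [← pi_withDensity_ofReal (fun _ : Fin d => gaussianReal 0 1)
    (f := fun j x => Real.exp (a j * x - a j ^ 2 / 2)) (fun j => integrable_exp_shift _)
    fun j x => (Real.exp_pos _).le]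
  simp_rw [← gaussianReal_eq_withDensity_shift]

lemma map_sum_mul_pi_gaussianReal (w a : Fin d → ℝ) :
    (Measure.pi fun j => gaussianReal (a j) 1).map (fun z => ∑ j, w j * z j) =
      gaussianReal (∑ j, w j * a j) (.mk (∑ j, w j ^ 2) (Finset.sum_nonneg fun _ _ => sq_nonneg _)) := by
  have : IsProbabilityMeasure
      ((Measure.pi fun j => gaussianReal (a j) 1).map fun z => ∑ j, w j * z j) :=
    Measure.isProbabilityMeasure_map (Measurable.aemeasurable (by fun_prop))
  apply Measure.ext_of_charFun
  ext t
  rw [charFun_apply_real, integral_map (Measurable.aemeasurable (by fun_prop))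
    (Measurable.aestronglyMeasurable (by fun_prop)), charFun_gaussianReal]
  have h : ∀ z : Fin d → ℝ, Complex.exp (t * ((∑ j, w j * z j : ℝ) : ℂ) * Complex.I) =
      ∏ j, Complex.exp (((t * w j : ℝ) : ℂ) * z j * Complex.I) := by
    intro z
    rw [← Complex.exp_sum]
    congr 1
    push_cast
    rw [Finset.mul_sum, Finset.sum_mul]
    exact Finset.sum_congr rfl fun j _ => by ring
  simp_rw [h]
  rw [integral_fintype_prod_eq_prod
    (f := fun j (x : ℝ) => Complex.exp (((t * w j : ℝ) : ℂ) * x * Complex.I))]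
  simp_rw [← charFun_apply_real, charFun_gaussianReal, ← Complex.exp_sum]
  congr 1
  rw [Finset.sum_sub_distrib]
  simp only [NNReal.coe_mk, NNReal.coe_one]
  push_cast
  rw [Finset.mul_sum, Finset.sum_mul, Finset.sum_mul, Finset.sum_div]
  congr 1
  · exact Finset.sum_congr rfl fun j _ => by ring
  · exact Finset.sum_congr rfl fun j _ => by ring

/-- On `[-1 / 2, 1 / 2]` the normal density is at least `1 / 3 * (7 / 8)`, hence at least `1 / 4`.
-/
lemma le_gaussianReal_Ico {δ : ℝ} (h0 : 0 ≤ δ) (h1 : δ ≤ 1) :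
    1 / 4 * δ ≤ (gaussianReal 0 1).real (Set.Ico (-(δ / 2)) (δ / 2)) := by
  have hpdf : ∀ x ∈ Set.Ico (-(δ / 2)) (δ / 2), 1 / 4 ≤ gaussianPDFReal 0 1 x := by
    intro x hx
    have hx2 : x ^ 2 ≤ 1 / 4 := by
      have : |x| ≤ |1 / 2| := abs_le_abs (by linarith [hx.2]) (by linarith [hx.1])
      have := sq_le_sq.2 this
      linarith
    have hexp : 7 / 8 ≤ Real.exp (-x ^ 2 / 2) := by
      have := Real.add_one_le_exp (-x ^ 2 / 2)
      linarith
    have hsqrt : Real.sqrt (2 * Real.pi) ≤ 3 := by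
      rw [Real.sqrt_le_left (by norm_num)]
      linarith [Real.pi_lt_four]
    have hsqrt0 : 0 < Real.sqrt (2 * Real.pi) := by positivity
    have : (1 : ℝ) / 3 ≤ (Real.sqrt (2 * Real.pi))⁻¹ := by
      rw [one_div]; exact inv_anti₀ hsqrt0 hsqrt
    simp only [gaussianPDFReal, NNReal.coe_one, mul_one, sub_zero]
    calc (1 : ℝ) / 4 ≤ 1 / 3 * (7 / 8) := by norm_num
      _ ≤ _ := by gcongr
  rw [Measure.real, gaussianReal_apply_eq_integral _ one_ne_zero,
    ENNReal.toReal_ofReal (integral_nonneg fun _ => gaussianPDFReal_nonneg _ _ _)]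
  have h := setIntegral_mono_on (μ := volume) (s := Set.Ico (-(δ / 2)) (δ / 2))
    (f := fun _ => (1 : ℝ) / 4) (by simp) (integrable_gaussianPDFReal 0 1).integrableOn
    measurableSet_Ico hpdf
  refine le_trans (le_of_eq ?_) h
  rw [setIntegral_const, Real.volume_real_Ico_of_le (by linarith), smul_eq_mul]
  ring

lemma gaussianReal_real_Ici (m c : ℝ) :
    (gaussianReal m 1).real (Set.Ici c) = (gaussianReal 0 1).real (Set.Ici (c - m)) := by
  have h := gaussianReal_map_add_const (μ := 0) (v := 1) m
  rw [zero_add] at h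
  rw [← h, map_measureReal_apply (by fun_prop) measurableSet_Ici]
  congr 1
  ext x
  simp

/-- Two unit-covariance Gaussians at distance at most one are told apart by a half-space, with
an advantage proportional to the distance of the means. -/
lemma exists_halfspace (a b : Fin d → ℝ) (hab : ∑ j, (a j - b j) ^ 2 ≤ 1) :
    ∃ H : Set (Fin d → ℝ), MeasurableSet H ∧ 1 / 4 * Real.sqrt (∑ j, (a j - b j) ^ 2) ≤
      (Measure.pi fun j => gaussianReal (a j) 1).real H -
        (Measure.pi fun j => gaussianReal (b j) 1).real H := by
  have hs0 : 0 ≤ ∑ j, (a j - b j) ^ 2 := Finset.sum_nonneg fun _ _ => sq_nonneg _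
  obtain ⟨δ, hδ⟩ : ∃ δ, δ = Real.sqrt (∑ j, (a j - b j) ^ 2) := ⟨_, rfl⟩
  rw [← hδ]
  have hδ1 : δ ≤ 1 := by rw [hδ]; exact Real.sqrt_le_one.2 hab
  have hδsq : ∑ j, (a j - b j) ^ 2 = δ ^ 2 := by rw [hδ, Real.sq_sqrt hs0]
  rcases (hδ ▸ Real.sqrt_nonneg _ : 0 ≤ δ).eq_or_lt with h0 | h0
  · exact ⟨∅, MeasurableSet.empty, by simp [← h0]⟩
  -- Unit vector in the direction of `a - b`. Projecting onto it leaves two unit-variance normal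
  -- laws at distance `δ`, separated by the midpoint of their means.
  set w : Fin d → ℝ := fun j => (a j - b j) / δ with hw
  have hw1 : ∑ j, w j ^ 2 = 1 := by
    simp only [hw, div_pow]
    rw [← Finset.sum_div, hδsq, div_self (by positivity)]
  have hwab : ∑ j, w j * a j - ∑ j, w j * b j = δ := by
    rw [← Finset.sum_sub_distrib]
    have : ∀ j, w j * a j - w j * b j = (a j - b j) ^ 2 / δ := fun j => by rw [hw]; ring
    simp_rw [this]
    rw [← Finset.sum_div, hδsq, sq, mul_div_assoc, div_self h0.ne', mul_one]
  have hmap : ∀ e : Fin d → ℝ, (Measure.pi fun j => gaussianReal (e j) 1).map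
      (fun z => ∑ j, w j * z j) = gaussianReal (∑ j, w j * e j) 1 := by
    intro e
    rw [map_sum_mul_pi_gaussianReal]
    congr 1
    exact NNReal.eq hw1
  set c := (∑ j, w j * a j + ∑ j, w j * b j) / 2 with hc
  have hm : Measurable fun z : Fin d → ℝ => ∑ j, w j * z j := by fun_prop
  refine ⟨(fun z => ∑ j, w j * z j) ⁻¹' Set.Ici c, hm measurableSet_Ici, ?_⟩
  rw [← map_measureReal_apply hm measurableSet_Ici, ← map_measureReal_apply hm measurableSet_Ici,
    hmap, hmap, gaussianReal_real_Ici, gaussianReal_real_Ici _ c,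
    show c - ∑ j, w j * a j = -(δ / 2) by linarith, show c - ∑ j, w j * b j = δ / 2 by linarith,
    ← measureReal_sdiff (Set.Ici_subset_Ici.2 (by linarith)) measurableSet_Ici, Set.Ici_sdiff_Ici]
  exact le_gaussianReal_Ico h0.le hδ1

/-- A tail bound that is uniform over means in `[-1, 1]`. -/
lemma gaussianReal_real_tail_le {m R : ℝ} (hm : |m| ≤ 1) (hR : 1 < R) :
    (gaussianReal m 1).real {x | R < |x|} ≤ 1 / (R - 1) ^ 2 := by
  have h := meas_ge_le_variance_div_sq (memLp_id_gaussianReal (μ := m) (v := 1) 2)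
    (show 0 < R - 1 by linarith)
  simp only [id_eq, integral_id_gaussianReal, variance_id_gaussianReal] at h
  refine ENNReal.toReal_le_of_le_ofReal (by positivity) ((measure_mono ?_).trans h)
  intro x hx
  simp only [Set.mem_ofPred_eq] at hx ⊢
  have := abs_sub_abs_le_abs_sub x m
  linarith

end NormalShifts

/-! ### Change of measure for labelled normal samples. -/

section LabelledNormals

variable {k d : ℕ}

/-- The law of a uniform label `i` together with a unit-covariance Gaussian of mean `a i`. -/
noncomputable def labelledNormal (a : Fin k → Fin d → ℝ) : Measure (Fin k × (Fin d → ℝ)) :=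
  ∑ i, (k : ENNReal)⁻¹ • (Measure.pi fun j => gaussianReal (a i j) 1).map (Prod.mk i)

lemma labelledNormal_apply (a : Fin k → Fin d → ℝ) {S : Set (Fin k × (Fin d → ℝ))}
    (hS : MeasurableSet S) : labelledNormal a S =
      ∑ i, (k : ENNReal)⁻¹ * (Measure.pi fun j => gaussianReal (a i j) 1) (Prod.mk i ⁻¹' S) := by
  rw [labelledNormal, Measure.finsetSum_apply]
  exact Finset.sum_congr rfl fun i _ => by
    rw [Measure.smul_apply, Measure.map_apply (by fun_prop) hS, smul_eq_mul]

lemma isProbabilityMeasure_labelledNormal (hk : 0 < k) (a : Fin k → Fin d → ℝ) :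
    IsProbabilityMeasure (labelledNormal a) := by
  constructor
  rw [labelledNormal_apply a MeasurableSet.univ]
  simp only [Set.preimage_univ, measure_univ, mul_one, Finset.sum_const, Finset.card_univ,
    Fintype.card_fin, nsmul_eq_mul]
  exact ENNReal.mul_inv_cancel (by exact_mod_cast hk.ne') (ENNReal.natCast_ne_top k)

/-- The density of `labelledNormal a` with respect to `labelledNormal 0`. -/
noncomputable def shiftDensity (a : Fin k → Fin d → ℝ) (p : Fin k × (Fin d → ℝ)) : ℝ :=
  ∏ j, Real.exp (a p.1 j * p.2 j - a p.1 j ^ 2 / 2)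

lemma measurable_shiftDensity (a : Fin k → Fin d → ℝ) : Measurable (shiftDensity a) := by
  have h : ∀ j, Measurable fun p : Fin k × (Fin d → ℝ) => a p.1 j := fun j =>
    (measurable_of_finite fun i => a i j).comp measurable_fst
  unfold shiftDensity
  fun_prop

lemma shiftDensity_pos (a : Fin k → Fin d → ℝ) (p : Fin k × (Fin d → ℝ)) :
    0 < shiftDensity a p := Finset.prod_pos fun _ _ => Real.exp_pos _

/-- Squaring a Gaussian likelihood ratio doubles the shift at the cost of a constant; this is the
chi-square computation. -/
lemma shiftDensity_sq (a : Fin k → Fin d → ℝ) (p : Fin k × (Fin d → ℝ)) :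
    shiftDensity a p ^ 2 = Real.exp (∑ j, a p.1 j ^ 2) * shiftDensity (2 * a) p := by
  rw [shiftDensity, shiftDensity, Real.exp_sum, ← Finset.prod_pow, ← Finset.prod_mul_distrib]
  refine Finset.prod_congr rfl fun j _ => ?_
  rw [sq, ← Real.exp_add, ← Real.exp_add]
  congr 1
  simp
  ring

lemma labelledNormal_eq_withDensity (a : Fin k → Fin d → ℝ) :
    labelledNormal a = (labelledNormal 0).withDensity
      fun p => ENNReal.ofReal (shiftDensity a p) := by
  have hm : Measurable fun p => ENNReal.ofReal (shiftDensity a p) :=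
    (measurable_shiftDensity a).ennreal_ofReal
  ext S hS
  rw [labelledNormal_apply a hS, withDensity_apply _ hS, ← lintegral_indicator hS, labelledNormal,
    lintegral_finsetSum_measure]
  refine Finset.sum_congr rfl fun i _ => ?_
  rw [lintegral_smul_measure, lintegral_map (hm.indicator hS) (by fun_prop),
    pi_gaussianReal_eq_withDensity_shift, withDensity_apply _ (measurable_prodMk_left hS),
    ← lintegral_indicator (measurable_prodMk_left hS), smul_eq_mul]
  rfl

lemma integrable_shiftDensity (hk : 0 < k) (a : Fin k → Fin d → ℝ) :
    Integrable (shiftDensity a) (labelledNormal 0) := by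
  have := isProbabilityMeasure_labelledNormal hk a
  refine ⟨(measurable_shiftDensity a).aestronglyMeasurable, ?_⟩
  rw [hasFiniteIntegral_iff_ofReal (ae_of_all _ fun p => (shiftDensity_pos a p).le),
    ← setLIntegral_univ, ← withDensity_apply _ MeasurableSet.univ, ← labelledNormal_eq_withDensity]
  exact measure_lt_top _ _

/-- Change of measure for samples, from a bound on the chi-square divergence. -/
lemma pi_labelledNormal_le (hk : 0 < k) (n : ℕ) {a : Fin k → Fin d → ℝ} {b : ℝ}
    (hb : ∀ i, ∑ j, a i j ^ 2 ≤ b) {S : Set (Fin n → Fin k × (Fin d → ℝ))}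
    (hS : MeasurableSet S) :
    (Measure.pi fun _ : Fin n => labelledNormal a) S ≤ ENNReal.ofReal (1 / 4) +
      ENNReal.ofReal (Real.exp (n * b)) * (Measure.pi fun _ : Fin n => labelledNormal 0) S := by
  have hprob := fun a : Fin k → Fin d → ℝ => isProbabilityMeasure_labelledNormal hk a
  have hdens : ∀ a : Fin k → Fin d → ℝ, (Measure.pi fun _ : Fin n => labelledNormal a) =
      (Measure.pi fun _ : Fin n => labelledNormal 0).withDensity
        fun s => ENNReal.ofReal (∏ t, shiftDensity a (s t)) := by
    intro a
    rw [← pi_withDensity_ofReal (fun _ : Fin n => labelledNormal (0 : Fin k → Fin d → ℝ))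
      (f := fun _ => shiftDensity a) (fun _ => integrable_shiftDensity hk a)
      fun _ p => (shiftDensity_pos a p).le, ← labelledNormal_eq_withDensity]
  have hmeas : ∀ a : Fin k → Fin d → ℝ, Measurable fun s : Fin n → Fin k × (Fin d → ℝ) =>
      ENNReal.ofReal (∏ t, shiftDensity a (s t)) := by
    intro a
    have := measurable_shiftDensity a
    fun_prop
  -- With `x` the likelihood ratio and `y` that of the doubled shift, `x ^ 2 ≤ C * y` and `(x - 2 *
  -- C) ^ 2 ≥ 0` give `x ≤ y / 4 + C`. As `y` is a probability density, the first term contributes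
  -- at most `1 / 4`.
  have hpt : ∀ s : Fin n → Fin k × (Fin d → ℝ), ENNReal.ofReal (∏ t, shiftDensity a (s t)) ≤
      ENNReal.ofReal (1 / 4) * ENNReal.ofReal (∏ t, shiftDensity (2 * a) (s t)) +
        ENNReal.ofReal (Real.exp (n * b)) := by
    intro s
    have hy : 0 ≤ ∏ t, shiftDensity (2 * a) (s t) :=
      Finset.prod_nonneg fun t _ => (shiftDensity_pos _ _).le
    rw [← ENNReal.ofReal_mul (by norm_num), ← ENNReal.ofReal_add (by positivity) (by positivity)]
    refine ENNReal.ofReal_le_ofReal ?_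
    have hsq : (∏ t, shiftDensity a (s t)) ^ 2 ≤
        Real.exp (n * b) * ∏ t, shiftDensity (2 * a) (s t) := by
      rw [← Finset.prod_pow]
      simp_rw [shiftDensity_sq]
      rw [Finset.prod_mul_distrib]
      refine mul_le_mul_of_nonneg_right ?_ hy
      rw [← Real.exp_sum]
      refine Real.exp_le_exp.2 ((Finset.sum_le_sum fun t _ => hb (s t).1).trans ?_)
      simp
    have hC := Real.exp_pos (n * b)
    generalize Real.exp (n * b) = C at *
    generalize ∏ t, shiftDensity a (s t) = x at *
    have h1 := sq_nonneg (x - 2 * C)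
    have h2 : C * x ≤ C * (1 / 4 * ∏ t, shiftDensity (2 * a) (s t) + C) := by linarith
    exact le_of_mul_le_mul_left h2 hC
  calc (Measure.pi fun _ : Fin n => labelledNormal a) S
      = ∫⁻ s in S, ENNReal.ofReal (∏ t, shiftDensity a (s t))
          ∂(Measure.pi fun _ : Fin n => labelledNormal 0) := by
        rw [hdens a, withDensity_apply _ hS]
    _ ≤ ∫⁻ s in S, (ENNReal.ofReal (1 / 4) * ENNReal.ofReal (∏ t, shiftDensity (2 * a) (s t)) +
          ENNReal.ofReal (Real.exp (n * b))) ∂(Measure.pi fun _ : Fin n => labelledNormal 0) :=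
        lintegral_mono hpt
    _ = ENNReal.ofReal (1 / 4) * (Measure.pi fun _ : Fin n => labelledNormal (2 * a)) S +
          ENNReal.ofReal (Real.exp (n * b)) *
            (Measure.pi fun _ : Fin n => labelledNormal 0) S := by
        rw [lintegral_add_right _ measurable_const, lintegral_const_mul _ (hmeas _),
          setLIntegral_const, hdens (2 * a), withDensity_apply _ hS]
    _ ≤ _ := by
        gcongr
        exact mul_le_of_le_one_right zero_le prob_le_one

end LabelledNormals

/-! ### Counting words in Hamming balls. -/

section HammingBalls

/-- Hamming balls of relative radius `1 / 8` are small. -/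
lemma card_le_of_hammingDist_le {ι : Type*} [Fintype ι] {p q : ℕ} (hp : 0 < p)
    (hq : q = p ^ 8) (w : ι → Fin q)
    (T : Finset (ι → Fin q)) (hT : ∀ v ∈ T, 8 * hammingDist v w ≤ Fintype.card ι) :
    (T.card : ℝ) ≤ (2 * p) ^ Fintype.card ι := by
  classical
  have hp' : (1 : ℝ) ≤ p := by exact_mod_cast hp
  have hp0 : (0 : ℝ) < p := by linarith
  -- Every mismatch is weighted by `p ^ (-8) = 1 / q`. The total weight of all words is at most `2`
  -- per coordinate, whereas a word in the ball has weight at least `p ^ (-card ι)`.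
  have hnn : ∀ v : ι → Fin q, 0 ≤ ∏ i, (if v i = w i then 1 else ((p : ℝ) ^ 8)⁻¹) := fun v =>
    Finset.prod_nonneg fun i _ => by split_ifs <;> positivity
  have hsum : ∀ i, ∑ a, (if a = w i then 1 else ((p : ℝ) ^ 8)⁻¹) ≤ 2 := by
    intro i
    calc ∑ a, (if a = w i then 1 else ((p : ℝ) ^ 8)⁻¹)
        ≤ ∑ a, ((if a = w i then 1 else 0) + ((p : ℝ) ^ 8)⁻¹) :=
          Finset.sum_le_sum fun a _ => by split_ifs <;> simp
      _ = 2 := by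
          rw [Finset.sum_add_distrib]
          simp only [Finset.sum_ite_eq', Finset.mem_univ, if_true, Finset.sum_const,
            Finset.card_univ, Fintype.card_fin, nsmul_eq_mul]
          rw [hq, Nat.cast_pow, mul_inv_cancel₀ (by positivity)]
          norm_num
  have hone : ∀ v ∈ T, ((p : ℝ) ^ Fintype.card ι)⁻¹ ≤
      ∏ i, (if v i = w i then 1 else ((p : ℝ) ^ 8)⁻¹) := by
    intro v hv
    have : ∏ i, (if v i = w i then 1 else ((p : ℝ) ^ 8)⁻¹) =
        ((p : ℝ) ^ (8 * hammingDist v w))⁻¹ := by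
      rw [Finset.prod_ite, Finset.prod_const_one, one_mul, Finset.prod_const, inv_pow, ← pow_mul]
      rfl
    rw [this]
    exact inv_anti₀ (by positivity) (pow_le_pow_right₀ hp' (hT v hv))
  have h : (T.card : ℝ) * ((p : ℝ) ^ Fintype.card ι)⁻¹ ≤ 2 ^ Fintype.card ι := by
    calc (T.card : ℝ) * ((p : ℝ) ^ Fintype.card ι)⁻¹
        ≤ ∑ v ∈ T, ∏ i, (if v i = w i then 1 else ((p : ℝ) ^ 8)⁻¹) := by
          rw [← nsmul_eq_mul]; exact Finset.card_nsmul_le_sum _ _ _ hone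
      _ ≤ ∑ v : ι → Fin q, ∏ i, (if v i = w i then 1 else ((p : ℝ) ^ 8)⁻¹) :=
          Finset.sum_le_univ_sum_of_nonneg hnn
      _ = ∏ i, ∑ a, (if a = w i then 1 else ((p : ℝ) ^ 8)⁻¹) := by
          rw [Finset.prod_univ_sum, Fintype.piFinset_univ]
      _ ≤ ∏ _i : ι, 2 := Finset.prod_le_prod (fun i _ => Finset.sum_nonneg fun a _ => by
          split_ifs <;> positivity) fun i _ => hsum i
      _ = _ := by simp
  rw [← div_eq_mul_inv, div_le_iff₀ (by positivity)] at h
  rwa [mul_pow]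

end HammingBalls

/-! ### Mixtures with well separated components. -/

section SpreadMixtures

variable {k d : ℕ}

/-- Component `i` is moved to the `i`-th of a sequence of centres at spacing `2 * R + 1`. -/
noncomputable def spread (R : ℝ) (p : Fin k × (Fin d → ℝ)) : EuclideanSpace ℝ (Fin d) :=
  WithLp.toLp 2 fun j => (p.1 : ℕ) * (2 * R + 1) + p.2 j

lemma measurable_spread (R : ℝ) : Measurable (spread R : Fin k × (Fin d → ℝ) → _) := by
  have h : Measurable fun p : Fin k × (Fin d → ℝ) => ((p.1 : ℕ) : ℝ) :=
    (measurable_of_finite fun i : Fin k => ((i : ℕ) : ℝ)).comp measurable_fst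
  unfold spread
  fun_prop

/-- The uniform mixture of unit-covariance Gaussians with means `a i` relative to the centres. -/
noncomputable def spreadMixture (hk : 0 < k) (R : ℝ) (a : Fin k → Fin d → ℝ) :
    ProbabilityMeasure (EuclideanSpace ℝ (Fin d)) :=
  mixture ⟨fun _ => (k : ℝ)⁻¹, fun _ => by positivity, by
    have : (k : ℝ) ≠ 0 := by exact_mod_cast hk.ne'
    simp [this]⟩
    fun i => affineGaussian (fun j => (i : ℕ) * (2 * R + 1) + a i j) 1

lemma spreadMixture_mem (hk : 0 < k) (R : ℝ) (a : Fin k → Fin d → ℝ) :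
    spreadMixture hk R a ∈ kMixtures (axisAlignedGaussians d) k :=
  mixture_mem_kMixtures _ fun _ => affineGaussian_mem _ fun _ => one_pos

lemma coe_affineGaussian_add (c a : Fin d → ℝ) :
    (affineGaussian (fun j => c j + a j) 1 : Measure (EuclideanSpace ℝ (Fin d))) =
      (Measure.pi fun j => gaussianReal (a j) 1).map fun z => WithLp.toLp 2 fun j => c j + z j := by
  have h : (Measure.pi fun j => gaussianReal (a j) 1) =
      (Measure.pi fun _ : Fin d => gaussianReal 0 1).map (fun z j => a j + z j) := by
    have h2 := Measure.pi_map_pi (μ := fun _ : Fin d => gaussianReal 0 1)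
      (f := fun j z => a j + z) (fun j => by fun_prop)
    rw [h2]
    simp only [gaussianReal_map_const_add, zero_add]
  rw [h, Measure.map_map (by fun_prop) (by fun_prop)]
  simp only [affineGaussian, ProbabilityMeasure.coe_mk]
  congr 1
  ext z j
  simp [add_assoc]

/-- Lets sample laws of mixtures be compared in the labelled model, where likelihood ratios are
products of exponentials. -/
lemma coe_spreadMixture (hk : 0 < k) (R : ℝ) (a : Fin k → Fin d → ℝ) :
    (spreadMixture hk R a : Measure (EuclideanSpace ℝ (Fin d))) =
      (labelledNormal a).map (spread R) := by
  ext S hS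
  rw [Measure.map_apply (measurable_spread R) hS,
    labelledNormal_apply a (measurable_spread R hS)]
  change (∑ i : Fin k, ENNReal.ofReal ((k : ℝ)⁻¹) •
    (affineGaussian (fun j => (i : ℕ) * (2 * R + 1) + a i j) 1 : Measure _)) S = _
  rw [Measure.finsetSum_apply]
  refine Finset.sum_congr rfl fun i _ => ?_
  rw [Measure.smul_apply, smul_eq_mul, ENNReal.ofReal_inv_of_pos (by exact_mod_cast hk),
    ENNReal.ofReal_natCast, coe_affineGaussian_add, Measure.map_apply (by fun_prop) hS]
  rfl

lemma pi_gaussianReal_tail_le (a : Fin d → ℝ) (ha : ∀ j, |a j| ≤ 1) {R : ℝ} (hR : 1 < R)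
    (j : Fin d) : (Measure.pi fun j => gaussianReal (a j) 1).real {z | R < |z j|} ≤
      1 / (R - 1) ^ 2 := by
  have h := (measurePreserving_eval (fun j => gaussianReal (a j) 1) j).measureReal_preimage
    (s := {x | R < |x|}) (measurableSet_lt (by fun_prop) (by fun_prop)).nullMeasurableSet
  refine (le_of_eq ?_).trans (gaussianReal_real_tail_le (ha j) hR)
  rw [← h]
  rfl

/-- The test set glues the optimal half-spaces of the components, each cut to a slab of half-width
`R` around its centre. The spacing `2 * R + 1` keeps the slabs disjoint, so on each component the
test differs from its own half-space only in the tail; the two tails give the subtracted term. -/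
lemma le_tvDist_spreadMixture (hk : 0 < k) (hd : 0 < d) {R : ℝ} (hR : 1 < R)
    (a b : Fin k → Fin d → ℝ) (ha : ∀ i j, |a i j| ≤ 1) (hb : ∀ i j, |b i j| ≤ 1)
    (hab : ∀ i, ∑ j, (a i j - b i j) ^ 2 ≤ 1) :
    (k : ℝ)⁻¹ * ∑ i, 1 / 4 * Real.sqrt (∑ j, (a i j - b i j) ^ 2) - 2 * (1 / (R - 1) ^ 2) ≤
      tvDist (spreadMixture hk R a) (spreadMixture hk R b) := by
  choose H hHm hH using fun i => exists_halfspace (a i) (b i) (hab i)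
  have hk0 : (0 : ℝ) < k := by exact_mod_cast hk
  set j₀ : Fin d := ⟨0, hd⟩
  set c : Fin k → ℝ := fun i => (i : ℕ) * (2 * R + 1) with hc
  set A : Set (EuclideanSpace ℝ (Fin d)) :=
    ⋃ i, {x | |x j₀ - c i| ≤ R ∧ (fun j => x j - c i) ∈ H i} with hA
  have hAm : MeasurableSet A := by
    refine MeasurableSet.iUnion fun i => ?_
    have h1 : MeasurableSet {x : EuclideanSpace ℝ (Fin d) | |x j₀ - c i| ≤ R} :=
      measurableSet_le (by fun_prop) (by fun_prop)
    have h2 : Measurable fun (x : EuclideanSpace ℝ (Fin d)) j => x j - c i := by fun_prop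
    exact h1.inter (h2 (hHm i))
  have hcomp : ∀ (e : Fin k → Fin d → ℝ) (i : Fin k),
      (affineGaussian (fun j => (i : ℕ) * (2 * R + 1) + e i j) 1 :
        Measure (EuclideanSpace ℝ (Fin d))).real A =
      (Measure.pi fun j => gaussianReal (e i j) 1).real
        {z | WithLp.toLp 2 (fun j => c i + z j) ∈ A} := by
    intro e i
    rw [coe_affineGaussian_add, map_measureReal_apply (by fun_prop) hAm]
    rfl
  have hsub1 : ∀ i, H i ⊆ {z | WithLp.toLp 2 (fun j => c i + z j) ∈ A} ∪ {z | R < |z j₀|} := by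
    intro i z hz
    by_cases hz0 : R < |z j₀|
    · exact Or.inr hz0
    · left
      refine Set.mem_iUnion.2 ⟨i, ?_, ?_⟩
      · simpa using hz0
      · simpa using hz
  have hsub2 : ∀ i, {z | WithLp.toLp 2 (fun j => c i + z j) ∈ A} ⊆ H i ∪ {z | R < |z j₀|} := by
    intro i z hz
    by_cases hz0 : R < |z j₀|
    · exact Or.inr hz0
    · left
      obtain ⟨i', h1, h2⟩ := Set.mem_iUnion.1 hz
      have hii : i' = i := by
        by_contra hne
        have h3 : (1 : ℝ) ≤ |((i : ℕ) : ℝ) - ((i' : ℕ) : ℝ)| := by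
          have h4 : (1 : ℤ) ≤ |((i : ℕ) : ℤ) - ((i' : ℕ) : ℤ)| :=
            Int.one_le_abs (by
              intro h0
              exact hne (Fin.ext (by omega)))
          exact_mod_cast h4
        have h5 : |c i - c i'| ≤ 2 * R := by
          have h6 := abs_sub (c i + z j₀ - c i') (z j₀)
          rw [show c i + z j₀ - c i' - z j₀ = c i - c i' by ring] at h6
          have h7 : |c i + z j₀ - c i'| ≤ R := h1
          linarith [not_lt.1 hz0]
        rw [hc, ← sub_mul, abs_mul, abs_of_pos (show 0 < 2 * R + 1 by linarith)] at h5
        have : 1 * (2 * R + 1) ≤ |((i : ℕ) : ℝ) - ((i' : ℕ) : ℝ)| * (2 * R + 1) := by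
          gcongr
        linarith
      subst hii
      simpa using h2
  refine le_trans ?_ (measureReal_sub_le_tvDist _ _ hAm)
  rw [spreadMixture, spreadMixture, mixture_real_apply, mixture_real_apply,
    ← Finset.sum_sub_distrib, Finset.mul_sum]
  have hterm : ∀ i : Fin k, (k : ℝ)⁻¹ * (1 / 4 * Real.sqrt (∑ j, (a i j - b i j) ^ 2)) ≤
      ((k : ℝ)⁻¹ * (affineGaussian (fun j => (i : ℕ) * (2 * R + 1) + a i j) 1 :
          Measure (EuclideanSpace ℝ (Fin d))).real A -
        (k : ℝ)⁻¹ * (affineGaussian (fun j => (i : ℕ) * (2 * R + 1) + b i j) 1 :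
          Measure (EuclideanSpace ℝ (Fin d))).real A) +
        (k : ℝ)⁻¹ * (2 * (1 / (R - 1) ^ 2)) := by
    intro i
    rw [hcomp, hcomp, ← mul_sub, ← mul_add]
    refine mul_le_mul_of_nonneg_left ?_ (by positivity)
    have h1 := (measureReal_mono (μ := Measure.pi fun j => gaussianReal (a i j) 1)
      (hsub1 i)).trans (measureReal_union_le _ _)
    have h2 := (measureReal_mono (μ := Measure.pi fun j => gaussianReal (b i j) 1)
      (hsub2 i)).trans (measureReal_union_le _ _)
    have h3 := pi_gaussianReal_tail_le (a i) (ha i) hR j₀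
    have h4 := pi_gaussianReal_tail_le (b i) (hb i) hR j₀
    linarith [hH i]
  have hsum := Finset.sum_le_sum fun i (_ : i ∈ Finset.univ) => hterm i
  rw [Finset.sum_add_distrib, Finset.sum_const, Finset.card_univ, Fintype.card_fin,
    nsmul_eq_mul, ← mul_assoc, mul_inv_cancel₀ hk0.ne', one_mul] at hsum
  linarith

end SpreadMixtures

/-! ### Events of bounded overlap. -/

section Packing

/-- Events that overlap at most `M` times have total probability at most `M`. -/
lemma sum_measureReal_le {Ω ι : Type*} [MeasurableSpace Ω] [Fintype ι] (μ : Measure Ω)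
    [IsProbabilityMeasure μ] {G : ι → Set Ω} (hG : ∀ v, MeasurableSet (G v)) {M : ℝ}
    (hM : ∀ ω, ∀ T : Finset ι, (∀ v ∈ T, ω ∈ G v) → (T.card : ℝ) ≤ M) :
    ∑ v, μ.real (G v) ≤ M := by
  classical
  have h : ∑ v, μ.real (G v) = ∫ ω, ∑ v, (G v).indicator (fun _ => (1 : ℝ)) ω ∂μ := by
    rw [integral_finsetSum _ fun v _ => (integrable_const 1).indicator (hG v)]
    exact Finset.sum_congr rfl fun v _ => by
      rw [integral_indicator (hG v), setIntegral_const, smul_eq_mul, mul_one]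
  rw [h]
  have h2 : ∫ ω, ∑ v, (G v).indicator (fun _ => (1 : ℝ)) ω ∂μ ≤ ∫ _, M ∂μ := by
    refine integral_mono (integrable_finsetSum _ fun v _ =>
      (integrable_const 1).indicator (hG v)) (integrable_const _) fun ω => ?_
    have h3 : ∑ v, (G v).indicator (fun _ => (1 : ℝ)) ω =
        ((Finset.univ.filter fun v => ω ∈ G v).card : ℝ) := by
      simp [Set.indicator_apply]
    simp only [h3]
    exact hM ω _ fun v hv => (Finset.mem_filter.1 hv).2
  simpa using h2

end Packing

/-! ### The packing argument. -/

section LowerBound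

variable {k d : ℕ}

/-- The means indexed by a word, on a grid of width `s`. -/
noncomputable def gridMeans {q : ℕ} (s : ℝ) (v : Fin k × Fin d → Fin q) (i : Fin k) (j : Fin d) : ℝ :=
  s * (v (i, j) : ℕ)

lemma abs_gridMeans_sub_le {q : ℕ} {s : ℝ} (hs : 0 ≤ s) (v w : Fin k × Fin d → Fin q) (i : Fin k)
    (j : Fin d) : |gridMeans s v i j - gridMeans s w i j| ≤ s * q := by
  unfold gridMeans
  rw [← mul_sub, abs_mul, abs_of_nonneg hs]
  refine mul_le_mul_of_nonneg_left ?_ hs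
  have h1 : ((v (i, j) : ℕ) : ℝ) ≤ q := by exact_mod_cast (v (i, j)).2.le
  have h2 : ((w (i, j) : ℕ) : ℝ) ≤ q := by exact_mod_cast (w (i, j)).2.le
  have h3 : (0 : ℝ) ≤ (v (i, j) : ℕ) := Nat.cast_nonneg _
  have h4 : (0 : ℝ) ≤ (w (i, j) : ℕ) := Nat.cast_nonneg _
  rw [abs_le]; constructor <;> linarith

lemma abs_gridMeans_le {q : ℕ} {s : ℝ} (hs : 0 ≤ s) (v : Fin k × Fin d → Fin q) (i : Fin k)
    (j : Fin d) : |gridMeans s v i j| ≤ s * q := by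
  unfold gridMeans
  rw [abs_of_nonneg (by positivity)]
  gcongr
  exact (v (i, j)).2.le

lemma sum_sq_le_of_abs_le {x : Fin d → ℝ} {y e : ℝ} (hx : ∀ j, |x j| ≤ y) (hy : d * y ^ 2 = e) :
    ∑ j, x j ^ 2 ≤ e := by
  calc ∑ j, x j ^ 2 ≤ ∑ _j : Fin d, y ^ 2 := Finset.sum_le_sum fun j _ => by
        rw [← sq_abs]; gcongr; exact hx j
    _ = e := by simp [hy]

/-- A row with `h` mismatches has distance at least `s * √h`, and `√h ≥ h / √d` since `h ≤ d`; this
makes the bound linear in the Hamming distance. -/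
lemma sum_sqrt_gridMeans_ge {q : ℕ} (hd : 0 < d) (s : ℝ)
    (v w : Fin k × Fin d → Fin q) :
    s * hammingDist v w / Real.sqrt d ≤
      ∑ i, Real.sqrt (∑ j, (gridMeans s v i j - gridMeans s w i j) ^ 2) := by
  classical
  have hd0 : (0 : ℝ) < d := by exact_mod_cast hd
  have hham : (hammingDist v w : ℝ) = ∑ i, ∑ j, if v (i, j) = w (i, j) then (0 : ℝ) else 1 := by
    rw [← Fintype.sum_prod_type' (f := fun i j => if v (i, j) = w (i, j) then (0 : ℝ) else 1)]
    rw [hammingDist, Finset.card_filter]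
    push_cast
    exact Finset.sum_congr rfl fun p _ => by simp only [ne_eq, ite_not]
  rw [hham, Finset.mul_sum, Finset.sum_div]
  refine Finset.sum_le_sum fun i _ => ?_
  set h := ∑ j, if v (i, j) = w (i, j) then (0 : ℝ) else 1 with hh
  have h0 : 0 ≤ h := Finset.sum_nonneg fun j _ => by split_ifs <;> norm_num
  have h1 : h ≤ d := by
    calc h ≤ ∑ _j : Fin d, (1 : ℝ) := Finset.sum_le_sum fun j _ => by split_ifs <;> norm_num
      _ = d := by simp
  refine Real.le_sqrt_of_sq_le ?_
  calc (s * h / Real.sqrt d) ^ 2 = s ^ 2 * (h * (h / d)) := by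
        rw [div_pow, Real.sq_sqrt hd0.le]; ring
    _ ≤ s ^ 2 * (h * 1) := by gcongr; rw [div_le_one hd0]; exact h1
    _ = ∑ j, s ^ 2 * (if v (i, j) = w (i, j) then (0 : ℝ) else 1) := by
        rw [mul_one, hh, Finset.mul_sum]
    _ ≤ _ := by
        refine Finset.sum_le_sum fun j _ => ?_
        split_ifs with hvw
        · rw [mul_zero]; exact sq_nonneg _
        · unfold gridMeans
          rw [← mul_sub, mul_pow]
          refine mul_le_mul_of_nonneg_left ?_ (sq_nonneg _)
          have hne : ((v (i, j) : ℕ) : ℤ) - ((w (i, j) : ℕ) : ℤ) ≠ 0 := fun h0 =>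
            hvw (Fin.ext (by omega))
          have h2 : (1 : ℤ) ≤ (((v (i, j) : ℕ) : ℤ) - ((w (i, j) : ℕ) : ℤ)) ^ 2 := by
            have := sq_pos_of_ne_zero hne
            omega
          exact_mod_cast h2

/-- The mixtures with means on a grid are separated in terms of the Hamming distance. -/
lemma hammingDist_le_of_tvDist_le {q : ℕ} (hk : 0 < k) (hd : 0 < d) {ε : ℝ} (hε : 0 < ε)
    (hεq : 64 * ε * q ≤ 1) (v w : Fin k × Fin d → Fin q)
    (htv : tvDist (spreadMixture hk (2 + 2 / ε) (gridMeans (64 * ε / Real.sqrt d) v))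
      (spreadMixture hk (2 + 2 / ε) (gridMeans (64 * ε / Real.sqrt d) w)) ≤ ε) :
    8 * hammingDist v w ≤ k * d := by
  have hd0 : (1 : ℝ) ≤ d := by exact_mod_cast hd
  have hk0 : (0 : ℝ) < k := by exact_mod_cast hk
  have hsd : 1 ≤ Real.sqrt d := Real.one_le_sqrt.2 hd0
  have hsd2 : Real.sqrt d ^ 2 = d := Real.sq_sqrt (by linarith)
  obtain ⟨s, hs⟩ : ∃ s, s = 64 * ε / Real.sqrt d := ⟨_, rfl⟩
  rw [← hs] at htv
  have hs0 : 0 ≤ s := by rw [hs]; positivity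
  have hsq : s * q ≤ 1 := by
    refine le_trans ?_ hεq
    rw [hs]
    gcongr
    exact div_le_self (by positivity) hsd
  have hsum : d * (s * q) ^ 2 = (64 * ε * q) ^ 2 := by
    rw [hs, mul_pow, div_pow, hsd2]; field_simp
  have h := le_tvDist_spreadMixture hk hd (R := 2 + 2 / ε) (by
      have : 0 < 2 / ε := by positivity
      linarith) (gridMeans s v) (gridMeans s w)
    (fun i j => (abs_gridMeans_le hs0 v i j).trans hsq)
    (fun i j => (abs_gridMeans_le hs0 w i j).trans hsq)
    (fun i => (sum_sq_le_of_abs_le (abs_gridMeans_sub_le hs0 v w i) hsum).trans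
      (pow_le_one₀ (by positivity) hεq))
  rw [← Finset.mul_sum] at h
  -- The radius `2 + 2 / ε` is chosen so that the two tails together cost at most `ε`.
  have htail : 1 / (2 + 2 / ε - 1) ^ 2 ≤ ε / 2 := by
    have h2 : 0 < 2 / ε := by positivity
    rw [show ε / 2 = 1 / (2 / ε) by field_simp]
    refine one_div_le_one_div_of_le h2 ?_
    calc 2 / ε ≤ 2 + 2 / ε - 1 := by linarith
      _ ≤ _ := le_self_pow₀ (by linarith) two_ne_zero
  have hham := sum_sqrt_gridMeans_ge hd s v w
  have e1 : s * hammingDist v w / Real.sqrt d = 64 * ε * (hammingDist v w / d) := by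
    rw [hs, div_mul_eq_mul_div, div_div, ← sq, hsd2]; ring
  rw [e1] at hham
  -- The left side is `16 * ε` times the relative Hamming distance, by the factor 64 in the grid
  -- width; hence that distance is at most `1 / 8`.
  have h3 : (k : ℝ)⁻¹ * (1 / 4 * (64 * ε * (hammingDist v w / d))) ≤ 2 * ε := by
    have : (k : ℝ)⁻¹ * (1 / 4 * (64 * ε * (hammingDist v w / d))) ≤ (k : ℝ)⁻¹ * (1 / 4 *
        ∑ i, Real.sqrt (∑ j, (gridMeans s v i j - gridMeans s w i j) ^ 2)) := by gcongr
    linarith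
  have h4 : (k : ℝ)⁻¹ * (1 / 4 * (64 * ε * (hammingDist v w / d))) =
      2 * ε * (8 * hammingDist v w / (k * d)) := by field_simp; ring
  rw [h4] at h3
  have h5 : 8 * (hammingDist v w : ℝ) / (k * d) ≤ 1 :=
    le_of_mul_le_mul_left (by linarith) (show 0 < 2 * ε by positivity)
  rw [div_le_one (by positivity)] at h5
  exact_mod_cast h5

/-- A realizable learner must use enough samples to tell apart the words of a packing. -/
lemma pow_le_of_isRealizablePACLearner {p q : ℕ} (hp : 0 < p) (hq : q = p ^ 8) (hk : 0 < k)
    (hd : 0 < d) {L : LearningMethod (EuclideanSpace ℝ (Fin d))} {m : ℝ → ℝ → ℕ}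
    (hL : IsRealizablePACLearner (kMixtures (axisAlignedGaussians d) k) L m) {ε δ : ℝ}
    (hε : 0 < ε) (hεq : 64 * ε * q ≤ 1) (hδ : 0 < δ) (hδ2 : δ ≤ 1 / 2) :
    (q : ℝ) ^ (k * d) ≤
      4 * (Real.exp (m ε δ * (64 * ε * q) ^ 2) * (2 * p) ^ (k * d)) := by
  classical
  have hd0 : (0 : ℝ) < d := by exact_mod_cast hd
  set n := m ε δ with hn
  obtain ⟨s, hs⟩ : ∃ s, s = 64 * ε / Real.sqrt d := ⟨_, rfl⟩
  have hs0 : 0 ≤ s := by rw [hs]; positivity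
  have hsum : d * (s * q) ^ 2 = (64 * ε * q) ^ 2 := by
    rw [hs, mul_pow, div_pow, Real.sq_sqrt hd0.le]; field_simp
  set f : (Fin k × Fin d → Fin q) → ProbabilityMeasure (EuclideanSpace ℝ (Fin d)) :=
    fun v => spreadMixture hk (2 + 2 / ε) (gridMeans s v) with hf
  set F : (Fin k × Fin d → Fin q) → Set (Fin n → EuclideanSpace ℝ (Fin d)) :=
    fun v => {S | ¬ IsApprox ε (f v) (L ε δ n S)} with hF
  set T : (Fin n → Fin k × (Fin d → ℝ)) → Fin n → EuclideanSpace ℝ (Fin d) :=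
    fun x t => spread (2 + 2 / ε) (x t) with hT
  have hTm : Measurable T := measurable_pi_lambda _ fun t =>
    (measurable_spread _).comp (measurable_pi_apply t)
  -- The learner is not assumed measurable, so success is replaced by the complement of a measurable
  -- hull of failure, which has the same probability bound.
  set G : (Fin k × Fin d → Fin q) → Set (Fin n → Fin k × (Fin d → ℝ)) :=
    fun v => T ⁻¹' (toMeasurable (sampleLaw (f v) n) (F v))ᶜ with hG
  have hGm : ∀ v, MeasurableSet (G v) := fun v => hTm (measurableSet_toMeasurable _ _).compl
  have hprob := fun a : Fin k → Fin d → ℝ => isProbabilityMeasure_labelledNormal hk a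
  have hlaw : ∀ v, sampleLaw (f v) n =
      (Measure.pi fun _ : Fin n => labelledNormal (gridMeans s v)).map T := by
    intro v
    have := Measure.pi_map_pi (μ := fun _ : Fin n => labelledNormal (gridMeans s v))
      (f := fun _ => spread (2 + 2 / ε)) fun _ => (measurable_spread _).aemeasurable
    rw [hT, this]
    simp only [hf, sampleLaw, coe_spreadMixture]
  have hhalf : ∀ v, ENNReal.ofReal (1 / 2) ≤
      (Measure.pi fun _ : Fin n => labelledNormal (gridMeans s v)) (G v) := by
    intro v
    rw [hG, ← Measure.map_apply hTm (measurableSet_toMeasurable _ _).compl, ← hlaw,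
      prob_compl_eq_one_sub (measurableSet_toMeasurable _ _), measure_toMeasurable]
    have h1 := hL (f v) (spreadMixture_mem hk _ _) ε δ hε hδ
    have h2 : sampleLaw (f v) n (F v) ≤ ENNReal.ofReal (1 / 2) :=
      h1.trans (ENNReal.ofReal_le_ofReal hδ2)
    calc ENNReal.ofReal (1 / 2) = 1 - ENNReal.ofReal (1 / 2) := by
          rw [← ENNReal.ofReal_one, ← ENNReal.ofReal_sub _ (by norm_num)]; norm_num
      _ ≤ _ := tsub_le_tsub_left h2 _
  -- Success has probability at least `1 / 2`, of which the change of measure loses `1 / 4`.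
  have hquarter : ∀ v, 1 / 4 ≤ Real.exp (n * (64 * ε * q) ^ 2) *
      (Measure.pi fun _ : Fin n => labelledNormal (0 : Fin k → Fin d → ℝ)).real (G v) := by
    intro v
    have h := (hhalf v).trans (pi_labelledNormal_le hk n
      (fun i => sum_sq_le_of_abs_le (abs_gridMeans_le hs0 v i) hsum) (hGm v))
    rw [← ofReal_measureReal, ← ENNReal.ofReal_mul (Real.exp_pos _).le,
      ← ENNReal.ofReal_add (by norm_num) (by positivity),
      ENNReal.ofReal_le_ofReal_iff (by positivity)] at h
    linarith
  -- Words that succeed on the same sample share one output, so their mixtures are within total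
  -- variation `ε` of each other and the words lie in one Hamming ball around any of them.
  have hpack := sum_measureReal_le
    (Measure.pi fun _ : Fin n => labelledNormal (0 : Fin k → Fin d → ℝ)) hGm
    (M := (2 * p) ^ (k * d)) (by
      intro x Y hY
      rcases Y.eq_empty_or_nonempty with rfl | ⟨w, hw⟩
      · simp only [Finset.card_empty, Nat.cast_zero]; positivity
      · have hsucc : ∀ v ∈ Y, l1Dist (L ε δ n (T x)) (f v) ≤ ε := by
          intro v hv
          by_contra hne
          exact hY v hv (subset_toMeasurable _ _ hne)
        have := card_le_of_hammingDist_le hp hq w Y (by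
          intro v hv
          rw [Fintype.card_prod, Fintype.card_fin, Fintype.card_fin]
          refine hammingDist_le_of_tvDist_le hk hd hε hεq v w ?_
          rw [← hs]
          have h1 := hsucc v hv
          have h2 := hsucc w hw
          unfold l1Dist at h1 h2
          rw [tvDist_comm] at h1
          have h3 := tvDist_triangle (f v) (L ε δ n (T x)) (f w)
          change tvDist (f v) (f w) ≤ ε
          linarith)
        simpa using this)
  have hcard := Finset.card_nsmul_le_sum Finset.univ _ _ fun v _ => hquarter v
  rw [← Finset.mul_sum, nsmul_eq_mul, Finset.card_univ, Fintype.card_fun, Fintype.card_prod,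
    Fintype.card_fin, Fintype.card_fin, Fintype.card_fin, Nat.cast_pow] at hcard
  have h2 := mul_le_mul_of_nonneg_left hpack (Real.exp_pos (n * (64 * ε * q) ^ 2)).le
  linarith

/-- Every realizable learner for mixtures of axis-aligned Gaussians needs at least a constant times
`k * d / ε ^ 2` samples. -/
theorem exists_sampleComplexity_lower_bound : ∃ c ε₀ : ℝ, 0 < c ∧ 0 < ε₀ ∧
    ∀ d k : ℕ, 1 ≤ d → 1 ≤ k →
      ∀ (L : LearningMethod (EuclideanSpace ℝ (Fin d))) (m : ℝ → ℝ → ℕ),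
        IsRealizablePACLearner (kMixtures (axisAlignedGaussians d) k) L m →
        ∀ ε δ : ℝ, 0 < ε → ε < ε₀ → 0 < δ → δ ≤ 1 / 2 →
          c * ((k : ℝ) * d / ε ^ 2) ≤ (m ε δ : ℝ) := by
  -- With `p = 4` the packing inequality, using `4 ≤ 4 ^ N`, loses a factor `4 * (2 * p) = 32` per
  -- coordinate, and `32 * exp 1 ≤ 4 ^ 8 = q` leaves a full factor `exp N`.
  obtain ⟨q, hq⟩ : ∃ q : ℕ, q = 4 ^ 8 := ⟨_, rfl⟩
  have hqr : (q : ℝ) = 4 ^ 8 := by rw [hq]; norm_num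
  have hq0 : (0 : ℝ) < q := by rw [hqr]; norm_num
  refine ⟨1 / (64 * q) ^ 2, 1 / (64 * q), by positivity, by positivity,
    fun d k hd hk L m hL ε δ hε hε0 hδ hδ2 => ?_⟩
  rw [lt_div_iff₀ (by positivity)] at hε0
  have h := pow_le_of_isRealizablePACLearner (by norm_num) hq hk hd hL hε (by linarith) hδ hδ2
  obtain ⟨N, hN⟩ : ∃ N, N = k * d := ⟨_, rfl⟩
  have hN1 : 1 ≤ N := by rw [hN]; exact Nat.mul_pos hk hd
  rw [← hN] at h
  have h4 : (4 : ℝ) ≤ 4 ^ N := le_self_pow₀ (by norm_num) (by omega)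
  have hexp : Real.exp N ≤ Real.exp (m ε δ * (64 * ε * q) ^ 2) := by
    have h5 : Real.exp N * 32 ^ N ≤ Real.exp (m ε δ * (64 * ε * q) ^ 2) * 32 ^ N := by
      calc Real.exp N * 32 ^ N = (Real.exp 1 * 32) ^ N := by
            rw [mul_pow, ← Real.exp_nat_mul, mul_one]
        _ ≤ (q : ℝ) ^ N := by
            gcongr
            rw [hqr]
            linarith [Real.exp_one_lt_d9]
        _ ≤ 4 ^ N * (Real.exp (m ε δ * (64 * ε * q) ^ 2) * (2 * (4 : ℕ)) ^ N) := by
            refine h.trans ?_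
            gcongr
        _ = Real.exp (m ε δ * (64 * ε * q) ^ 2) * ((4 : ℝ) * (2 * (4 : ℕ))) ^ N := by
            rw [mul_pow (4 : ℝ)]; ring
        _ = _ := by norm_num
    exact le_of_mul_le_mul_right h5 (by positivity)
  have hfin := Real.exp_le_exp.1 hexp
  rw [hN] at hfin
  push_cast at hfin
  rw [← mul_div_assoc, div_le_iff₀ (by positivity), one_div, inv_mul_le_iff₀ (by positivity)]
  linarith

end LowerBound

theorem mainTheorem6 :
    (∃ K : ℝ, 0 < K ∧ ∀ d k : ℕ, 1 ≤ d → 2 ≤ k →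
      ∃ (L : LearningMethod (EuclideanSpace ℝ (Fin d))) (m : ℝ → ℝ → ℕ),
        IsAgnosticPACLearner 9 (kMixtures (axisAlignedGaussians d) k) L m ∧
        IsRealizablePACLearner (kMixtures (axisAlignedGaussians d) k) L m ∧
        ∀ ε δ : ℝ, 0 < ε → 0 < δ → δ < 1 →
          (m ε δ : ℝ) ≤ K * ((k : ℝ) * d * Real.log k * Real.log (k / δ) / ε ^ 4)) ∧
    (∃ c ε₀ : ℝ, 0 < c ∧ 0 < ε₀ ∧ ∀ d k : ℕ, 1 ≤ d → 1 ≤ k →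
      ∀ (L : LearningMethod (EuclideanSpace ℝ (Fin d))) (m : ℝ → ℝ → ℕ),
        IsRealizablePACLearner (kMixtures (axisAlignedGaussians d) k) L m →
        ∀ ε δ : ℝ, 0 < ε → ε < ε₀ → 0 < δ → δ ≤ 1 / 2 →
          c * ((k : ℝ) * d / ε ^ 2) ≤ (m ε δ : ℝ)) := by
  refine ⟨?_, exists_sampleComplexity_lower_bound⟩
  obtain ⟨K, hK, h⟩ := exists_agnostic_learner_kMixtures
  refine ⟨K, hK, fun d k hd hk => ?_⟩
  obtain ⟨L, m, hL, hm⟩ := h d k hd hk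
  exact ⟨L, m, hL, hL.isRealizablePACLearner, hm⟩
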